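/- **Setting.** A linear representation $(\xi,A,B,\eta)$ of size $m$ consists of $\xi,\eta\in\mathbb R_{\ge 0}^m$ and $A,B\in\mathbb R_{\ge0}^{m\times m}$. Let $\mu$ be the monoid morphism from $\{a,b\}^*$ to $m\times m$ matrices with $\mu(a)=A$, $\mu(b)=B$. For every $n$ with $\xi'(A+B)^n\eta>0$, choose a word $w\in\{a,b\}^n$ with probability $$\Pr(w)=\frac{\xi'\mu(w)\eta}{\sum_{v\in\{a,b\}^n}\xi'\mu(v)\eta},$$ and let $Y_n=|w|_a$ be the number of occurrences of $a$ in $w$. The pair $(A,B)$ is *aperiodic* if the greatest common divisor of all differences $|\ell(C_1)|_a-|\ell(C_2)|_a$ equals $1$. Here $C_1,C_2$ range over the cycles (closed walks) of equal length in the directed graph on $\{1,\dots,m\}$ that has an edge $i\to j$ labelled $a$ whenever $A_{ij}>0$ and an edge $i\to j$ labelled $b$ whenever $B_{ij}>0$; $\ell(C)$ is the word of labels read along $C$. If $A+B$ is primitive with Perron–Frobenius eigenvalue $\lambda$, let $u(z)$ be the analytic function near $z=0$ with $\det(u(z)I-Ae^z-B)=0$ and $u(0)=\lambda$, and put $\beta=u'(0)/\lambda$.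 **Equipotent communicating bicomponent model.** Let $(\xi_1,A_1,B_1,\eta_1)$ and $(\xi_2,A_2,B_2,\eta_2)$ be linear representations of sizes $m_1,m_2$, let $A_0,B_0\in\mathbb R_{\ge0}^{m_1\times m_2}$, and let $Y_n$ be defined by $$\xi=\begin{pmatrix}\xi_1\\ \xi_2\end{pmatrix},\quad A=\begin{pmatrix}A_1&A_0\\0&A_2\end{pmatrix},\quad B=\begin{pmatrix}B_1&B_0\\0&B_2\end{pmatrix},\quad \eta=\begin{pmatrix}\eta_1\\ \eta_2\end{pmatrix}.$$ Assume that $\xi_1\ne0$, $\eta_2\neq 0$, $A_0+B_0\neq0$, that $M_1=A_1+B_1$ and $M_2=A_2+B_2$ are primitive, and that their Perron–Frobenius eigenvalues are equal. Let $\beta_1,\beta_2$ be the constants $\beta$ of $(A_1,B_1)$ and $(A_2,B_2)$. **Theorem.** Assume moreover that $\beta_1\ne\beta_2$ and that both pairs $(A_1,B_1)$ and $(A_2,B_2)$ are aperiodic. Put $b_1=\min\{\beta_1,\beta_2\}$, $b_2=\max\{\beta_1,\beta_2\}$ and $f_U=\frac1{b_2-b_1}\chi_{[b_1,b_2]}$,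 the uniform density on $[b_1,b_2]$. Let $x$ be a real number with $x\ne\beta_1$ and $x\neq\beta_2$, and let $k=k(n)\in\mathbb N$ be any sequence with $\lim_{n\to\infty}k(n)/n=x$. Then, as $n\to\infty$, $$\bigl|\,n\Pr(Y_n=k(n))-f_U(x)\,\bigr|=O(n^{-1/2}).$$ -/

import Mathlib

open Matrix Filter Topology Asymptotics

noncomputable section

/-- The binary alphabet `{a, b}`. -/
inductive Letter
  | a
  | b
  deriving DecidableEq

instance : Fintype Letter where
  elems := {Letter.a, Letter.b}
  complete := by rintro (_ | _) <;> simp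

namespace RationalModel

/-! ### Pairs of matrices: transition graph and aperiodicity -/

section Pair

variable {ι : Type*} (A B : Matrix ι ι ℝ)

/-- The transition matrix of a letter: `A` for the letter `a`, `B` for the letter `b`. -/
def letterMatrix : Letter → Matrix ι ι ℝ
  | Letter.a => A
  | Letter.b => B

/-- `IsPath A B i w j`: in the transition graph of `(A, B)`, which has an edge from `i` to `j`
labelled `a` (resp. `b`) whenever `0 < A i j` (resp. `0 < B i j`), there is a path from `i` to `j`
whose labels, read in order, form the word `w`. -/
inductive IsPath : ι → List Letter → ι → Prop
  | nil (i : ι) : IsPath i [] i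
  | cons {i j k : ι} {σ : Letter} {w : List Letter} :
      0 < letterMatrix A B σ i j → IsPath j w k → IsPath i (σ :: w) k

/-- `w` is the label of a cycle (closed path) of the transition graph. -/
def IsCycleLabel (w : List Letter) : Prop := ∃ i : ι, IsPath A B i w i

/-- The differences of the numbers of occurrences of `a` in the labels of two cycles having
equal length. -/
def cycleDifferences : Set ℤ :=
  {z | ∃ w₁ w₂ : List Letter, IsCycleLabel A B w₁ ∧ IsCycleLabel A B w₂ ∧
    w₁.length = w₂.length ∧ z = (w₁.count Letter.a : ℤ) - (w₂.count Letter.a : ℤ)}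

/-- The pair `(A, B)` is aperiodic: the greatest common divisor of all the cycle differences
is `1`, i.e. `1` is their only common divisor in `ℕ`. (If all differences vanish, then `0` is a
common divisor, and the pair is not aperiodic.) -/
def IsAperiodicPair : Prop :=
  ∀ d : ℕ, (∀ z ∈ cycleDifferences A B, (d : ℤ) ∣ z) → d = 1

variable [Fintype ι] [DecidableEq ι]

/-- The Perron–Frobenius eigenvalue of a (nonnegative, irreducible) real matrix: its spectral
radius, that is, the largest modulus of its complex eigenvalues. -/
def perronRoot (M : Matrix ι ι ℝ) : ℝ :=
  (spectralRadius ℂ (M.map Complex.ofReal)).toReal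

/-- `u` is a solution, analytic at `0`, of `Det(I u - A e^z - B) = 0` in a neighbourhood of
`z = 0`, subject to `u 0 = λ`, with `λ` the Perron–Frobenius eigenvalue of `A + B`. -/
def IsMainBranch (u : ℂ → ℂ) : Prop :=
  AnalyticAt ℂ u 0 ∧ u 0 = (perronRoot (A + B) : ℂ) ∧
    ∀ᶠ z in 𝓝 (0 : ℂ),
      Matrix.det (u z • (1 : Matrix ι ι ℂ) - Complex.exp z • A.map Complex.ofReal
        - B.map Complex.ofReal) = 0

/-- The implicitly defined function `u(z)`. For primitive `A + B` the value `λ` is a simple root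
of the characteristic polynomial, so the germ of `u` at `0` exists and is unique. -/
def mainBranch : ℂ → ℂ := Classical.epsilon (IsMainBranch A B)

/-- The constant `β = u'(0) / λ` (a real number; it is the leading term of the mean value). -/
def beta : ℝ := (deriv (mainBranch A B) 0).re / perronRoot (A + B)

end Pair

/-! ### Linear representations and the random variable `Y_n` -/

/-- A linear representation `(ξ, A, B, η)` with nonnegative entries. -/
structure LinearRep (ι : Type*) where
  ξ : ι → ℝ
  A : Matrix ι ι ℝ
  B : Matrix ι ι ℝ
  η : ι → ℝ
  ξ_nonneg : ∀ i, 0 ≤ ξ i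
  A_nonneg : ∀ i j, 0 ≤ A i j
  B_nonneg : ∀ i j, 0 ≤ B i j
  η_nonneg : ∀ i, 0 ≤ η i

namespace LinearRep

variable {ι : Type*} (R : LinearRep ι)

/-- The matrix `M = A + B`. -/
def M : Matrix ι ι ℝ := R.A + R.B

variable [Fintype ι] [DecidableEq ι]

/-- The constant `β` of the representation. -/
def beta : ℝ := RationalModel.beta R.A R.B

/-- The monoid morphism `μ` from words to matrices with `μ(a) = A`, `μ(b) = B`. -/
def μ (w : List Letter) : Matrix ι ι ℝ := (w.map (letterMatrix R.A R.B)).prod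

/-- The value `(r, w) = ξ' μ(w) η` of the rational series at the word `w`. -/
def series (w : List Letter) : ℝ := R.ξ ⬝ᵥ (R.μ w *ᵥ R.η)

/-- The probability of the word `w` of length `n`:
`Pr(w) = (r, w) / ∑ (r, x)`, the sum over all words `x` of length `n`. -/
def wordProb (n : ℕ) (w : Fin n → Letter) : ℝ :=
  R.series (List.ofFn w) / ∑ x : Fin n → Letter, R.series (List.ofFn x)

/-- `Pr(Y_n = k)`, where `Y_n = |w|_a` is the number of occurrences of `a` in a word `w` of
length `n` drawn with probability `Pr(w)`. -/
def probY (n k : ℕ) : ℝ :=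
  ∑ w : Fin n → Letter with (List.ofFn w).count Letter.a = k, R.wordProb n w

end LinearRep

/-! ### Communicating bicomponent models -/

/-- A communicating bicomponent model: two linear representations `(ξ₁, A₁, B₁, η₁)` and
`(ξ₂, A₂, B₂, η₂)` with irreducible matrices `M₁`, `M₂`, together with transitions `A₀`, `B₀`
from the first to the second, such that `ξ₁ ≠ 0 ≠ η₂` and `A₀ + B₀ ≠ 0`. -/
structure BicomponentModel (ι₁ ι₂ : Type*) where
  fst : LinearRep ι₁
  snd : LinearRep ι₂
  A₀ : Matrix ι₁ ι₂ ℝ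
  B₀ : Matrix ι₁ ι₂ ℝ
  A₀_nonneg : ∀ i j, 0 ≤ A₀ i j
  B₀_nonneg : ∀ i j, 0 ≤ B₀ i j
  fst_irreducible : fst.M.IsIrreducible
  snd_irreducible : snd.M.IsIrreducible
  fst_ξ_ne_zero : fst.ξ ≠ 0
  snd_η_ne_zero : snd.η ≠ 0
  M₀_ne_zero : A₀ + B₀ ≠ 0

namespace BicomponentModel

variable {ι₁ ι₂ : Type*} (R : BicomponentModel ι₁ ι₂)

/-- The linear representation `ξ = (ξ₁, ξ₂)`, `A = (A₁ A₀; 0 A₂)`, `B = (B₁ B₀; 0 B₂)`,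
`η = (η₁, η₂)` that defines `Y_n`. -/
def toLinearRep : LinearRep (ι₁ ⊕ ι₂) where
  ξ := Sum.elim R.fst.ξ R.snd.ξ
  A := Matrix.fromBlocks R.fst.A R.A₀ 0 R.snd.A
  B := Matrix.fromBlocks R.fst.B R.B₀ 0 R.snd.B
  η := Sum.elim R.fst.η R.snd.η
  ξ_nonneg := by
    rintro (i | i)
    · exact R.fst.ξ_nonneg i
    · exact R.snd.ξ_nonneg i
  A_nonneg := by
    rintro (i | i) (j | j)
    · exact R.fst.A_nonneg i j
    · exact R.A₀_nonneg i j
    · exact le_refl (0 : ℝ)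
    · exact R.snd.A_nonneg i j
  B_nonneg := by
    rintro (i | i) (j | j)
    · exact R.fst.B_nonneg i j
    · exact R.B₀_nonneg i j
    · exact le_refl (0 : ℝ)
    · exact R.snd.B_nonneg i j
  η_nonneg := by
    rintro (i | i)
    · exact R.fst.η_nonneg i
    · exact R.snd.η_nonneg i

/-- Equipotent model: `M₁`, `M₂` are primitive and their Perron–Frobenius eigenvalues agree. -/
structure IsEquipotent [Fintype ι₁] [DecidableEq ι₁] [Fintype ι₂] [DecidableEq ι₂] : Prop where
  fst_primitive : R.fst.M.IsPrimitive
  snd_primitive : R.snd.M.IsPrimitive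
  perronRoot_eq : perronRoot R.fst.M = perronRoot R.snd.M

end BicomponentModel

/-- The density of the uniform distribution on the interval `[b₁, b₂]`. -/
def uniformDensity (b₁ b₂ x : ℝ) : ℝ :=
  (Set.Icc b₁ b₂).indicator (fun _ => 1 / (b₂ - b₁)) x

end RationalModel

end

/-! # Local limit law for equipotent communicating bicomponent models -/

/-! Dividing all matrices by the common Perron root changes no probability, so both components may
be assumed to have Perron root 1. With `N_j(s) = A_j e^s + B_j` for `j = 0, 1, 2`, the weight of the
words of length `n` with `k` letters `a` is the coefficient of `e^{ks}` in the generating function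
of the block representation, recovered by integrating against `e^{-ks}` over `s = iθ`, `|θ| ≤ π`. A
path crosses from the first component to the second at most once, so the generating function is a
term for each component plus the convolution `∑ ξ₁' N₁^i N₀ N₂^(n-1-i) η₂`.

Near `s = 0`, Perron-Frobenius theory and the implicit function theorem give `N_j^n = u_j^n P_j +
O(ρ^n)` for `j = 1, 2`, with `u_j` analytic, `u_j(0) = 1`, `u_j'(0) = β_j` and `P_j` a projection
onto a line (`exists_spectral_splitting`). Away from `0` on the imaginary axis, aperiodicity pushes
the spectral radius below 1 (`norm_lt_one_of_aperiodic`). `QuasiPower` records what the analysis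
needs of such a sequence.

The pure powers in the convolution sum to `(u₁^n - u₂^n) ab / (u₁ - u₂) = (u₁^n - u₂^n) ψ(s) / s`,
where `ψ(0) = a(0)b(0) / (β₁ - β₂)`. Because `u_j(τ)` is about `e^{β_j τ}` for small real `τ`, the
product `u_j^n e^{-ks}` becomes exponentially small when the contour moves to the right if `x >
β_j`, to the left if `x < β_j`; what remains is half a residue at `0`, whose sign depends on the
side. If `x` lies strictly between the drifts, the two contours move in opposite directions and the
half residues add up to `2π a(0)b(0) / |β₁ - β₂|` (`geomSmall_convolution`). If `x` lies outside,
one shift in a single direction makes the whole convolution exponentially small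
(`geomSmall_convolution_outside`). The single-component terms are exponentially small for every `x ≠
β_j`.

Hence the numerator of `Pr(Y_n = k)` is `κ f_U(x)` up to a geometrically small error, while the
denominator, the value at `s = 0`, is `κ n + O(1)` with the same `κ > 0`. The quotient gives an
error `O(1/n)`, stronger than the one claimed (`isBigO_quotient`). -/

namespace RationalModel

/-! ### Perron-Frobenius theory for primitive matrices -/

section Perron

variable {ι : Type*} [Fintype ι]

theorem mulVec_pos_of_pos {P : Matrix ι ι ℝ} (hP : ∀ i j, 0 < P i j) {x : ι → ℝ}
    (hx : ∀ i, 0 ≤ x i) (hx0 : x ≠ 0) (i : ι) : 0 < (P *ᵥ x) i := by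
  obtain ⟨j, hj⟩ := Function.ne_iff.mp hx0
  have hj' : 0 < x j := lt_of_le_of_ne (hx j) (Ne.symm hj)
  exact Finset.sum_pos' (fun k _ => mul_nonneg (hP i k).le (hx k))
    ⟨j, Finset.mem_univ _, mul_pos (hP i j) hj'⟩

theorem pow_mulVec_of_mulVec {R : Type*} [CommRing R] [DecidableEq ι] {N : Matrix ι ι R}
    {w : ι → R} {μ : R} (h : N *ᵥ w = μ • w) (n : ℕ) : (N ^ n) *ᵥ w = μ ^ n • w := by
  induction n with
  | zero => simp
  | succ n ih => rw [pow_succ, ← mulVec_mulVec, h, mulVec_smul, ih, smul_smul, pow_succ, mul_comm]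

theorem vecMul_pow_of_vecMul {R : Type*} [CommRing R] [DecidableEq ι] {N : Matrix ι ι R}
    {w : ι → R} {μ : R} (h : w ᵥ* N = μ • w) (n : ℕ) : w ᵥ* (N ^ n) = μ ^ n • w := by
  induction n with
  | zero => simp
  | succ n ih => rw [pow_succ, ← vecMul_vecMul, ih, smul_vecMul, h, smul_smul, pow_succ]

variable [DecidableEq ι]

/-- A nonnegative nonzero eigenvector of a primitive matrix is positive. -/
theorem pos_of_mulVec_eq {M : Matrix ι ι ℝ} (hM : M.IsPrimitive) {t : ℝ} (ht : 0 ≤ t)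
    {x : ι → ℝ} (hx : ∀ i, 0 ≤ x i) (hx0 : x ≠ 0) (h : M *ᵥ x = t • x) :
    0 < t ∧ ∀ i, 0 < x i := by
  obtain ⟨p, hp, hpos⟩ := hM.exists_pos_pow
  have key : ∀ i, 0 < t ^ p * x i := fun i => by
    have := mulVec_pos_of_pos hpos hx hx0 i
    rwa [pow_mulVec_of_mulVec h] at this
  have hxi : ∀ i, 0 < x i := fun i => by
    refine lt_of_le_of_ne (hx i) fun h0 => ?_
    have := key i
    rw [← h0, mul_zero] at this
    exact lt_irrefl _ this
  obtain ⟨j, -⟩ := Function.ne_iff.mp hx0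
  refine ⟨lt_of_le_of_ne ht fun h0 => ?_, hxi⟩
  have := key j
  rw [← h0, zero_pow hp.ne', zero_mul] at this
  exact lt_irrefl _ this

/-- Collatz-Wielandt argument: `t` is the largest number for which some `x` in the simplex satisfies
`t x ≤ M x`. The maximum exists by compactness, since summing the inequality over the entries bounds
`t` by the sum of all entries of `M`. -/
theorem exists_perron_vector [Nonempty ι] {M : Matrix ι ι ℝ} (hM : M.IsPrimitive) :
    ∃ t : ℝ, 0 < t ∧ ∃ v : ι → ℝ, (∀ i, 0 < v i) ∧ M *ᵥ v = t • v := by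
  obtain ⟨p, hp, hpos⟩ := hM.exists_pos_pow
  set b : ℝ := ∑ i, ∑ j, M i j with hb
  set K : Set ((ι → ℝ) × ℝ) :=
    (stdSimplex ℝ ι ×ˢ Set.Icc 0 b) ∩ {z | ∀ i, z.2 * z.1 i ≤ (M *ᵥ z.1) i} with hK
  have hKc : IsCompact K := by
    refine ((isCompact_stdSimplex ℝ ι).prod isCompact_Icc).inter_right ?_
    simp only [Set.ofPred_forall]
    refine isClosed_iInter fun i => isClosed_le (by fun_prop) ?_
    simp only [mulVec, dotProduct]
    fun_prop
  have hb0 : 0 ≤ b := Finset.sum_nonneg fun i _ => Finset.sum_nonneg fun j _ => hM.nonneg i j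
  have mul_nonneg' : ∀ x : ι → ℝ, (∀ i, 0 ≤ x i) → ∀ i, 0 ≤ (M *ᵥ x) i := fun x hx i =>
    Finset.sum_nonneg fun j _ => mul_nonneg (hM.nonneg i j) (hx j)
  have bound : ∀ (x : ι → ℝ) (t : ℝ), x ∈ stdSimplex ℝ ι → 0 ≤ t →
      (∀ i, t * x i ≤ (M *ᵥ x) i) → (x, t) ∈ K := by
    intro x t hx ht h
    refine ⟨⟨hx, ht, ?_⟩, h⟩
    calc t = ∑ i, t * x i := by rw [← Finset.mul_sum, hx.2, mul_one]
      _ ≤ ∑ i, (M *ᵥ x) i := Finset.sum_le_sum fun i _ => h i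
      _ ≤ b := Finset.sum_le_sum fun i _ => Finset.sum_le_sum fun j _ => by
          refine mul_le_of_le_one_right (hM.nonneg i j) ?_
          rw [← hx.2]
          exact Finset.single_le_sum (fun k _ => hx.1 k) (Finset.mem_univ j)
  obtain ⟨i₀⟩ := ‹Nonempty ι›
  have hne : K.Nonempty := ⟨(Pi.single i₀ 1, 0), bound _ _ (single_mem_stdSimplex ℝ i₀) le_rfl
    fun i => by
      rw [zero_mul]
      exact mul_nonneg' _ (single_mem_stdSimplex ℝ i₀).1 i⟩
  obtain ⟨⟨x, t⟩, hxt, hmax⟩ := hKc.exists_isMaxOn hne continuous_snd.continuousOn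
  have hx : x ∈ stdSimplex ℝ ι := hxt.1.1
  have ht : 0 ≤ t := hxt.1.2.1
  have hle : ∀ i, t * x i ≤ (M *ᵥ x) i := hxt.2
  have hx0 : x ≠ 0 := by
    rintro rfl
    have := hx.2
    simp at this
  have heq : M *ᵥ x = t • x := by
    -- Were `t x ≤ M x` not an equality, applying the positive matrix `M ^ p` to the defect would
    -- make every inequality strict for `y = M ^ p x`; the least relative gap `ε` could then be
    -- added to `t`, against maximality.
    by_contra hne
    set d : ι → ℝ := M *ᵥ x - t • x with hd
    have hd0 : d ≠ 0 := sub_ne_zero.mpr hne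
    have hdn : ∀ i, 0 ≤ d i := fun i => sub_nonneg.mpr (hle i)
    set y := (M ^ p) *ᵥ x with hy
    have hypos : ∀ i, 0 < y i := mulVec_pos_of_pos hpos hx.1 hx0
    have hgap : ∀ i, 0 < (M *ᵥ y) i - t * y i := by
      intro i
      have h1 := mulVec_pos_of_pos hpos hdn hd0 i
      have h2 : (M ^ p) *ᵥ d = M *ᵥ y - t • y := by
        rw [hd, mulVec_sub, mulVec_smul, hy, mulVec_mulVec, mulVec_mulVec, ← pow_succ, ← pow_succ']
      rwa [h2] at h1
    obtain ⟨k, hk⟩ := Finite.exists_min fun i => ((M *ᵥ y) i - t * y i) / y i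
    set ε := ((M *ᵥ y) k - t * y k) / y k
    have hε : 0 < ε := div_pos (hgap k) (hypos k)
    have hs : 0 < ∑ i, y i := Finset.sum_pos (fun i _ => hypos i) ⟨i₀, Finset.mem_univ _⟩
    have hmem : ((∑ i, y i)⁻¹ • y, t + ε) ∈ K := by
      refine bound _ _ ⟨fun i => mul_nonneg (inv_pos.mpr hs).le (hypos i).le, ?_⟩
        (add_nonneg ht hε.le) fun i => ?_
      · simp only [Pi.smul_apply, smul_eq_mul, ← Finset.mul_sum]
        exact inv_mul_cancel₀ hs.ne'
      · rw [mulVec_smul]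
        simp only [Pi.smul_apply, smul_eq_mul]
        have h3 := (le_div_iff₀ (hypos i)).mp (hk i)
        have h4 : (t + ε) * y i ≤ (M *ᵥ y) i := by linarith
        calc (t + ε) * ((∑ i, y i)⁻¹ * y i) = (∑ i, y i)⁻¹ * ((t + ε) * y i) := by ring
          _ ≤ _ := mul_le_mul_of_nonneg_left h4 (inv_pos.mpr hs).le
    have := hmax hmem
    simp only [Set.mem_ofPred_eq] at this
    linarith
  obtain ⟨h1, h2⟩ := pos_of_mulVec_eq hM ht hx.1 hx0 heq
  exact ⟨t, h1, x, h2, heq⟩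

theorem isPrimitive_transpose {M : Matrix ι ι ℝ} (hM : M.IsPrimitive) : Mᵀ.IsPrimitive := by
  obtain ⟨p, hp, hpos⟩ := hM.exists_pos_pow
  exact ⟨fun i j => hM.nonneg j i, p, hp, fun i j => by
    rw [← transpose_pow]
    exact hpos j i⟩

theorem isPrimitive_smul {M : Matrix ι ι ℝ} (hM : M.IsPrimitive) {c : ℝ} (hc : 0 < c) :
    (c • M).IsPrimitive := by
  obtain ⟨p, hp, hpos⟩ := hM.exists_pos_pow
  exact ⟨fun i j => mul_nonneg hc.le (hM.nonneg i j), p, hp, fun i j => by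
    rw [smul_pow]
    exact mul_pos (pow_pos hc p) (hpos i j)⟩

/-- A primitive matrix has positive left and right eigenvectors for a common positive
eigenvalue. -/
theorem exists_perron_pair [Nonempty ι] {M : Matrix ι ι ℝ} (hM : M.IsPrimitive) :
    ∃ t : ℝ, 0 < t ∧ ∃ v l : ι → ℝ, (∀ i, 0 < v i) ∧ (∀ i, 0 < l i) ∧ M *ᵥ v = t • v ∧
      l ᵥ* M = t • l ∧ l ⬝ᵥ v = 1 := by
  obtain ⟨t, ht, v, hv, hMv⟩ := exists_perron_vector hM
  obtain ⟨t', ht', l, hl, hMl⟩ := exists_perron_vector (isPrimitive_transpose hM)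
  rw [mulVec_transpose] at hMl
  have hlv : 0 < l ⬝ᵥ v := Finset.sum_pos (fun i _ => mul_pos (hl i) (hv i)) Finset.univ_nonempty
  have : t = t' := by
    have h1 : l ⬝ᵥ M *ᵥ v = t * (l ⬝ᵥ v) := by rw [hMv, dotProduct_smul, smul_eq_mul]
    have h2 : l ⬝ᵥ M *ᵥ v = t' * (l ⬝ᵥ v) := by
      rw [dotProduct_mulVec, hMl, smul_dotProduct, smul_eq_mul]
    exact mul_right_cancel₀ hlv.ne' (h1.symm.trans h2)
  subst this
  refine ⟨t, ht, v, (l ⬝ᵥ v)⁻¹ • l, hv, fun i => mul_pos (inv_pos.mpr hlv) (hl i), hMv, ?_, ?_⟩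
  · rw [smul_vecMul, hMl, smul_comm]
  · rw [smul_dotProduct, smul_eq_mul, inv_mul_cancel₀ hlv.ne']

section Domination

variable {M : Matrix ι ι ℝ} {N : Matrix ι ι ℂ} {l : ι → ℝ} {t : ℝ} {w : ι → ℂ} {μ : ℂ}

omit [DecidableEq ι] in
theorem norm_mul_norm_le (hN : ∀ i j, ‖N i j‖ ≤ M i j) (hw : N *ᵥ w = μ • w) (i : ι) :
    ‖μ‖ * ‖w i‖ ≤ (M *ᵥ fun j => ‖w j‖) i := by
  rw [← norm_mul, show μ * w i = (N *ᵥ w) i by rw [hw]; rfl]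
  refine (norm_sum_le _ _).trans (Finset.sum_le_sum fun j _ => ?_)
  rw [norm_mul]
  exact mul_le_mul_of_nonneg_right (hN i j) (norm_nonneg _)

omit [DecidableEq ι] in
theorem sum_mul_norm_pos (hl : ∀ i, 0 < l i) (hw0 : w ≠ 0) : 0 < l ⬝ᵥ fun j => ‖w j‖ := by
  obtain ⟨k, hk⟩ := Function.ne_iff.mp hw0
  exact Finset.sum_pos' (fun i _ => mul_nonneg (hl i).le (norm_nonneg _))
    ⟨k, Finset.mem_univ _, mul_pos (hl k) (norm_pos_iff.mpr hk)⟩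

omit [DecidableEq ι] in
/-- The eigenvalues of a complex matrix dominated entrywise by `M` are at most the Perron
eigenvalue of `M`. -/
theorem norm_le_of_dominated (hN : ∀ i j, ‖N i j‖ ≤ M i j) (hl : ∀ i, 0 < l i)
    (hlM : l ᵥ* M = t • l) (hw0 : w ≠ 0) (hw : N *ᵥ w = μ • w) : ‖μ‖ ≤ t := by
  have hpos := sum_mul_norm_pos hl hw0
  have h1 : ‖μ‖ * (l ⬝ᵥ fun j => ‖w j‖) ≤ t * (l ⬝ᵥ fun j => ‖w j‖) := by
    calc ‖μ‖ * (l ⬝ᵥ fun j => ‖w j‖) = ∑ i, l i * (‖μ‖ * ‖w i‖) := by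
          simp only [dotProduct, Finset.mul_sum]
          exact Finset.sum_congr rfl fun i _ => by ring
      _ ≤ l ⬝ᵥ (M *ᵥ fun j => ‖w j‖) := Finset.sum_le_sum fun i _ =>
          mul_le_mul_of_nonneg_left (norm_mul_norm_le hN hw i) (hl i).le
      _ = t * (l ⬝ᵥ fun j => ‖w j‖) := by
          rw [dotProduct_mulVec, hlM, smul_dotProduct, smul_eq_mul]
  exact le_of_mul_le_mul_right h1 hpos

omit [DecidableEq ι] in
-- The inequality `t |w| ≤ M |w|` becomes an equality after pairing with `l`. As all weights `l i`
-- are positive, it is an equality in every coordinate.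
theorem mulVec_norm_eq_of_dominated (hN : ∀ i j, ‖N i j‖ ≤ M i j) (hl : ∀ i, 0 < l i)
    (hlM : l ᵥ* M = t • l) (hw : N *ᵥ w = μ • w) (hμ : t ≤ ‖μ‖) :
    (M *ᵥ fun j => ‖w j‖) = t • fun j => ‖w j‖ := by
  have hle : ∀ i, l i * (t * ‖w i‖) ≤ l i * (M *ᵥ fun j => ‖w j‖) i := fun i =>
    mul_le_mul_of_nonneg_left ((mul_le_mul_of_nonneg_right hμ (norm_nonneg _)).trans
      (norm_mul_norm_le hN hw i)) (hl i).le
  have hsum : ∑ i, l i * (t * ‖w i‖) = ∑ i, l i * (M *ᵥ fun j => ‖w j‖) i := by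
    have : l ⬝ᵥ (M *ᵥ fun j => ‖w j‖) = t * (l ⬝ᵥ fun j => ‖w j‖) := by
      rw [dotProduct_mulVec, hlM, smul_dotProduct, smul_eq_mul]
    rw [dotProduct] at this
    rw [this, dotProduct, Finset.mul_sum]
    exact Finset.sum_congr rfl fun i _ => by ring
  have := (Finset.sum_eq_sum_iff_of_le fun i _ => hle i).mp hsum
  ext i
  exact (mul_left_cancel₀ (hl i).ne' (this i (Finset.mem_univ _))).symm

/-- Equality in the triangle inequality: all the terms have the same argument. -/
theorem eq_mul_of_sum_eq {κ : Type*} (s : Finset κ) {c : κ → ℂ} {r : κ → ℝ} {e : ℂ}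
    (he : ‖e‖ = 1) (hc : ∀ j ∈ s, ‖c j‖ ≤ r j) (hsum : ∑ j ∈ s, c j = (∑ j ∈ s, r j : ℝ) * e) :
    ∀ j ∈ s, c j = r j * e := by
  have hee : e * (starRingEnd ℂ) e = 1 := by
    rw [Complex.mul_conj, Complex.normSq_eq_norm_sq, he]
    simp
  have hre : ∀ j ∈ s, (c j * (starRingEnd ℂ) e).re ≤ r j := fun j hj =>
    (Complex.re_le_norm _).trans (by rw [norm_mul, Complex.norm_conj, he, mul_one]; exact hc j hj)
  have h1 : ∑ j ∈ s, (c j * (starRingEnd ℂ) e).re = ∑ j ∈ s, r j := by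
    rw [← Complex.re_sum, ← Finset.sum_mul, hsum, mul_assoc, hee, mul_one, Complex.ofReal_re]
  intro j hj
  have h2 := (Finset.sum_eq_sum_iff_of_le hre).mp h1 j hj
  have h3 : ‖c j * (starRingEnd ℂ) e‖ = (c j * (starRingEnd ℂ) e).re := by
    refine le_antisymm ?_ (Complex.re_le_norm _)
    rw [h2, norm_mul, Complex.norm_conj, he, mul_one]
    exact hc j hj
  have h4 : c j * (starRingEnd ℂ) e = r j := by
    rw [← h2, ← h3]
    exact (Complex.eq_coe_norm_of_nonneg (Complex.re_eq_norm.mp h3.symm))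
  rw [← h4, mul_assoc, mul_comm _ e, hee, mul_one]

/-- An eigenvector `w` of a dominated matrix whose eigenvalue has the largest possible modulus:
the entries of `w` do not vanish, and the phases are determined along the positive entries. -/
theorem phase_of_dominated (hM : M.IsPrimitive) (hN : ∀ i j, ‖N i j‖ ≤ M i j)
    (hl : ∀ i, 0 < l i) (hlM : l ᵥ* M = l) (hw0 : w ≠ 0) (hw : N *ᵥ w = μ • w)
    (hμ : 1 ≤ ‖μ‖) : ‖μ‖ = 1 ∧ (∀ i, w i ≠ 0) ∧
      ∀ i j, N i j * (w j / ‖w j‖) = M i j * (μ * (w i / ‖w i‖)) := by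
  have hlM' : l ᵥ* M = (1 : ℝ) • l := by rw [hlM, one_smul]
  have hμ1 : ‖μ‖ = 1 := le_antisymm (norm_le_of_dominated hN hl hlM' hw0 hw) hμ
  have heq := mulVec_norm_eq_of_dominated hN hl hlM' hw hμ
  have hpos : ∀ i, 0 < ‖w i‖ := by
    refine (pos_of_mulVec_eq hM zero_le_one (fun i => norm_nonneg _) (fun h => hw0 ?_) heq).2
    ext i
    exact norm_eq_zero.mp (congrFun h i)
  refine ⟨hμ1, fun i => norm_pos_iff.mp (hpos i), fun i j => ?_⟩
  have hne : ∀ i, ((‖w i‖ : ℝ) : ℂ) ≠ 0 := fun i => Complex.ofReal_ne_zero.mpr (hpos i).ne'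
  -- Row `i` of `N w = μ w` is an equality case of the triangle inequality: the terms add up to `μ w
  -- i`, whose modulus equals the sum of the bounds `M i j ‖w j‖`.
  have key := eq_mul_of_sum_eq Finset.univ (c := fun j => N i j * w j)
    (r := fun j => M i j * ‖w j‖) (e := μ * (w i / ‖w i‖))
    (by rw [norm_mul, norm_div, hμ1, Complex.norm_real, norm_norm, div_self (hpos i).ne', one_mul])
    (fun j _ => by
      rw [norm_mul]
      exact mul_le_mul_of_nonneg_right (hN i j) (norm_nonneg _))
    (by
      have h1 : ∑ j, N i j * w j = μ * w i := congrFun hw i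
      have h2 : ∑ j, M i j * ‖w j‖ = ‖w i‖ := by
        have := congrFun heq i
        rwa [one_smul] at this
      rw [h1, h2]
      field_simp [hne i]) j (Finset.mem_univ _)
  push_cast at key
  rw [← mul_div_assoc, key]
  field_simp [hne j]

end Domination

/-- For a primitive matrix with Perron eigenvalue `1`, an eigenvector whose eigenvalue has
modulus at least `1` is not orthogonal to the left Perron vector. -/
theorem dotProduct_ne_zero_of_eigen {M : Matrix ι ι ℝ} (hM : M.IsPrimitive) {l : ι → ℝ}
    (hl : ∀ i, 0 < l i) (hlM : l ᵥ* M = l) {w : ι → ℂ} {μ : ℂ} (hw0 : w ≠ 0)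
    (hw : M.map Complex.ofReal *ᵥ w = μ • w) (hμ : 1 ≤ ‖μ‖) :
    (fun i => (l i : ℂ)) ⬝ᵥ w ≠ 0 := by
  obtain ⟨p, hp, hpos⟩ := hM.exists_pos_pow
  have hMp : (M ^ p).IsPrimitive := ⟨fun i j => (hpos i j).le, 1, one_pos, by simpa using hpos⟩
  have hlMp : l ᵥ* (M ^ p) = l := by
    simpa using vecMul_pow_of_vecMul (μ := (1 : ℝ)) (by rwa [one_smul]) p
  have hmap : (M ^ p).map Complex.ofReal = (M.map Complex.ofReal) ^ p :=
    Matrix.map_pow (f := Complex.ofRealHom) M p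
  obtain ⟨h1, h2, h3⟩ := phase_of_dominated hMp (N := (M ^ p).map Complex.ofReal)
    (fun i j => by simp [abs_of_nonneg (hpos i j).le]) hl hlMp hw0
    (by rw [hmap]; exact pow_mulVec_of_mulVec hw p)
    (by rw [norm_pow]; exact one_le_pow₀ hμ)
  obtain ⟨i, -⟩ := Function.ne_iff.mp hw0
  set c := μ ^ p * (w i / ‖w i‖) with hc
  have hwj : ∀ j, w j = c * ‖w j‖ := by
    intro j
    have hne : ((‖w j‖ : ℝ) : ℂ) ≠ 0 := Complex.ofReal_ne_zero.mpr (norm_pos_iff.mpr (h2 j)).ne'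
    have h4 : w j / ‖w j‖ = c :=
      mul_left_cancel₀ (Complex.ofReal_ne_zero.mpr (hpos i j).ne') (h3 i j)
    rw [← h4, div_mul_cancel₀ _ hne]
  have hc0 : c ≠ 0 := fun h => h2 i (by rw [hwj i, h, zero_mul])
  have : (fun i => (l i : ℂ)) ⬝ᵥ w = c * ((l ⬝ᵥ fun j => ‖w j‖ : ℝ) : ℂ) := by
    simp only [dotProduct, Complex.ofReal_sum, Complex.ofReal_mul, Finset.mul_sum]
    refine Finset.sum_congr rfl fun j _ => ?_
    conv_lhs => rw [hwj j]
    ring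
  rw [this]
  exact mul_ne_zero hc0 (Complex.ofReal_ne_zero.mpr (sum_mul_norm_pos hl hw0).ne')

theorem exists_eigenvector_of_mem_spectrum {N : Matrix ι ι ℂ} {μ : ℂ} (h : μ ∈ spectrum ℂ N) :
    ∃ w : ι → ℂ, w ≠ 0 ∧ N *ᵥ w = μ • w := by
  rw [spectrum.mem_iff, Matrix.isUnit_iff_isUnit_det, isUnit_iff_ne_zero, not_not] at h
  obtain ⟨w, hw0, hw⟩ := Matrix.exists_mulVec_eq_zero_iff.mpr h
  refine ⟨w, hw0, ?_⟩
  rw [sub_mulVec, sub_eq_zero, Algebra.algebraMap_eq_smul_one, smul_mulVec, one_mulVec] at hw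
  exact hw.symm

/-- Domination of `M` by itself bounds every eigenvalue by `t`, and `v` shows that `t` is attained.
-/
theorem perronRoot_eq {M : Matrix ι ι ℝ} (hM : ∀ i j, 0 ≤ M i j) {v l : ι → ℝ} {t : ℝ}
    (ht : 0 < t) (hv : v ≠ 0) (hl : ∀ i, 0 < l i) (hMv : M *ᵥ v = t • v) (hlM : l ᵥ* M = t • l) :
    perronRoot M = t := by
  have hN : ∀ i j, ‖M.map Complex.ofReal i j‖ ≤ M i j := fun i j => by
    simp [abs_of_nonneg (hM i j)]
  have : spectralRadius ℂ (M.map Complex.ofReal) = ENNReal.ofReal t := by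
    refine le_antisymm (iSup₂_le fun μ hμ => ?_) ?_
    · obtain ⟨w, hw0, hw⟩ := exists_eigenvector_of_mem_spectrum hμ
      rw [← enorm_eq_nnnorm, ← ofReal_norm]
      exact ENNReal.ofReal_le_ofReal (norm_le_of_dominated hN hl hlM hw0 hw)
    · have hmem : (t : ℂ) ∈ spectrum ℂ (M.map Complex.ofReal) := by
        rw [spectrum.mem_iff, Matrix.isUnit_iff_isUnit_det, isUnit_iff_ne_zero, not_not,
          ← Matrix.exists_mulVec_eq_zero_iff]
        refine ⟨fun i => (v i : ℂ), fun h => hv ?_, ?_⟩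
        · ext i
          simpa using congrFun h i
        · rw [sub_mulVec, sub_eq_zero, Algebra.algebraMap_eq_smul_one, smul_mulVec, one_mulVec]
          ext i
          have := congrFun hMv i
          simp only [mulVec, dotProduct, Pi.smul_apply, smul_eq_mul] at this
          simp only [mulVec, dotProduct, Pi.smul_apply, smul_eq_mul, map_apply]
          exact_mod_cast this.symm
      refine le_trans ?_ (le_iSup₂ (α := ENNReal) (t : ℂ) hmem)
      rw [← enorm_eq_nnnorm, ← ofReal_norm, Complex.norm_real, Real.norm_of_nonneg ht.le]
  rw [perronRoot, this, ENNReal.toReal_ofReal ht.le]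

end Perron

/-! ### The matrices `A e^s + B` and their entrywise domination by the values at `Re s` -/

section Pencil

open scoped Matrix.Norms.Operator

variable {ι κ : Type*}

/-- The matrix `A e^s + B`. -/
noncomputable def pencil (A B : Matrix ι κ ℝ) (s : ℂ) : Matrix ι κ ℂ :=
  Complex.exp s • A.map Complex.ofReal + B.map Complex.ofReal

theorem pencil_apply (A B : Matrix ι κ ℝ) (s : ℂ) (i : ι) (j : κ) :
    pencil A B s i j = Complex.exp s * A i j + B i j := rfl

theorem pencil_zero (A B : Matrix ι κ ℝ) : pencil A B 0 = (A + B).map Complex.ofReal := by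
  ext i j
  simp [pencil_apply]

theorem pencil_add_period (A B : Matrix ι κ ℝ) (s : ℂ) :
    pencil A B (s + 2 * Real.pi * Complex.I) = pencil A B s := by
  ext i j
  simp [pencil_apply, Complex.exp_add, Complex.exp_two_pi_mul_I]

theorem pencil_ofReal (A B : Matrix ι κ ℝ) (t : ℝ) :
    pencil A B t = (Real.exp t • A + B).map Complex.ofReal := by
  ext i j
  simp [pencil_apply]

theorem norm_pencil_apply_le {A B : Matrix ι κ ℝ} (hA : ∀ i j, 0 ≤ A i j) (hB : ∀ i j, 0 ≤ B i j)
    (s : ℂ) (i : ι) (j : κ) : ‖pencil A B s i j‖ ≤ (Real.exp s.re • A + B) i j := by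
  rw [pencil_apply]
  refine (norm_add_le _ _).trans (le_of_eq ?_)
  rw [norm_mul, Complex.norm_exp, Complex.norm_real, Complex.norm_real,
    Real.norm_of_nonneg (hA i j), Real.norm_of_nonneg (hB i j)]
  rfl

theorem differentiable_pencil_apply (A B : Matrix ι κ ℝ) (i : ι) (j : κ) :
    Differentiable ℂ fun s => pencil A B s i j := by
  simp only [pencil_apply]
  fun_prop

theorem continuous_pencil (A B : Matrix ι ι ℝ) : Continuous (pencil A B) := by
  unfold pencil
  fun_prop

variable [Fintype ι] [DecidableEq ι]

theorem differentiable_pencil_pow_apply (A B : Matrix ι ι ℝ) (n : ℕ) (i j : ι) :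
    Differentiable ℂ fun s => (pencil A B s ^ n) i j := by
  induction n generalizing i j with
  | zero => simp
  | succ n ih =>
    simp only [pow_succ, Matrix.mul_apply]
    exact Differentiable.fun_sum fun k _ => (ih i k).mul (differentiable_pencil_apply A B k j)

theorem norm_pow_apply_le_of_dominated {N : Matrix ι ι ℂ} {M : Matrix ι ι ℝ}
    (h : ∀ i j, ‖N i j‖ ≤ M i j) (n : ℕ) (i j : ι) : ‖(N ^ n) i j‖ ≤ (M ^ n) i j := by
  induction n generalizing i j with
  | zero => by_cases hij : i = j <;> simp [hij]
  | succ n ih =>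
    simp only [pow_succ, Matrix.mul_apply]
    refine (norm_sum_le _ _).trans (Finset.sum_le_sum fun k _ => ?_)
    rw [norm_mul]
    exact mul_le_mul (ih i k) (h k j) (norm_nonneg _) ((norm_nonneg _).trans (ih i k))

theorem norm_pencil_pow_apply_le {A B : Matrix ι ι ℝ} (hA : ∀ i j, 0 ≤ A i j)
    (hB : ∀ i j, 0 ≤ B i j) (s : ℂ) (n : ℕ) (i j : ι) :
    ‖(pencil A B s ^ n) i j‖ ≤ ((Real.exp s.re • A + B) ^ n) i j :=
  norm_pow_apply_le_of_dominated (norm_pencil_apply_le hA hB s) n i j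

theorem pencil_ofReal_pow (A B : Matrix ι ι ℝ) (t : ℝ) (n : ℕ) :
    pencil A B t ^ n = ((Real.exp t • A + B) ^ n).map Complex.ofReal := by
  rw [pencil_ofReal]
  exact (Matrix.map_pow (f := Complex.ofRealHom) _ n).symm

end Pencil

/-! ### Aperiodicity and the spectral radius on the imaginary axis -/

section Aperiodic

open scoped Matrix.Norms.Operator

theorem isAperiodicPair_smul {ι : Type*} {A B : Matrix ι ι ℝ} {c : ℝ} (hc : 0 < c)
    (h : IsAperiodicPair A B) : IsAperiodicPair (c • A) (c • B) := by
  have hpath : ∀ i w j, IsPath A B i w j → IsPath (c • A) (c • B) i w j := by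
    intro i w j hp
    induction hp with
    | nil i => exact .nil i
    | @cons i j k σ w h1 _ ih =>
      refine .cons (σ := σ) ?_ ih
      cases σ <;> exact mul_pos hc h1
  intro d hd
  refine h d fun z hz => hd z ?_
  obtain ⟨w₁, w₂, ⟨i, hi⟩, ⟨j, hj⟩, hlen, rfl⟩ := hz
  exact ⟨w₁, w₂, ⟨i, hpath _ _ _ hi⟩, ⟨j, hpath _ _ _ hj⟩, hlen, rfl⟩

variable {ι : Type*} [Fintype ι] [DecidableEq ι] {A B : Matrix ι ι ℝ}

/-- An eigenvalue of modulus at least 1 would produce phases `φ` with `z φ_j = μ φ_i` along edges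
labelled `a` and `φ_j = μ φ_i` along edges labelled `b`, where `z = e^s`. Around a cycle labelled
`u` this yields `z ^ |u|_a = μ ^ |u|`, so `z ^ d = 1` for every cycle difference `d`. The order of
`z` then divides all differences and must be 1. -/
theorem norm_lt_one_of_aperiodic (hA : ∀ i j, 0 ≤ A i j) (hB : ∀ i j, 0 ≤ B i j)
    (hM : (A + B).IsPrimitive) {l : ι → ℝ} (hl : ∀ i, 0 < l i) (hlM : l ᵥ* (A + B) = l)
    (hap : IsAperiodicPair A B) {s : ℂ} (hs : s.re = 0) (hs1 : Complex.exp s ≠ 1)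
    {w : ι → ℂ} (hw0 : w ≠ 0) {μ : ℂ} (hw : pencil A B s *ᵥ w = μ • w) : ‖μ‖ < 1 := by
  by_contra! hμ
  set z := Complex.exp s with hz
  have hz1 : ‖z‖ = 1 := by rw [hz, Complex.norm_exp, hs, Real.exp_zero]
  have hz0 : z ≠ 0 := Complex.exp_ne_zero s
  have hN : ∀ i j, ‖pencil A B s i j‖ ≤ (A + B) i j := fun i j => by
    simpa [hs] using norm_pencil_apply_le hA hB s i j
  obtain ⟨hμ1, hwi, hph⟩ := phase_of_dominated hM hN hl hlM hw0 hw hμ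
  set φ : ι → ℂ := fun i => w i / ‖w i‖ with hφ
  have hφ1 : ∀ i, ‖φ i‖ = 1 := fun i => by
    rw [hφ, norm_div, Complex.norm_real, norm_norm, div_self (norm_ne_zero_iff.mpr (hwi i))]
  have hedge : ∀ i j, (0 < A i j → z * φ j = μ * φ i) ∧ (0 < B i j → φ j = μ * φ i) := by
    intro i j
    have h1 : (z * A i j + B i j) * φ j = ((A i j + B i j : ℝ) : ℂ) * (μ * φ i) := hph i j
    -- An edge pair `i → j` may carry both letters; a second use of the equality case separates the
    -- contribution of `A i j` from that of `B i j`.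
    have key := eq_mul_of_sum_eq Finset.univ (c := ![z * φ j * A i j, φ j * B i j])
      (r := ![A i j, B i j]) (e := μ * φ i) (by rw [norm_mul, hμ1, hφ1, one_mul])
      (by
        intro k _
        fin_cases k
        · simp [hz1, hφ1, abs_of_nonneg (hA i j)]
        · simp [hφ1, abs_of_nonneg (hB i j)])
      (by
        simp only [Fin.sum_univ_two, Matrix.cons_val_zero, Matrix.cons_val_one]
        rw [← h1]
        ring)
    have k0 := key 0 (Finset.mem_univ _)
    have k1 := key 1 (Finset.mem_univ _)
    simp only [Matrix.cons_val_zero, Matrix.cons_val_one] at k0 k1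
    refine ⟨fun h => ?_, fun h => ?_⟩
    · have hne : (A i j : ℂ) ≠ 0 := Complex.ofReal_ne_zero.mpr h.ne'
      exact mul_right_cancel₀ hne (k0.trans (mul_comm _ _))
    · have hne : (B i j : ℂ) ≠ 0 := Complex.ofReal_ne_zero.mpr h.ne'
      exact mul_right_cancel₀ hne (k1.trans (mul_comm _ _))
  have hpath : ∀ i u j, IsPath A B i u j → z ^ (u.count Letter.a) * φ j = μ ^ u.length * φ i := by
    intro i u j hp
    induction hp with
    | nil i => simp
    | @cons i j k σ u h1 _ ih =>
      cases σ
      · have := (hedge i j).1 h1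
        rw [List.count_cons_self, pow_succ', mul_assoc, ih, List.length_cons, pow_succ, mul_assoc,
          ← this]
        ring
      · have := (hedge i j).2 h1
        rw [List.count_cons_of_ne (by decide), ih, List.length_cons, pow_succ, mul_assoc, ← this]
  have hφ0 : ∀ i, φ i ≠ 0 := fun i => norm_ne_zero_iff.mp (by rw [hφ1]; exact one_ne_zero)
  have hcyc : ∀ u, IsCycleLabel A B u → z ^ (u.count Letter.a) = μ ^ u.length :=
    fun u ⟨i, hi⟩ => mul_right_cancel₀ (hφ0 i) (hpath i u i hi)
  set zu : ℂˣ := Units.mk0 z hz0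
  have hdiff : ∀ d ∈ cycleDifferences A B, ((orderOf zu : ℕ) : ℤ) ∣ d := by
    rintro d ⟨u₁, u₂, h₁, h₂, hlen, rfl⟩
    rw [orderOf_dvd_iff_zpow_eq_one]
    ext
    rw [Units.val_zpow_eq_zpow_val, Units.val_mk0, zpow_sub₀ hz0, zpow_natCast, zpow_natCast,
      hcyc _ h₁, hcyc _ h₂, hlen, Units.val_one, div_self]
    exact pow_ne_zero _ (norm_ne_zero_iff.mp (by rw [hμ1]; exact one_ne_zero))
  -- If `z` has infinite order, `orderOf` is 0; the definition of aperiodicity rules out the common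
  -- divisor 0 as well.
  have h1 := orderOf_eq_one_iff.mp (hap _ hdiff)
  exact hs1 (by simpa [zu] using congrArg Units.val h1)

end Aperiodic

/-! ### Uniform geometric decay of matrix powers -/

section GeometricDecay

open scoped Matrix.Norms.Operator

variable {ι : Type*} [Fintype ι] [DecidableEq ι] [Nonempty ι]

/-- The powers of a continuous family of matrices decay geometrically, uniformly near a point at
which the spectral radius is less than one. -/
theorem eventually_norm_pow_le {X : Type*} [TopologicalSpace X] {N : X → Matrix ι ι ℂ} {x₀ : X}
    {s : Set X} (hN : ContinuousWithinAt N s x₀)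
    (h : ∀ (w : ι → ℂ) (μ : ℂ), w ≠ 0 → N x₀ *ᵥ w = μ • w → ‖μ‖ < 1) :
    ∃ ρ : ℝ, 0 < ρ ∧ ρ < 1 ∧ ∃ C : ℝ, 0 < C ∧ ∀ᶠ x in 𝓝[s] x₀, ∀ n, ‖N x ^ n‖ ≤ C * ρ ^ n := by
  have hrad : spectralRadius ℂ (N x₀) < (1 : NNReal) :=
    spectrum.spectralRadius_lt_of_forall_lt _ fun μ hμ => by
      obtain ⟨w, hw0, hw⟩ := exists_eigenvector_of_mem_spectrum hμ
      exact h w μ hw0 hw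
  -- Gelfand's formula provides one exponent `p` with `‖N x₀ ^ p‖ < 1`. This persists nearby by
  -- continuity, and a general exponent is divided by `p` with remainder.
  have hlim := spectrum.pow_norm_pow_one_div_tendsto_nhds_spectralRadius (N x₀)
  obtain ⟨p, hp1, hp⟩ := ((hlim.eventually (gt_mem_nhds hrad)).and (eventually_gt_atTop 0)).exists
  have hp2 : ‖N x₀ ^ p‖ < 1 := by
    have h1 : ‖N x₀ ^ p‖ ^ (1 / (p : ℝ)) < 1 := by
      rw [ENNReal.coe_one, ← ENNReal.ofReal_one, ENNReal.ofReal_lt_ofReal_iff one_pos] at hp1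
      exact hp1
    by_contra! h2
    exact absurd h1 (not_lt.mpr (Real.one_le_rpow h2 (by positivity)))
  obtain ⟨b, hb, hb1⟩ := exists_between hp2
  have hb0 : 0 < b := (norm_nonneg _).trans_lt hb
  set ρ : ℝ := b ^ (1 / (p : ℝ)) with hρ
  have hρ0 : 0 < ρ := Real.rpow_pos_of_pos hb0 _
  have hρp : ρ ^ p = b := by
    rw [hρ, ← Real.rpow_natCast, ← Real.rpow_mul hb0.le, one_div,
      inv_mul_cancel₀ (Nat.cast_ne_zero.mpr hp.ne'), Real.rpow_one]
  have hρ1 : ρ < 1 := Real.rpow_lt_one hb0.le hb1 (by positivity)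
  set D : ℝ := ‖N x₀‖ + 1 with hD
  have hD1 : 1 ≤ D := by simp [hD]
  have hone : 0 < ‖(1 : Matrix ι ι ℂ)‖ := norm_pos_iff.mpr one_ne_zero
  refine ⟨ρ, hρ0, hρ1, ‖(1 : Matrix ι ι ℂ)‖ * D ^ p / b, by positivity, ?_⟩
  have e1 : ∀ᶠ x in 𝓝[s] x₀, ‖N x ^ p‖ < b :=
    (hN.pow p).norm.eventually (gt_mem_nhds hb)
  have e2 : ∀ᶠ x in 𝓝[s] x₀, ‖N x‖ < D :=
    hN.norm.eventually (gt_mem_nhds (by simp [hD]))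
  filter_upwards [e1, e2] with x h1 h2 n
  -- The right factor `R` lets the case `m = 0` hold without knowing the norm of the identity.
  have hpow : ∀ (Q : Matrix ι ι ℂ) (c : ℝ), ‖Q‖ ≤ c → ∀ m, ∀ R : Matrix ι ι ℂ,
      ‖Q ^ m * R‖ ≤ c ^ m * ‖R‖ := by
    intro Q c hQ m R
    induction m with
    | zero => simp
    | succ m ih =>
      rw [pow_succ', mul_assoc, pow_succ', mul_assoc]
      exact (norm_mul_le _ _).trans
        (mul_le_mul hQ ih (norm_nonneg _) ((norm_nonneg _).trans hQ))
  have hn : N x ^ n = (N x ^ p) ^ (n / p) * (N x ^ (n % p) * 1) := by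
    rw [mul_one, ← pow_mul, ← pow_add, Nat.div_add_mod]
  have h3 : ‖N x ^ n‖ ≤ b ^ (n / p) * (D ^ (n % p) * ‖(1 : Matrix ι ι ℂ)‖) := by
    rw [hn]
    refine (hpow _ _ h1.le _ _).trans ?_
    exact mul_le_mul_of_nonneg_left (hpow _ _ h2.le _ _) (pow_nonneg hb0.le _)
  have h4 : D ^ (n % p) ≤ D ^ p := pow_le_pow_right₀ hD1 (Nat.mod_lt n hp).le
  have h5 : b ^ (n / p) * b ≤ ρ ^ n := by
    conv_lhs => rw [← hρp, ← pow_mul, ← pow_add]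
    refine pow_le_pow_of_le_one hρ0.le hρ1.le ?_
    have := Nat.div_add_mod n p
    have := Nat.mod_lt n hp
    omega
  calc ‖N x ^ n‖ ≤ b ^ (n / p) * (D ^ (n % p) * ‖(1 : Matrix ι ι ℂ)‖) := h3
    _ ≤ b ^ (n / p) * (D ^ p * ‖(1 : Matrix ι ι ℂ)‖) := by gcongr
    _ = ‖(1 : Matrix ι ι ℂ)‖ * D ^ p / b * (b ^ (n / p) * b) := by field_simp
    _ ≤ _ := mul_le_mul_of_nonneg_left h5 (by positivity)

theorem exists_norm_pow_le_of_isCompact {X : Type*} [TopologicalSpace X] {N : X → Matrix ι ι ℂ}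
    {K : Set X} (hK : IsCompact K) (hN : ContinuousOn N K)
    (h : ∀ x ∈ K, ∀ (w : ι → ℂ) (μ : ℂ), w ≠ 0 → N x *ᵥ w = μ • w → ‖μ‖ < 1) :
    ∃ ρ : ℝ, 0 < ρ ∧ ρ < 1 ∧ ∃ C : ℝ, 0 < C ∧ ∀ x ∈ K, ∀ n, ‖N x ^ n‖ ≤ C * ρ ^ n := by
  refine hK.induction_on
    (p := fun s => ∃ ρ : ℝ, 0 < ρ ∧ ρ < 1 ∧ ∃ C : ℝ, 0 < C ∧ ∀ x ∈ s, ∀ n, ‖N x ^ n‖ ≤ C * ρ ^ n)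
    ⟨1 / 2, by norm_num, by norm_num, 1, one_pos, by simp⟩ ?_ ?_ ?_
  · rintro s t hst ⟨ρ, h0, h1, C, hC, hb⟩
    exact ⟨ρ, h0, h1, C, hC, fun x hx => hb x (hst hx)⟩
  · rintro s t ⟨ρ, h0, h1, C, hC, hb⟩ ⟨ρ', h0', h1', C', hC', hb'⟩
    refine ⟨max ρ ρ', lt_max_of_lt_left h0, max_lt h1 h1', max C C', lt_max_of_lt_left hC, ?_⟩
    rintro x (hx | hx) n
    · refine (hb x hx n).trans ?_
      gcongr <;> exact le_max_left _ _
    · refine (hb' x hx n).trans ?_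
      gcongr <;> exact le_max_right _ _
  · intro x hx
    obtain ⟨ρ, h0, h1, C, hC, hb⟩ := eventually_norm_pow_le (hN x hx) (h x hx)
    exact ⟨_, hb, ρ, h0, h1, C, hC, fun y hy => hy⟩

omit [Nonempty ι] in
theorem norm_apply_le_norm (N : Matrix ι ι ℂ) (i j : ι) : ‖N i j‖ ≤ ‖N‖ := by
  have h1 : ∑ k, ‖N i k‖₊ ≤ ‖N‖₊ := by
    rw [Matrix.linfty_opNNNorm_def]
    exact Finset.le_sup (f := fun i => ∑ k, ‖N i k‖₊) (Finset.mem_univ i)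
  have h2 : ‖N i j‖₊ ≤ ∑ k, ‖N i k‖₊ :=
    Finset.single_le_sum (f := fun k => ‖N i k‖₊) (fun _ _ => zero_le) (Finset.mem_univ j)
  exact_mod_cast h2.trans h1

end GeometricDecay

/-! ### The dominant eigenvalue as an analytic function, and the constant `β` -/

section Branch

open scoped Matrix.Norms.Operator

variable {ι : Type*} [Fintype ι] [DecidableEq ι]

omit [DecidableEq ι] in
/-- A simple eigenvalue of an analytic family of matrices, with its eigenvector, extends
analytically. -/
theorem exists_eigen_branch {N : ℂ → Matrix ι ι ℂ}
    (hN : ∀ i j, Differentiable ℂ fun s => N s i j) {v₀ l₀ : ι → ℂ} (hv : N 0 *ᵥ v₀ = v₀)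
    (hl : l₀ ᵥ* N 0 = l₀) (hlv : l₀ ⬝ᵥ v₀ = 1)
    (hker : ∀ w, N 0 *ᵥ w = w → l₀ ⬝ᵥ w = 0 → w = 0) :
    ∃ (u : ℂ → ℂ) (v : ℂ → ι → ℂ), AnalyticAt ℂ u 0 ∧ AnalyticAt ℂ v 0 ∧ u 0 = 1 ∧ v 0 = v₀ ∧
      ∀ᶠ s in 𝓝 (0 : ℂ), N s *ᵥ v s = u s • v s := by
  -- The eigenvector equation together with the normalisation `l₀ ⬝ v` is a square system in `(v,
  -- u)`, to which the implicit function theorem applies.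
  let F : ℂ × ((ι → ℂ) × ℂ) → (ι → ℂ) × ℂ := fun x =>
    (N x.1 *ᵥ x.2.1 - x.2.2 • x.2.1, l₀ ⬝ᵥ x.2.1)
  set x₀ : ℂ × ((ι → ℂ) × ℂ) := (0, (v₀, 1)) with hx₀
  have hF : ContDiff ℂ ⊤ F := by
    have hNc : ∀ i j, ContDiff ℂ ⊤ fun x : ℂ × ((ι → ℂ) × ℂ) => N x.1 i j := fun i j =>
      (hN i j).contDiff.comp contDiff_fst
    refine ContDiff.prodMk (contDiff_pi.mpr fun i => ?_) ?_
    · simp only [Pi.sub_apply, mulVec, dotProduct, Pi.smul_apply, smul_eq_mul]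
      exact (ContDiff.sum fun j _ => (hNc i j).mul (by fun_prop)).sub (by fun_prop)
    · simp only [dotProduct]
      fun_prop
  have hFd : DifferentiableAt ℂ F x₀ := hF.contDiffAt.differentiableAt (by simp)
  -- The partial derivative in `(v, u)` is read off from the restriction of `F` to lines, which is
  -- an explicit quadratic polynomial.
  have hline : ∀ y : (ι → ℂ) × ℂ, (fderiv ℂ F x₀ ∘L .inr ℂ ℂ ((ι → ℂ) × ℂ)) y =
      (N 0 *ᵥ y.1 - y.1 - y.2 • v₀, l₀ ⬝ᵥ y.1) := by
    rintro ⟨w, c⟩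
    have h1 : HasDerivAt (fun ε : ℂ => F (x₀ + ε • ((0 : ℂ), (w, c)))) (fderiv ℂ F x₀ (0, (w, c)))
        0 := by
      have h2 : HasDerivAt (fun ε : ℂ => x₀ + ε • ((0 : ℂ), (w, c))) ((0 : ℂ), (w, c)) 0 := by
        simpa using ((hasDerivAt_id (0 : ℂ)).smul_const ((0 : ℂ), (w, c))).const_add x₀
      have h3 : HasFDerivAt F (fderiv ℂ F x₀) (x₀ + (0 : ℂ) • ((0 : ℂ), (w, c))) := by
        simpa using hFd.hasFDerivAt
      exact h3.comp_hasDerivAt (0 : ℂ) h2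
    have h4 : (fun ε : ℂ => F (x₀ + ε • ((0 : ℂ), (w, c)))) = fun ε =>
        (ε • (N 0 *ᵥ w - w - c • v₀) - (ε * ε) • (c • w), 1 + ε * (l₀ ⬝ᵥ w)) := by
      ext1 ε
      have h0 : F (x₀ + ε • ((0 : ℂ), (w, c))) = (N 0 *ᵥ (v₀ + ε • w) - (1 + ε * c) • (v₀ + ε • w),
          l₀ ⬝ᵥ (v₀ + ε • w)) := by
        simp [F, hx₀]
      rw [h0, mulVec_add, hv, mulVec_smul, dotProduct_add, hlv, dotProduct_smul, smul_eq_mul]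
      congr 1
      ext i
      simp only [Pi.add_apply, Pi.sub_apply, Pi.smul_apply, smul_eq_mul]
      ring
    have h5 : HasDerivAt (fun ε : ℂ => (ε • (N 0 *ᵥ w - w - c • v₀) - (ε * ε) • (c • w),
        1 + ε * (l₀ ⬝ᵥ w))) (N 0 *ᵥ w - w - c • v₀, l₀ ⬝ᵥ w) 0 := by
      refine HasDerivAt.prodMk ?_ ?_
      · have h6 := ((hasDerivAt_id (0 : ℂ)).smul_const (N 0 *ᵥ w - w - c • v₀)).sub
          (((hasDerivAt_id (0 : ℂ)).mul (hasDerivAt_id (0 : ℂ))).smul_const (c • w))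
        simp only [id, one_mul, mul_one, one_smul, add_zero, zero_smul, sub_zero] at h6
        exact h6
      · simpa using ((hasDerivAt_id (0 : ℂ)).mul_const (l₀ ⬝ᵥ w)).const_add 1
    rw [h4] at h1
    exact h1.unique h5
  -- Pairing the first component with `l₀` kills `N 0 w - w` and leaves `c = 0`; then `w` is a fixed
  -- vector orthogonal to `l₀`, excluded by `hker`. In finite dimension injectivity is enough.
  have hinj : Function.Injective (fderiv ℂ F x₀ ∘L .inr ℂ ℂ ((ι → ℂ) × ℂ)) := by
    rw [injective_iff_map_eq_zero]
    rintro ⟨w, c⟩ h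
    rw [hline, Prod.mk_eq_zero] at h
    obtain ⟨h1, h2⟩ := h
    dsimp only at h1 h2
    have hc : c = 0 := by
      have h3 := congrArg (fun y => l₀ ⬝ᵥ y) h1
      simp only [dotProduct_sub, dotProduct_mulVec, hl, dotProduct_smul, hlv, dotProduct_zero,
        smul_eq_mul] at h3
      simpa using h3
    have hw : w = 0 := by
      refine hker w ?_ h2
      rw [hc, zero_smul, sub_zero, sub_eq_zero] at h1
      exact h1
    rw [hc, hw]
    rfl
  have hinv : (fderiv ℂ F x₀ ∘L .inr ℂ ℂ ((ι → ℂ) × ℂ)).IsInvertible :=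
    ⟨(LinearEquiv.ofInjectiveEndo _ hinj).toContinuousLinearEquiv, by ext <;> rfl⟩
  have hFc : ContDiffAt ℂ ⊤ F x₀ := hF.contDiffAt
  set g := hFc.implicitFunction (by simp) hinv with hg
  have hga : AnalyticAt ℂ g 0 := (hFc.contDiffAt_implicitFunction (by simp) hinv).analyticAt
  have hg0 : g 0 = (v₀, 1) := hFc.implicitFunction_apply_self (by simp) hinv
  have hgF := hFc.eventually_apply_implicitFunction (by simp) hinv
  refine ⟨fun s => (g s).2, fun s => (g s).1, ?_, ?_, by simp [hg0], by simp [hg0], ?_⟩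
  · exact analyticAt_snd.comp hga
  · exact analyticAt_fst.comp hga
  · filter_upwards [hgF] with s hs
    have h1 := congrArg Prod.fst hs
    simp only [F, hx₀, hv, one_smul, sub_self] at h1
    exact sub_eq_zero.mp h1

/-- For a pair of nonnegative matrices whose sum is primitive with Perron eigenvalue `1`, the
powers of `A e^s + B` are, near `s = 0`, asymptotic to `u(s)^n P(s)` with `u` analytic and `P`
an analytic projection onto a line. -/
theorem exists_spectral_splitting {A B : Matrix ι ι ℝ} (hM : (A + B).IsPrimitive) {v l : ι → ℝ}
    (hv : ∀ i, 0 < v i) (hl : ∀ i, 0 < l i) (hMv : (A + B) *ᵥ v = v) (hlM : l ᵥ* (A + B) = l)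
    (hlv : l ⬝ᵥ v = 1) :
    ∃ (u : ℂ → ℂ) (P : ℂ → Matrix ι ι ℂ) (r : ℝ), 0 < r ∧
      DifferentiableOn ℂ u (Metric.ball 0 r) ∧
      (∀ i j, DifferentiableOn ℂ (fun s => P s i j) (Metric.ball 0 r)) ∧
      u 0 = 1 ∧ (∀ i j, P 0 i j = v i * l j) ∧ HasDerivAt u ((l ⬝ᵥ A *ᵥ v : ℝ) : ℂ) 0 ∧
      (∀ s ∈ Metric.ball (0 : ℂ) r, 1 ≤ ‖P s‖ ∧ pencil A B s * P s = u s • P s ∧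
        P s * pencil A B s = u s • P s) ∧
      ∃ ρ : ℝ, 0 < ρ ∧ ρ < 1 ∧ ∃ C : ℝ, 0 < C ∧
        ∀ s ∈ Metric.ball (0 : ℂ) r, ∀ n, ‖pencil A B s ^ n - u s ^ n • P s‖ ≤ C * ρ ^ n := by
  have : Nonempty ι := by
    by_contra h
    rw [not_nonempty_iff] at h
    simp [dotProduct] at hlv
  set v₀ : ι → ℂ := fun i => v i with hv₀
  set l₀ : ι → ℂ := fun i => l i with hl₀
  have hMv₀ : (A + B).map Complex.ofReal *ᵥ v₀ = v₀ := by
    ext i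
    have := congrFun hMv i
    simp only [mulVec, dotProduct] at this
    simp only [mulVec, dotProduct, map_apply, hv₀]
    exact_mod_cast this
  have hlM₀ : l₀ ᵥ* (A + B).map Complex.ofReal = l₀ := by
    ext i
    have := congrFun hlM i
    simp only [vecMul, dotProduct] at this
    simp only [vecMul, dotProduct, map_apply, hl₀]
    exact_mod_cast this
  have hlv₀ : l₀ ⬝ᵥ v₀ = 1 := by
    simp only [dotProduct] at hlv
    simp only [dotProduct, hl₀, hv₀]
    exact_mod_cast hlv
  have hker := fun (w : ι → ℂ) (h1 : (A + B).map Complex.ofReal *ᵥ w = w)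
      (h2 : l₀ ⬝ᵥ w = 0) => by_contra fun hw0 =>
    dotProduct_ne_zero_of_eigen hM hl hlM (w := w) (μ := 1) hw0 (by rw [h1, one_smul]) (by simp) h2
  have hkerT : ∀ w, ((A + B).map Complex.ofReal)ᵀ *ᵥ w = w → v₀ ⬝ᵥ w = 0 → w = 0 := by
    intro w h1 h2
    by_contra hw0
    have hMT : (Aᵀ + Bᵀ).IsPrimitive := isPrimitive_transpose hM
    refine dotProduct_ne_zero_of_eigen (isPrimitive_transpose hM) hv (w := w) (μ := 1) ?_ hw0 ?_
      (by simp) h2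
    · rw [vecMul_transpose, hMv]
    · rw [one_smul]
      exact h1
  obtain ⟨u, x, hu, hx, hu0, hx0, hux⟩ := exists_eigen_branch (N := pencil A B)
    (differentiable_pencil_apply A B) (v₀ := v₀) (l₀ := l₀) (by rwa [pencil_zero])
    (by rwa [pencil_zero]) hlv₀ (by rw [pencil_zero]; exact hker)
  obtain ⟨u', y, hu', hy, hu'0, hy0, huy⟩ := exists_eigen_branch (N := fun s => (pencil A B s)ᵀ)
    (fun i j => differentiable_pencil_apply A B j i) (v₀ := l₀) (l₀ := v₀)
    (by rwa [pencil_zero, mulVec_transpose]) (by rwa [pencil_zero, vecMul_transpose])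
    (by rwa [dotProduct_comm]) (by rw [pencil_zero]; exact hkerT)
  have hyx : AnalyticAt ℂ (fun s => y s ⬝ᵥ x s) 0 := by
    simp only [dotProduct]
    refine Finset.analyticAt_fun_sum _ fun i _ => ?_
    exact (analyticAt_pi_iff.mp hy i).mul (analyticAt_pi_iff.mp hx i)
  have hyx0 : y 0 ⬝ᵥ x 0 = 1 := by rw [hy0, hx0, hlv₀]
  -- The spectral projection built from the right branch `x` and the left branch `y`. Their
  -- eigenvalues `u` and `u'` agree near `0` because `y ⬝ x` does not vanish there.
  set P : ℂ → Matrix ι ι ℂ := fun s => (y s ⬝ᵥ x s)⁻¹ • vecMulVec (x s) (y s) with hP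
  have hPa : ∀ i j, AnalyticAt ℂ (fun s => P s i j) 0 := by
    intro i j
    have h1 : AnalyticAt ℂ (fun s => (y s ⬝ᵥ x s)⁻¹) 0 := hyx.inv (by rw [hyx0]; exact one_ne_zero)
    exact h1.mul ((analyticAt_pi_iff.mp hx i).mul (analyticAt_pi_iff.mp hy j))
  have hP0 : ∀ i j, P 0 i j = v i * l j := by
    intro i j
    have h1 : P 0 = vecMulVec v₀ l₀ := by
      simp only [hP]
      rw [hyx0, hx0, hy0, inv_one, one_smul]
    rw [h1, vecMulVec_apply]
  have hPc : ContinuousAt P 0 :=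
    continuousAt_pi.mpr fun i => continuousAt_pi.mpr fun j => (hPa i j).continuousAt
  have hyx_ne : ∀ᶠ s in 𝓝 (0 : ℂ), y s ⬝ᵥ x s ≠ 0 :=
    hyx.continuousAt.eventually_ne (by rw [hyx0]; exact one_ne_zero)
  have hev : ∀ᶠ s in 𝓝 (0 : ℂ), pencil A B s * P s = u s • P s ∧ P s * pencil A B s = u s • P s ∧
      P s * P s = P s ∧ P s ≠ 0 := by
    filter_upwards [hux, huy, hyx_ne] with s h1 h2 h3
    rw [mulVec_transpose] at h2
    have huu : u s = u' s := by
      have h4 : y s ⬝ᵥ (pencil A B s *ᵥ x s) = u s * (y s ⬝ᵥ x s) := by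
        rw [h1, dotProduct_smul, smul_eq_mul]
      rw [dotProduct_mulVec, h2, smul_dotProduct, smul_eq_mul] at h4
      exact (mul_right_cancel₀ h3 h4).symm
    refine ⟨?_, ?_, ?_, ?_⟩
    · simp only [hP]
      rw [mul_smul_comm, mul_vecMulVec, h1, smul_vecMulVec, smul_comm]
    · simp only [hP]
      rw [smul_mul_assoc, vecMulVec_mul, h2, ← huu, vecMulVec_smul, smul_comm]
    · simp only [hP]
      rw [smul_mul_assoc, mul_smul_comm, vecMulVec_mul_vecMulVec, vecMulVec_smul,
        inv_smul_smul₀ h3]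
    · intro h4
      have h5 : (P s).trace = 1 := by
        simp only [hP, trace_smul, trace_vecMulVec, smul_eq_mul]
        rw [dotProduct_comm (x s), inv_mul_cancel₀ h3]
      rw [h4] at h5
      simp at h5
  have hlx : AnalyticAt ℂ (fun s => l₀ ⬝ᵥ x s) 0 := by
    simp only [dotProduct]
    exact Finset.analyticAt_fun_sum _ fun i _ => analyticAt_const.mul (analyticAt_pi_iff.mp hx i)
  have hlx0 : l₀ ⬝ᵥ x 0 = 1 := by rw [hx0, hlv₀]
  have hderiv : HasDerivAt u ((l ⬝ᵥ A *ᵥ v : ℝ) : ℂ) 0 := by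
    have hAx : AnalyticAt ℂ (fun s => l₀ ⬝ᵥ A.map Complex.ofReal *ᵥ x s) 0 := by
      simp only [dotProduct, mulVec]
      exact Finset.analyticAt_fun_sum _ fun i _ => analyticAt_const.mul
        (Finset.analyticAt_fun_sum _ fun j _ => analyticAt_const.mul (analyticAt_pi_iff.mp hx j))
    have hg : DifferentiableAt ℂ (fun s => (l₀ ⬝ᵥ A.map Complex.ofReal *ᵥ x s) / (l₀ ⬝ᵥ x s)) 0 :=
      hAx.differentiableAt.div hlx.differentiableAt (by rw [hlx0]; exact one_ne_zero)
    -- Pairing the eigenvector equation with the fixed left vector `l₀` gives `u = 1 + (e^s - 1) (l₀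
    -- A x) / (l₀ x)`. Since `e^s - 1` vanishes at `0`, the derivative of `x` drops out.
    have h1 : HasDerivAt (fun s => 1 + (Complex.exp s - 1) *
        ((l₀ ⬝ᵥ A.map Complex.ofReal *ᵥ x s) / (l₀ ⬝ᵥ x s))) ((l ⬝ᵥ A *ᵥ v : ℝ) : ℂ) 0 := by
      have h2 := (((Complex.hasDerivAt_exp 0).sub_const 1).mul hg.hasDerivAt).const_add 1
      simp only [Complex.exp_zero, sub_self, zero_mul, add_zero, one_mul, hx0, hlv₀, div_one] at h2
      have h3 : l₀ ⬝ᵥ A.map Complex.ofReal *ᵥ v₀ = ((l ⬝ᵥ A *ᵥ v : ℝ) : ℂ) := by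
        simp [dotProduct, mulVec, hl₀, hv₀]
      rw [h3] at h2
      exact h2
    refine h1.congr_of_eventuallyEq ?_
    filter_upwards [hux, hlx.continuousAt.eventually_ne (by rw [hlx0]; exact one_ne_zero)]
      with s h2 h3
    have h4 : pencil A B s = (A + B).map Complex.ofReal +
        (Complex.exp s - 1) • A.map Complex.ofReal := by
      ext i j
      simp [pencil_apply]
      ring
    have h5 : l₀ ⬝ᵥ (pencil A B s *ᵥ x s) = u s * (l₀ ⬝ᵥ x s) := by
      rw [h2, dotProduct_smul, smul_eq_mul]
    rw [h4, add_mulVec, dotProduct_add, dotProduct_mulVec, hlM₀, smul_mulVec, dotProduct_smul,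
      smul_eq_mul] at h5
    field_simp
    rw [← h5]
  -- At `s = 0` the remainder `N - u P` has spectral radius below 1: an eigenvector for `|μ| ≥ 1` is
  -- annihilated by `P`, so it is an eigenvector of `A + B` orthogonal to `l`.
  obtain ⟨ρ, hρ0, hρ1, C, hC, hbound⟩ := eventually_norm_pow_le
    (N := fun s => pencil A B s - u s • P s) (x₀ := (0 : ℂ)) (s := Set.univ)
    (by
      rw [continuousWithinAt_univ]
      exact (continuous_pencil A B).continuousAt.sub (hu.continuousAt.smul hPc))
    (by
      intro w μ hw0 hw
      by_contra! hμ
      obtain ⟨h1, h2, h3, -⟩ := hev.self_of_nhds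
      have hμ0 : μ ≠ 0 := norm_pos_iff.mp (one_pos.trans_le hμ)
      have h4 : P 0 *ᵥ w = 0 := by
        have h5 : P 0 * (pencil A B 0 - u 0 • P 0) = 0 := by
          rw [mul_sub, h2, mul_smul_comm, h3, sub_self]
        have h6 := congrArg (fun y => P 0 *ᵥ y) hw
        simp only [mulVec_mulVec, h5, zero_mulVec, mulVec_smul] at h6
        exact (smul_eq_zero.mp h6.symm).resolve_left hμ0
      have h5 : (A + B).map Complex.ofReal *ᵥ w = μ • w := by
        rw [← pencil_zero, ← hw, sub_mulVec, smul_mulVec, h4, smul_zero, sub_zero]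
      refine dotProduct_ne_zero_of_eigen hM hl hlM hw0 h5 hμ ?_
      obtain ⟨i⟩ := this
      have h6 : (P 0 *ᵥ w) i = v i * (l₀ ⬝ᵥ w) := by
        simp only [mulVec, dotProduct, hP0, Finset.mul_sum, mul_assoc, hl₀]
      rw [h4] at h6
      exact (mul_eq_zero.mp h6.symm).resolve_left (Complex.ofReal_ne_zero.mpr (hv i).ne'))
  rw [nhdsWithin_univ] at hbound
  have hPb : ∀ᶠ s in 𝓝 (0 : ℂ), ‖1 - P s‖ < ‖1 - P 0‖ + 1 :=
    (continuousAt_const.sub hPc).norm.eventually (gt_mem_nhds (by simp))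
  have hall := hev.and (hbound.and (hPb.and (hu.eventually_analyticAt.and
    (eventually_all.mpr fun i => eventually_all.mpr fun j => (hPa i j).eventually_analyticAt))))
  obtain ⟨r, hr, hball⟩ := Metric.eventually_nhds_iff_ball.mp hall
  -- The identity `(N - u P)^n = N^n - u^n P` holds only for `n ≥ 1`. For `n = 0` the difference is
  -- `1 - P`, which accounts for the term `‖1 - P 0‖ + 1` in the constant.
  refine ⟨u, P, r, hr, ?_, ?_, hu0, hP0, hderiv, ?_, ρ, hρ0, hρ1, C + (‖1 - P 0‖ + 1),
    by positivity, ?_⟩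
  · exact fun s hs => (hball s hs).2.2.2.1.differentiableAt.differentiableWithinAt
  · exact fun i j s hs => ((hball s hs).2.2.2.2 i j).differentiableAt.differentiableWithinAt
  · intro s hs
    obtain ⟨⟨h1, h2, h3, h4⟩, -⟩ := hball s hs
    refine ⟨?_, h1, h2⟩
    have h5 := norm_mul_le (P s) (P s)
    rw [h3] at h5
    exact one_le_of_le_mul_left₀ (norm_pos_iff.mpr h4) h5
  · intro s hs n
    obtain ⟨⟨h1, h2, h3, -⟩, h4, h5, -⟩ := hball s hs
    have hpow : ∀ m, (pencil A B s - u s • P s) ^ (m + 1) =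
        pencil A B s ^ (m + 1) - u s ^ (m + 1) • P s := by
      have hPp : ∀ m, pencil A B s ^ m * P s = u s ^ m • P s := by
        intro m
        induction m with
        | zero => simp
        | succ m ih => rw [pow_succ, mul_assoc, h1, mul_smul_comm, ih, smul_smul, pow_succ']
      intro m
      induction m with
      | zero => simp
      | succ m ih =>
        rw [pow_succ, ih, sub_mul, mul_sub, mul_sub, ← pow_succ, mul_smul_comm, hPp,
          smul_mul_assoc, h2, smul_mul_assoc, mul_smul_comm, h3, sub_self, sub_zero, smul_smul,
          ← pow_succ']
    cases n with
    | zero =>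
      simp only [pow_zero, one_smul, mul_one]
      linarith
    | succ n =>
      rw [← hpow]
      refine (h4 (n + 1)).trans (mul_le_mul_of_nonneg_right ?_ (by positivity))
      have := norm_nonneg (1 - P 0)
      linarith

theorem det_sub_pencil_eq_zero_iff {A B : Matrix ι ι ℝ} {t : ℝ} (ht : t ≠ 0) (y z : ℂ) :
    Matrix.det (y • (1 : Matrix ι ι ℂ) - Complex.exp z • A.map Complex.ofReal
        - B.map Complex.ofReal) = 0 ↔
      ∃ w : ι → ℂ, w ≠ 0 ∧ pencil (t⁻¹ • A) (t⁻¹ • B) z *ᵥ w = (y / t) • w := by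
  have htc : (t : ℂ) ≠ 0 := Complex.ofReal_ne_zero.mpr ht
  have h1 : y • (1 : Matrix ι ι ℂ) - Complex.exp z • A.map Complex.ofReal - B.map Complex.ofReal =
      (t : ℂ) • ((y / t) • (1 : Matrix ι ι ℂ) - pencil (t⁻¹ • A) (t⁻¹ • B) z) := by
    ext i j
    simp only [Matrix.sub_apply, Matrix.smul_apply, smul_eq_mul, map_apply, pencil_apply,
      Complex.ofReal_mul, Complex.ofReal_inv]
    field_simp
    ring
  rw [h1, det_smul, mul_eq_zero, or_iff_right (pow_ne_zero _ htc), ← exists_mulVec_eq_zero_iff]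
  refine exists_congr fun w => and_congr_right fun _ => ?_
  rw [sub_mulVec, smul_mulVec, one_mulVec, sub_eq_zero, eq_comm]

/-- The constant `β` in terms of the Perron vectors of the normalised pair. -/
theorem beta_eq {A B : Matrix ι ι ℝ} {t : ℝ} (ht : 0 < t) (hroot : perronRoot (A + B) = t)
    (hM : (t⁻¹ • A + t⁻¹ • B).IsPrimitive) {v l : ι → ℝ}
    (hv : ∀ i, 0 < v i) (hl : ∀ i, 0 < l i) (hMv : (t⁻¹ • A + t⁻¹ • B) *ᵥ v = v)
    (hlM : l ᵥ* (t⁻¹ • A + t⁻¹ • B) = l) (hlv : l ⬝ᵥ v = 1) :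
    beta A B = l ⬝ᵥ (t⁻¹ • A) *ᵥ v := by
  obtain ⟨u, P, r, hr, hu, -, hu0, -, hderiv, hP, ρ, hρ0, hρ1, C, hC, hb⟩ :=
    exists_spectral_splitting hM hv hl hMv hlM hlv
  have htc : (t : ℂ) ≠ 0 := Complex.ofReal_ne_zero.mpr ht.ne'
  have hball : ∀ᶠ z in 𝓝 (0 : ℂ), z ∈ Metric.ball (0 : ℂ) r := Metric.ball_mem_nhds _ hr
  have hex : IsMainBranch A B fun z => t * u z := by
    refine ⟨?_, by simp [hu0, hroot], ?_⟩
    · exact analyticAt_const.mul (hu.analyticAt (Metric.ball_mem_nhds _ hr))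
    · filter_upwards [hball] with z hz
      obtain ⟨h1, h2, -⟩ := hP z hz
      rw [det_sub_pencil_eq_zero_iff ht.ne', mul_div_cancel_left₀ _ htc]
      have : ∃ j, (fun i => P z i j) ≠ 0 := by
        by_contra! h
        have h3 : P z = 0 := by
          ext i j
          exact congrFun (h j) i
        rw [h3, norm_zero] at h1
        exact absurd h1 (by norm_num)
      obtain ⟨j, hj⟩ := this
      refine ⟨_, hj, ?_⟩
      ext i
      have := congrFun (congrFun h2 i) j
      rwa [mul_apply] at this
  -- `mainBranch` is an arbitrary choice among solutions, so all solutions must have the same germ.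
  -- If `U z / t ≠ u z`, its eigenvector is killed by `P z`, so the powers act on it with decay `ρ ^
  -- n`; yet `‖U z / t‖ > ρ` near `0`.
  have huniq : ∀ U, IsMainBranch A B U → deriv U 0 = t * (l ⬝ᵥ (t⁻¹ • A) *ᵥ v : ℝ) := by
    rintro U ⟨hU, hU0, hUdet⟩
    have h1 : U =ᶠ[𝓝 0] fun z => t * u z := by
      have h2 : ContinuousAt (fun z => ‖U z / t‖) 0 := (hU.continuousAt.div_const _).norm
      have h3 : ∀ᶠ z in 𝓝 (0 : ℂ), ρ < ‖U z / t‖ := by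
        refine h2.eventually (lt_mem_nhds ?_)
        simp only [hU0, hroot, div_self htc, norm_one]
        exact hρ1
      filter_upwards [hball, hUdet, h3] with z hz h4 h5
      obtain ⟨w, hw0, hw⟩ := (det_sub_pencil_eq_zero_iff ht.ne' _ _).mp h4
      obtain ⟨-, h6, h7⟩ := hP z hz
      by_contra hne
      have hne' : U z / t ≠ u z := fun h => hne (by rw [← h, mul_div_cancel₀ _ htc])
      have h8 : P z *ᵥ w = 0 := by
        have h9 := congrArg (fun y => P z *ᵥ y) hw
        simp only [mulVec_mulVec, h7, smul_mulVec, mulVec_smul] at h9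
        rw [← sub_eq_zero, ← sub_smul] at h9
        exact (smul_eq_zero.mp h9).resolve_left (sub_ne_zero.mpr hne'.symm)
      have h9 : ∀ n, ‖U z / t‖ ^ n * ‖w‖ ≤ C * ρ ^ n * ‖w‖ := by
        intro n
        have h10 : (pencil (t⁻¹ • A) (t⁻¹ • B) z ^ n - u z ^ n • P z) *ᵥ w = (U z / t) ^ n • w := by
          rw [sub_mulVec, smul_mulVec, h8, smul_zero, sub_zero, pow_mulVec_of_mulVec hw]
        rw [← norm_pow, ← norm_smul, ← h10]
        exact (linfty_opNorm_mulVec _ _).trans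
          (mul_le_mul_of_nonneg_right (hb z hz n) (norm_nonneg _))
      have h10 : ∀ n, (‖U z / t‖ / ρ) ^ n ≤ C := fun n => by
        rw [div_pow, div_le_iff₀ (pow_pos hρ0 n)]
        exact le_of_mul_le_mul_right (h9 n) (norm_pos_iff.mpr hw0)
      have h11 : 1 < ‖U z / t‖ / ρ := (one_lt_div hρ0).mpr h5
      obtain ⟨n, hn⟩ := pow_unbounded_of_one_lt C h11
      exact absurd (h10 n) (not_le.mpr hn)
    rw [h1.deriv_eq]
    exact (hderiv.const_mul _).deriv
  rw [beta, mainBranch, huniq _ (Classical.epsilon_spec ⟨_, hex⟩), hroot, ← Complex.ofReal_mul,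
    Complex.ofReal_re, mul_div_cancel_left₀ _ ht.ne']

end Branch

/-- A sequence of entire functions of period `2πi` behaving like the powers of an analytic
function near the origin, dominated by its values on the real axis, and decaying geometrically on
the imaginary axis away from the origin (modulo `2πi`). -/
structure QuasiPower (X : ℕ → ℂ → ℂ) (u a : ℂ → ℂ) (β r : ℝ) : Prop where
  differentiable (i : ℕ) : Differentiable ℂ (X i)
  periodic (i : ℕ) (s : ℂ) : X i (s + 2 * Real.pi * Complex.I) = X i s
  norm_le_re (i : ℕ) (s : ℂ) : ‖X i s‖ ≤ ‖X i s.re‖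
  r_pos : 0 < r
  differentiableOn_base : DifferentiableOn ℂ u (Metric.ball 0 r)
  differentiableOn_coeff : DifferentiableOn ℂ a (Metric.ball 0 r)
  base_zero : u 0 = 1
  hasDerivAt_base : HasDerivAt u β 0
  coeff_bounded : ∃ K : ℝ, 0 < K ∧ ∀ s ∈ Metric.ball (0 : ℂ) r, ‖a s‖ ≤ K
  approx : ∃ ρ : ℝ, 0 < ρ ∧ ρ < 1 ∧ ∃ C : ℝ, 0 < C ∧
    ∀ s ∈ Metric.ball (0 : ℂ) r, ∀ i, ‖X i s - u s ^ i * a s‖ ≤ C * ρ ^ i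
  base_le_re : ∃ ρ : ℝ, 0 < ρ ∧ ρ < 1 ∧ ∃ C : ℝ, 0 < C ∧
    ∀ s ∈ Metric.ball (0 : ℂ) r, ∀ i, ‖u s‖ ^ i ≤ C * (‖u s.re‖ ^ i + ρ ^ i)
  arc (δ : ℝ) (hδ : 0 < δ) : ∃ ρ : ℝ, 0 < ρ ∧ ρ < 1 ∧ ∃ C : ℝ, 0 < C ∧
    ∀ θ : ℝ, δ ≤ |θ| → |θ| ≤ Real.pi → ∀ i, ‖X i (θ * Complex.I)‖ ≤ C * ρ ^ i
  base_lt_one (θ : ℝ) : θ ≠ 0 → |θ| < r → |θ| ≤ Real.pi → ‖u (θ * Complex.I)‖ < 1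

/-! ### Aperiodic primitive pairs give quasi-power sequences -/

section

open scoped Matrix.Norms.Operator

variable {ι : Type*} [Fintype ι] [DecidableEq ι]

theorem exp_mul_I_ne_one {θ : ℝ} (h0 : θ ≠ 0) (h : |θ| ≤ Real.pi) :
    Complex.exp (θ * Complex.I) ≠ 1 := by
  intro h1
  obtain ⟨n, hn⟩ := Complex.exp_eq_one_iff.mp h1
  have h2 : θ = n * (2 * Real.pi) := by
    have := congrArg Complex.im hn
    simpa using this
  have hn0 : n ≠ 0 := by
    rintro rfl
    exact h0 (by simpa using h2)
  have h3 : (1 : ℝ) ≤ |(n : ℝ)| := by exact_mod_cast Int.one_le_abs hn0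
  rw [h2, abs_mul, abs_of_pos Real.two_pi_pos] at h
  nlinarith [Real.pi_pos]

theorem norm_mono_of_entry_le {N N' : Matrix ι ι ℂ} (h : ∀ i j, ‖N i j‖ ≤ ‖N' i j‖) :
    ‖N‖ ≤ ‖N'‖ := by
  have : ‖N‖₊ ≤ ‖N'‖₊ := by
    rw [linfty_opNNNorm_def, linfty_opNNNorm_def]
    exact Finset.sup_mono_fun fun i _ => Finset.sum_le_sum fun j _ => h i j
  exact_mod_cast this

/-- The sequences `∑ c_{ij}(s) (A e^s + B)^n_{ij}`, with `c` itself of the form `F e^s + G`. -/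
noncomputable def pencilSeq (F G A B : Matrix ι ι ℝ) (n : ℕ) (s : ℂ) : ℂ :=
  ∑ i, ∑ j, pencil F G s i j * (pencil A B s ^ n) i j

/-- The coefficient is `a = ∑ c_ij P_ij`. Aperiodicity enters only through `hradius`, the bound on
the spectral radius at `iθ`; it yields the decay on the arcs by compactness, and `|u(iθ)| < 1`
because a nonzero column of `P` is an eigenvector for `u`. -/
theorem exists_quasiPower {A B : Matrix ι ι ℝ} (hA : ∀ i j, 0 ≤ A i j) (hB : ∀ i j, 0 ≤ B i j)
    (hM : (A + B).IsPrimitive) (hap : IsAperiodicPair A B) {v l : ι → ℝ}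
    (hv : ∀ i, 0 < v i) (hl : ∀ i, 0 < l i) (hMv : (A + B) *ᵥ v = v) (hlM : l ᵥ* (A + B) = l)
    (hlv : l ⬝ᵥ v = 1) :
    ∃ (u : ℂ → ℂ) (r : ℝ), ∀ F G : Matrix ι ι ℝ, (∀ i j, 0 ≤ F i j) → (∀ i j, 0 ≤ G i j) →
      ∃ a : ℂ → ℂ, a 0 = ((∑ i, ∑ j, (F i j + G i j) * (v i * l j) : ℝ) : ℂ) ∧
        QuasiPower (pencilSeq F G A B) u a (l ⬝ᵥ A *ᵥ v) r := by
  have hne : Nonempty ι := by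
    by_contra h
    rw [not_nonempty_iff] at h
    simp [dotProduct] at hlv
  obtain ⟨u, P, r, hr, hu, hPd, hu0, hP0, hderiv, hP, ρ, hρ0, hρ1, C, hC, hb⟩ :=
    exists_spectral_splitting hM hv hl hMv hlM hlv
  refine ⟨u, r, fun F G hF hG => ⟨fun s => ∑ i, ∑ j, pencil F G s i j * P s i j, ?_, ?_⟩⟩
  · simp [hP0, pencil_apply]
  set D : ℝ := ∑ i, ∑ j, (Real.exp r * F i j + G i j) with hD
  have hD0 : 0 ≤ D := Finset.sum_nonneg fun i _ => Finset.sum_nonneg fun j _ =>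
    add_nonneg (mul_nonneg (Real.exp_pos _).le (hF i j)) (hG i j)
  have hsum : ∀ (s : ℂ) (N : Matrix ι ι ℂ), s.re ≤ r →
      ‖∑ i, ∑ j, pencil F G s i j * N i j‖ ≤ D * ‖N‖ := by
    intro s N hs
    rw [hD, Finset.sum_mul]
    refine (norm_sum_le _ _).trans (Finset.sum_le_sum fun i _ => ?_)
    rw [Finset.sum_mul]
    refine (norm_sum_le _ _).trans (Finset.sum_le_sum fun j _ => ?_)
    rw [norm_mul]
    refine mul_le_mul ((norm_pencil_apply_le hF hG s i j).trans ?_) (norm_apply_le_norm N i j)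
      (norm_nonneg _) (add_nonneg (mul_nonneg (Real.exp_pos _).le (hF i j)) (hG i j))
    exact add_le_add (mul_le_mul_of_nonneg_right (Real.exp_le_exp.mpr hs) (hF i j)) le_rfl
  have hre : ∀ s ∈ Metric.ball (0 : ℂ) r, s.re ≤ r := fun s hs =>
    (Complex.re_le_norm s).trans (mem_ball_zero_iff.mp hs).le
  have hre_mem : ∀ s ∈ Metric.ball (0 : ℂ) r, ((s.re : ℝ) : ℂ) ∈ Metric.ball (0 : ℂ) r :=
    fun s hs => by
      rw [mem_ball_zero_iff, Complex.norm_real]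
      exact (Complex.abs_re_le_norm s).trans_lt (mem_ball_zero_iff.mp hs)
  have hPb : ∀ s ∈ Metric.ball (0 : ℂ) r, ‖P s‖ ≤ ‖(1 : Matrix ι ι ℂ)‖ + C := fun s hs => by
    have h1 := hb s hs 0
    simp only [pow_zero, one_smul, mul_one] at h1
    have h2 := norm_sub_norm_le (P s) 1
    rw [norm_sub_rev] at h2
    linarith
  have hone : 0 < ‖(1 : Matrix ι ι ℂ)‖ := norm_pos_iff.mpr one_ne_zero
  have hradius : ∀ θ : ℝ, θ ≠ 0 → |θ| ≤ Real.pi → ∀ (w : ι → ℂ) (μ : ℂ), w ≠ 0 →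
      pencil A B (θ * Complex.I) *ᵥ w = μ • w → ‖μ‖ < 1 := fun θ h0 hπ w μ hw0 hw =>
    norm_lt_one_of_aperiodic hA hB hM hl hlM hap (by simp) (exp_mul_I_ne_one h0 hπ) hw0 hw
  refine ⟨fun n => ?_, fun n s => ?_, fun n s => ?_, hr, hu, ?_, hu0, hderiv,
    ⟨D * (‖(1 : Matrix ι ι ℂ)‖ + C) + 1, by positivity, fun s hs => ?_⟩,
    ⟨ρ, hρ0, hρ1, D * C + 1, by positivity, fun s hs n => ?_⟩,
    ⟨ρ, hρ0, hρ1, ‖(1 : Matrix ι ι ℂ)‖ + 2 * C, by positivity, fun s hs n => ?_⟩, fun δ hδ => ?_,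
    fun θ h0 hr' hπ => ?_⟩
  · exact Differentiable.fun_sum fun i _ => Differentiable.fun_sum fun j _ =>
      (differentiable_pencil_apply F G i j).mul (differentiable_pencil_pow_apply A B n i j)
  · simp only [pencilSeq, pencil_add_period]
  · have h1 : pencilSeq F G A B n (s.re : ℂ) = ((∑ i, ∑ j, (Real.exp s.re • F + G) i j *
        ((Real.exp s.re • A + B) ^ n) i j : ℝ) : ℂ) := by
      simp only [pencilSeq, pencil_ofReal_pow]
      simp [pencil_ofReal]
    rw [h1, Complex.norm_real]
    refine le_trans ?_ (le_abs_self _)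
    refine (norm_sum_le _ _).trans (Finset.sum_le_sum fun i _ =>
      (norm_sum_le _ _).trans (Finset.sum_le_sum fun j _ => ?_))
    rw [norm_mul]
    exact mul_le_mul (norm_pencil_apply_le hF hG s i j) (norm_pencil_pow_apply_le hA hB s n i j)
      (norm_nonneg _) ((norm_nonneg _).trans (norm_pencil_apply_le hF hG s i j))
  · exact DifferentiableOn.fun_sum fun i _ => DifferentiableOn.fun_sum fun j _ =>
      (differentiable_pencil_apply F G i j).differentiableOn.mul (hPd i j)
  · refine (hsum s _ (hre s hs)).trans ?_
    have := mul_le_mul_of_nonneg_left (hPb s hs) hD0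
    linarith
  · have h1 : pencilSeq F G A B n s - u s ^ n * ∑ i, ∑ j, pencil F G s i j * P s i j =
        ∑ i, ∑ j, pencil F G s i j * (pencil A B s ^ n - u s ^ n • P s) i j := by
      simp only [pencilSeq, Finset.mul_sum, ← Finset.sum_sub_distrib, Matrix.sub_apply,
        Matrix.smul_apply, smul_eq_mul]
      refine Finset.sum_congr rfl fun i _ => Finset.sum_congr rfl fun j _ => by ring
    rw [h1]
    refine (hsum s _ (hre s hs)).trans ((mul_le_mul_of_nonneg_left (hb s hs n) hD0).trans ?_)
    rw [← mul_assoc]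
    exact mul_le_mul_of_nonneg_right (by linarith) (by positivity)
  -- The base is compared with its value at `Re s` through the matrices: `1 ≤ ‖P s‖` passes from
  -- `u^n` to the powers of the pencil, entrywise domination passes to `Re s`, and the splitting
  -- there returns to `u`.
  · have h1 : ‖u s‖ ^ n ≤ ‖u s ^ n • P s‖ := by
      rw [norm_smul, norm_pow]
      exact le_mul_of_one_le_right (by positivity) (hP s hs).1
    have h2 : ‖u s ^ n • P s‖ ≤ ‖pencil A B s ^ n‖ + C * ρ ^ n := by
      have h3 := norm_sub_norm_le (u s ^ n • P s) (pencil A B s ^ n)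
      rw [norm_sub_rev] at h3
      linarith [hb s hs n]
    have h3 : ‖pencil A B s ^ n‖ ≤ ‖pencil A B s.re ^ n‖ := norm_mono_of_entry_le fun i j => by
      refine (norm_pencil_pow_apply_le hA hB s n i j).trans ?_
      rw [pencil_ofReal_pow, map_apply, Complex.norm_real]
      exact le_abs_self _
    have h4 : ‖pencil A B s.re ^ n‖ ≤ ‖u s.re‖ ^ n * (‖(1 : Matrix ι ι ℂ)‖ + C) + C * ρ ^ n := by
      have h5 := norm_sub_norm_le (pencil A B s.re ^ n) (u s.re ^ n • P s.re)
      have h6 : ‖u s.re ^ n • P s.re‖ ≤ ‖u s.re‖ ^ n * (‖(1 : Matrix ι ι ℂ)‖ + C) := by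
        rw [norm_smul, norm_pow]
        exact mul_le_mul_of_nonneg_left (hPb _ (hre_mem s hs)) (by positivity)
      linarith [hb _ (hre_mem s hs) n]
    have h5 : 0 ≤ C * ‖u s.re‖ ^ n := by positivity
    have h6 : 0 ≤ ‖(1 : Matrix ι ι ℂ)‖ * ρ ^ n := by positivity
    linarith
  · have hK : IsCompact {θ : ℝ | δ ≤ |θ| ∧ |θ| ≤ Real.pi} := by
      refine Metric.isCompact_of_isClosed_isBounded ?_ ?_
      · exact (isClosed_le continuous_const continuous_abs).inter
          (isClosed_le continuous_abs continuous_const)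
      · refine (Metric.isBounded_closedBall (x := (0 : ℝ)) (r := Real.pi)).subset fun θ hθ => ?_
        rw [mem_closedBall_zero_iff]
        exact hθ.2
    obtain ⟨ρ', h0, h1, C', hC', h2⟩ := exists_norm_pow_le_of_isCompact
      (N := fun θ : ℝ => pencil A B (θ * Complex.I)) hK
      ((continuous_pencil A B).comp (by fun_prop)).continuousOn
      fun θ hθ => hradius θ (abs_pos.mp (hδ.trans_le hθ.1)) hθ.2
    refine ⟨ρ', h0, h1, D * C' + 1, by positivity, fun θ hθ hπ n => ?_⟩
    refine (hsum _ _ (by simpa using hr.le)).trans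
      ((mul_le_mul_of_nonneg_left (h2 θ ⟨hθ, hπ⟩ n) hD0).trans ?_)
    rw [← mul_assoc]
    exact mul_le_mul_of_nonneg_right (by linarith) (by positivity)
  · obtain ⟨h1, h2, -⟩ := hP (θ * Complex.I) (by simpa using hr')
    have : ∃ j, (fun i => P (θ * Complex.I) i j) ≠ 0 := by
      by_contra! h
      have h3 : P (θ * Complex.I) = 0 := by
        ext i j
        exact congrFun (h j) i
      rw [h3, norm_zero] at h1
      exact absurd h1 (by norm_num)
    obtain ⟨j, hj⟩ := this
    refine hradius θ h0 hπ _ _ hj ?_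
    ext i
    have := congrFun (congrFun h2 i) j
    rwa [mul_apply] at this

end

/-! ### Moving a contour off the imaginary axis, to either side -/

section Contour

open Complex MeasureTheory

/-- The three sides, other than the one on the imaginary axis, of the rectangle with vertices
`±iδ`, `τ ± iδ`. -/
def threeSides (δ τ : ℝ) : Set ℂ :=
  {s | (|s.im| = δ ∧ s.re ∈ Set.uIcc 0 τ) ∨ (s.re = τ ∧ |s.im| ≤ δ)}

/-- The integral along `threeSides δ τ`, from `-iδ` to `iδ`, divided by `i`. -/
noncomputable def sideIntegral (f : ℂ → ℂ) (δ τ : ℝ) : ℂ :=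
  (∫ y in (-δ)..δ, f (τ + y * I)) - I * (∫ x in (0 : ℝ)..τ, f (x + (-δ : ℝ) * I))
    + I * (∫ x in (0 : ℝ)..τ, f (x + (δ : ℝ) * I))

/-- Cauchy's theorem for the rectangle, divided by `i`. Nothing fixes the sign of `τ`, so the same
formula serves shifts to the right and to the left. -/
theorem integral_eq_sideIntegral {f : ℂ → ℂ} {δ τ : ℝ}
    (hf : DifferentiableOn ℂ f (Set.uIcc 0 τ ×ℂ Set.uIcc (-δ) δ)) :
    ∫ y in (-δ)..δ, f (y * I) = sideIntegral f δ τ := by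
  have h := integral_boundary_rect_eq_zero_of_differentiableOn f ⟨0, -δ⟩ ⟨τ, δ⟩ hf
  simp only [smul_eq_mul, ofReal_zero, zero_add] at h
  unfold sideIntegral
  linear_combination (I : ℂ) * h + (∫ y in (-δ)..δ, f (y * I)) * I_sq -
    (∫ y in (-δ)..δ, f (τ + y * I)) * I_sq

variable {δ τ : ℝ}

theorem mem_threeSides_vertical {y : ℝ} (hδ : 0 ≤ δ) (hy : y ∈ Set.uIcc (-δ) δ) :
    (τ + y * I : ℂ) ∈ threeSides δ τ := by
  rw [Set.uIcc_of_le (by linarith)] at hy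
  right
  simpa using abs_le.mpr hy

theorem mem_threeSides_lower {x : ℝ} (hδ : 0 ≤ δ) (hx : x ∈ Set.uIcc 0 τ) :
    (x + (-δ : ℝ) * I : ℂ) ∈ threeSides δ τ := by
  left
  simpa [abs_of_nonneg hδ] using hx

theorem mem_threeSides_upper {x : ℝ} (hδ : 0 ≤ δ) (hx : x ∈ Set.uIcc 0 τ) :
    (x + (δ : ℝ) * I : ℂ) ∈ threeSides δ τ := by
  left
  simpa [abs_of_nonneg hδ] using hx

theorem norm_sideIntegral_le {f : ℂ → ℂ} (hδ : 0 ≤ δ) {K : ℝ}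
    (hf : ∀ s ∈ threeSides δ τ, ‖f s‖ ≤ K) : ‖sideIntegral f δ τ‖ ≤ K * (2 * δ + 2 * |τ|) := by
  have h1 : ‖∫ y in (-δ)..δ, f (τ + y * I)‖ ≤ K * |δ - -δ| :=
    intervalIntegral.norm_integral_le_of_norm_le_const fun y hy =>
      hf _ (mem_threeSides_vertical hδ (Set.uIoc_subset_uIcc hy))
  have h2 : ‖∫ x in (0 : ℝ)..τ, f (x + (-δ : ℝ) * I)‖ ≤ K * |τ - 0| :=
    intervalIntegral.norm_integral_le_of_norm_le_const fun x hx =>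
      hf _ (mem_threeSides_lower hδ (Set.uIoc_subset_uIcc hx))
  have h3 : ‖∫ x in (0 : ℝ)..τ, f (x + (δ : ℝ) * I)‖ ≤ K * |τ - 0| :=
    intervalIntegral.norm_integral_le_of_norm_le_const fun x hx =>
      hf _ (mem_threeSides_upper hδ (Set.uIoc_subset_uIcc hx))
  rw [show δ - -δ = 2 * δ by ring, abs_of_nonneg (by linarith)] at h1
  rw [sub_zero] at h2 h3
  unfold sideIntegral
  refine (norm_add_le _ _).trans ((add_le_add_left (norm_sub_le _ _) _).trans ?_)
  rw [norm_mul, norm_mul, norm_I, one_mul, one_mul]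
  linarith

theorem integrable_sides {f : ℂ → ℂ} (hδ : 0 ≤ δ) (hf : ContinuousOn f (threeSides δ τ)) :
    IntervalIntegrable (fun y : ℝ => f (τ + y * I)) volume (-δ) δ ∧
    IntervalIntegrable (fun x : ℝ => f (x + (-δ : ℝ) * I)) volume 0 τ ∧
    IntervalIntegrable (fun x : ℝ => f (x + (δ : ℝ) * I)) volume 0 τ :=
  ⟨(hf.comp (by fun_prop) fun _ hy => mem_threeSides_vertical hδ hy).intervalIntegrable,
   (hf.comp (by fun_prop) fun _ hy => mem_threeSides_lower hδ hy).intervalIntegrable,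
   (hf.comp (by fun_prop) fun _ hy => mem_threeSides_upper hδ hy).intervalIntegrable⟩

theorem sideIntegral_sub {f g : ℂ → ℂ} (hδ : 0 ≤ δ) (hf : ContinuousOn f (threeSides δ τ))
    (hg : ContinuousOn g (threeSides δ τ)) :
    sideIntegral (fun s => f s - g s) δ τ = sideIntegral f δ τ - sideIntegral g δ τ := by
  obtain ⟨f1, f2, f3⟩ := integrable_sides hδ hf
  obtain ⟨g1, g2, g3⟩ := integrable_sides hδ hg
  unfold sideIntegral
  rw [intervalIntegral.integral_sub f1 g1, intervalIntegral.integral_sub f2 g2,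
    intervalIntegral.integral_sub f3 g3]
  ring

theorem sideIntegral_const_mul (c : ℂ) (f : ℂ → ℂ) :
    sideIntegral (fun s => c * f s) δ τ = c * sideIntegral f δ τ := by
  unfold sideIntegral
  simp only [intervalIntegral.integral_const_mul]
  ring

theorem sideIntegral_congr {f g : ℂ → ℂ} (hδ : 0 ≤ δ) (h : Set.EqOn f g (threeSides δ τ)) :
    sideIntegral f δ τ = sideIntegral g δ τ := by
  unfold sideIntegral
  congr 1
  · congr 1
    · exact intervalIntegral.integral_congr fun y hy => h (mem_threeSides_vertical hδ hy)
    · congr 1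
      exact intervalIntegral.integral_congr fun y hy => h (mem_threeSides_lower hδ hy)
  · congr 1
    exact intervalIntegral.integral_congr fun y hy => h (mem_threeSides_upper hδ hy)

theorem sideIntegral_of_hasDerivAt {f L : ℂ → ℂ} (hδ : 0 ≤ δ)
    (hL : ∀ s ∈ threeSides δ τ, HasDerivAt L (f s) s) (hf : ContinuousOn f (threeSides δ τ)) :
    sideIntegral f δ τ = I * (L ((-δ : ℝ) * I) - L ((δ : ℝ) * I)) := by
  obtain ⟨f1, f2, f3⟩ := integrable_sides hδ hf
  have e1 : ∫ y in (-δ)..δ, f (τ + y * I) * I =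
      L (τ + (δ : ℝ) * I) - L (τ + (-δ : ℝ) * I) := by
    refine intervalIntegral.integral_eq_sub_of_hasDerivAt
      (f := fun y : ℝ => L (τ + y * I)) (fun y hy => ?_) (f1.mul_const I)
    have h1 : HasDerivAt (fun y : ℝ => (τ + y * I : ℂ)) I y := by
      simpa using ((ofRealCLM.hasDerivAt (x := y)).mul_const I).const_add (τ : ℂ)
    exact (hL _ (mem_threeSides_vertical hδ hy)).comp y h1
  have e2 : ∀ c : ℝ, (∀ x ∈ Set.uIcc 0 τ, (x + (c : ℝ) * I : ℂ) ∈ threeSides δ τ) →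
      IntervalIntegrable (fun x : ℝ => f (x + (c : ℝ) * I)) volume 0 τ →
      ∫ x in (0 : ℝ)..τ, f (x + (c : ℝ) * I) = L (τ + (c : ℝ) * I) - L ((c : ℝ) * I) := by
    intro c hc hint
    have h2 := intervalIntegral.integral_eq_sub_of_hasDerivAt
      (f := fun x : ℝ => L (x + c * I)) (f' := fun x : ℝ => f (x + c * I)) (a := 0) (b := τ)
      (fun x hx => by
        have h1 : HasDerivAt (fun x : ℝ => (x + c * I : ℂ)) 1 x := by
          simpa using (ofRealCLM.hasDerivAt (x := x)).add_const (c * I : ℂ)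
        have h3 := (hL _ (hc x hx)).comp x h1
        rw [mul_one] at h3
        exact h3) hint
    simpa using h2
  rw [intervalIntegral.integral_mul_const] at e1
  unfold sideIntegral
  rw [e2 _ (fun x hx => mem_threeSides_lower hδ hx) f2,
    e2 _ (fun x hx => mem_threeSides_upper hδ hx) f3]
  linear_combination (-I) * e1 + (∫ y in (-δ)..δ, f (τ + y * I)) * I_sq

theorem mul_re_nonneg_of_mem_threeSides {s : ℂ} (hδ : 0 < δ) (hτ : τ ≠ 0)
    (hs : s ∈ threeSides δ τ) : 0 < τ * s.re ∨ s.im ≠ 0 := by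
  rcases hs with ⟨h1, -⟩ | ⟨h1, -⟩
  · right
    intro h0
    rw [h0, abs_zero] at h1
    exact hδ.ne h1
  · left
    rw [h1]
    exact mul_self_pos.mpr hτ

theorem ne_zero_of_mem_threeSides {s : ℂ} (hδ : 0 < δ) (hτ : τ ≠ 0)
    (hs : s ∈ threeSides δ τ) : s ≠ 0 := by
  rintro rfl
  simpa using mul_re_nonneg_of_mem_threeSides hδ hτ hs

theorem continuousOn_inv_threeSides (hδ : 0 < δ) (hτ : τ ≠ 0) :
    ContinuousOn (fun s : ℂ => s⁻¹) (threeSides δ τ) :=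
  continuousOn_id.inv₀ fun _ hs => ne_zero_of_mem_threeSides hδ hτ hs

/-- The three sides avoid the negative real axis, so `log` is a primitive and the value is `i
(log(-iδ) - log(iδ)) = π`: half a residue. For `τ < 0` the primitive is `log(-s)` and the sign is
reversed. -/
theorem sideIntegral_inv_of_pos (hδ : 0 < δ) (hτ : 0 < τ) :
    sideIntegral (fun s => s⁻¹) δ τ = Real.pi := by
  have hsl : ∀ s ∈ threeSides δ τ, s ∈ slitPlane := fun s hs => by
    rcases mul_re_nonneg_of_mem_threeSides hδ hτ.ne' hs with h | h
    · exact Or.inl (pos_of_mul_pos_right h hτ.le)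
    · exact Or.inr h
  rw [sideIntegral_of_hasDerivAt hδ.le (L := log) (fun s hs => hasDerivAt_log (hsl s hs))
    (continuousOn_inv_threeSides hδ hτ.ne'), ofReal_neg,
    log, log, neg_mul, arg_neg_eq_arg_sub_pi_of_im_pos (by simpa using hδ),
    show ‖-((δ : ℂ) * I)‖ = ‖(δ : ℂ) * I‖ from norm_neg _]
  push_cast
  linear_combination (-(Real.pi : ℂ)) * I_sq

theorem sideIntegral_inv_of_neg (hδ : 0 < δ) (hτ : τ < 0) :
    sideIntegral (fun s => s⁻¹) δ τ = -Real.pi := by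
  have hsl : ∀ s ∈ threeSides δ τ, -s ∈ slitPlane := fun s hs => by
    rcases mul_re_nonneg_of_mem_threeSides hδ hτ.ne hs with h | h
    · left
      rw [neg_re]
      exact neg_pos.mpr (neg_of_mul_pos_right h hτ.le)
    · right
      rwa [neg_im, neg_ne_zero]
  rw [sideIntegral_of_hasDerivAt hδ.le (L := fun s => log (-s)) (fun s hs => by
      have h := (hasDerivAt_log (hsl s hs)).comp s (hasDerivAt_neg s)
      rw [inv_neg, neg_mul_neg, mul_one] at h
      exact h)
    (continuousOn_inv_threeSides hδ hτ.ne), ofReal_neg,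
    log, log, neg_mul, neg_neg, arg_neg_eq_arg_sub_pi_of_im_pos (by simpa using hδ),
    show ‖-((δ : ℂ) * I)‖ = ‖(δ : ℂ) * I‖ from norm_neg _]
  push_cast
  linear_combination (Real.pi : ℂ) * I_sq

/-- Integrating a difference quotient along the imaginary axis by moving the contour. -/
theorem integral_dslope {F : ℂ → ℂ} {U : Set ℂ} (hU : IsOpen U) (hF : DifferentiableOn ℂ F U)
    (hδ : 0 < δ) (hτ : τ ≠ 0) (hsub : Set.uIcc 0 τ ×ℂ Set.uIcc (-δ) δ ⊆ U) :
    ∫ y in (-δ)..δ, dslope F 0 (y * I) =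
      sideIntegral (fun s => F s * s⁻¹) δ τ - F 0 * sideIntegral (fun s => s⁻¹) δ τ := by
  have h0 : (0 : ℂ) ∈ U := hsub ⟨by simp, by
    rw [Set.mem_preimage, zero_im, Set.uIcc_of_le (by linarith)]
    exact ⟨by linarith, hδ.le⟩⟩
  have hsides : threeSides δ τ ⊆ U := fun s hs => hsub <| by
    rcases hs with ⟨h1, h2⟩ | ⟨h1, h2⟩
    · refine ⟨h2, ?_⟩
      rw [Set.mem_preimage, Set.uIcc_of_le (by linarith)]
      exact abs_le.mp h1.le
    · refine ⟨by simp [h1], ?_⟩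
      rw [Set.mem_preimage, Set.uIcc_of_le (by linarith)]
      exact abs_le.mp h2
  have hd : DifferentiableOn ℂ (dslope F 0) U :=
    (differentiableOn_dslope (hU.mem_nhds h0)).mpr hF
  have hinv : ContinuousOn (fun s : ℂ => s⁻¹) (threeSides δ τ) :=
    continuousOn_inv_threeSides hδ hτ
  -- The difference quotient is holomorphic at `0`, so it can be moved as a whole; only on the three
  -- sides, where `s ≠ 0`, is it split into `F s / s` and `F 0 / s`.
  rw [integral_eq_sideIntegral (hd.mono hsub), ← sideIntegral_const_mul,
    ← sideIntegral_sub (f := fun s => F s * s⁻¹) (g := fun s => F 0 * s⁻¹) hδ.le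
      ((hF.continuousOn.mono hsides).mul hinv) (continuousOn_const.mul hinv)]
  refine sideIntegral_congr hδ.le fun s hs => ?_
  have hs0 := ne_zero_of_mem_threeSides hδ hτ hs
  rw [dslope_of_ne _ hs0, slope_def_field, sub_zero]
  field_simp

end Contour

/-! ### Geometrically small sequences and their convolutions -/

section Decay

/-- The sequence `f` decays geometrically. -/
def GeomSmall (f : ℕ → ℂ) : Prop :=
  ∃ q : ℝ, 0 < q ∧ q < 1 ∧ f =O[atTop] fun n : ℕ => q ^ n

/-- The factor `n`, which counts the terms of a convolution, is absorbed by any slightly larger rate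
`q' < 1`. -/
theorem GeomSmall.of_le {f : ℕ → ℂ} {C q : ℝ} (hq0 : 0 < q) (hq1 : q < 1)
    (h : ∀ᶠ n : ℕ in atTop, ‖f n‖ ≤ C * (n * q ^ n)) : GeomSmall f := by
  obtain ⟨q', h1, h2⟩ := exists_between hq1
  refine ⟨q', hq0.trans h1, h2, (IsBigO.of_bound C ?_ :
    f =O[atTop] fun n : ℕ => (n : ℝ) ^ 1 * q ^ n).trans
    (isLittleO_pow_const_mul_const_pow_const_pow_of_norm_lt 1
      (by rwa [Real.norm_of_nonneg hq0.le])).isBigO⟩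
  filter_upwards [h] with n hn
  rw [pow_one, Real.norm_of_nonneg (by positivity)]
  exact hn

theorem GeomSmall.add {f g : ℕ → ℂ} (hf : GeomSmall f) (hg : GeomSmall g) :
    GeomSmall fun n => f n + g n := by
  obtain ⟨q, h0, h1, h⟩ := hf
  obtain ⟨q', h0', h1', h'⟩ := hg
  refine ⟨max q q', lt_max_of_lt_left h0, max_lt h1 h1', ?_⟩
  refine (h.trans ?_).add (h'.trans ?_)
  · exact IsBigO.of_norm_le fun n => by
      rw [Real.norm_of_nonneg (by positivity)]
      exact pow_le_pow_left₀ h0.le (le_max_left _ _) n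
  · exact IsBigO.of_norm_le fun n => by
      rw [Real.norm_of_nonneg (by positivity)]
      exact pow_le_pow_left₀ h0'.le (le_max_right _ _) n

theorem GeomSmall.neg {f : ℕ → ℂ} (hf : GeomSmall f) : GeomSmall fun n => -f n := by
  obtain ⟨q, h0, h1, h⟩ := hf
  exact ⟨q, h0, h1, h.neg_left⟩

theorem GeomSmall.const_mul {f : ℕ → ℂ} (hf : GeomSmall f) (c : ℂ) :
    GeomSmall fun n => c * f n := by
  obtain ⟨q, h0, h1, h⟩ := hf
  exact ⟨q, h0, h1, h.const_mul_left c⟩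

theorem GeomSmall.congr {f g : ℕ → ℂ} (hf : GeomSmall f) (h : ∀ n, f n = g n) : GeomSmall g := by
  rwa [← funext h]

theorem geomSmall_zero : GeomSmall fun _ => 0 :=
  ⟨1 / 2, by norm_num, by norm_num, isBigO_zero _ _⟩

theorem GeomSmall.sum {ι : Type*} (s : Finset ι) {f : ι → ℕ → ℂ} (h : ∀ i ∈ s, GeomSmall (f i)) :
    GeomSmall fun n => ∑ i ∈ s, f i n := by
  classical
  induction s using Finset.induction_on with
  | empty => simpa using geomSmall_zero
  | insert i s hi ih =>
    refine GeomSmall.congr ((h i (Finset.mem_insert_self _ _)).add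
      (ih fun j hj => h j (Finset.mem_insert_of_mem hj))) fun n => ?_
    rw [Finset.sum_insert hi]

theorem norm_convolution_le {p q : ℕ → ℂ} {c c' ρ ρ' R : ℝ} (hc : 0 ≤ c) (hρ : 0 ≤ ρ)
    (hρ' : 0 ≤ ρ') (hR : 0 < R) (hρR : ρ ≤ R) (hρR' : ρ' ≤ R) (hp : ∀ i, ‖p i‖ ≤ c * ρ ^ i)
    (hq : ∀ i, ‖q i‖ ≤ c' * ρ' ^ i) (n : ℕ) :
    ‖∑ i ∈ Finset.range n, p i * q (n - 1 - i)‖ ≤ c * c' / R * (n * R ^ n) := by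
  have hc' : 0 ≤ c' := by simpa using (norm_nonneg _).trans (hq 0)
  have h : ∀ i ∈ Finset.range n, ‖p i * q (n - 1 - i)‖ ≤ c * c' / R * R ^ n := by
    intro i hi
    have hi' := Finset.mem_range.mp hi
    have hn : R ^ n = R ^ i * R ^ (n - 1 - i) * R := by
      rw [← pow_add, ← pow_succ]
      congr 1
      omega
    rw [norm_mul, hn]
    calc ‖p i‖ * ‖q (n - 1 - i)‖ ≤ (c * ρ ^ i) * (c' * ρ' ^ (n - 1 - i)) :=
          mul_le_mul (hp i) (hq _) (norm_nonneg _) (by positivity)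
      _ ≤ (c * R ^ i) * (c' * R ^ (n - 1 - i)) := by gcongr
      _ = _ := by field_simp
  refine (norm_sum_le _ _).trans ((Finset.sum_le_sum h).trans (le_of_eq ?_))
  rw [Finset.sum_const, Finset.card_range, nsmul_eq_mul]
  ring

end Decay

/-! ### Bounds on the shifted contour -/

section Bounds

open Complex MeasureTheory

variable {X Y : ℕ → ℂ → ℂ} {u a u' b : ℂ → ℂ} {β β' r r' x : ℝ} {k : ℕ → ℕ}

/-- To first order `|u(στ)| ≤ 1 + σβτ + ετ`, and this is below `1 + yτ ≤ e^{yτ}` once `ε < y - σβ`.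
-/
theorem eventually_norm_lt_exp {y σ : ℝ} (hu0 : u 0 = 1) (hu : HasDerivAt u β 0)
    (h : σ * β < y) : ∀ᶠ τ in 𝓝[>] (0 : ℝ), ‖u ((σ * τ : ℝ) : ℂ)‖ < Real.exp (y * τ) := by
  have hw : HasDerivAt (fun τ : ℝ => u ((σ * τ : ℝ) : ℂ)) (β * σ) 0 := by
    have h1 : HasDerivAt (fun τ : ℝ => ((σ * τ : ℝ) : ℂ)) (σ : ℂ) 0 := by
      simpa using ((hasDerivAt_id (0 : ℝ)).const_mul σ).ofReal_comp
    exact HasDerivAt.comp_of_eq (0 : ℝ) hu h1 (by simp)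
  set ε := (y - σ * β) / 2 with hε
  have hε0 : 0 < ε := by
    rw [hε]
    linarith
  have h1 := (hasDerivAt_iff_isLittleO.mp hw).def hε0
  have h2 : ∀ᶠ τ in 𝓝 (0 : ℝ), 0 < 1 + σ * β * τ := by
    have : ContinuousAt (fun τ : ℝ => 1 + σ * β * τ) 0 := by fun_prop
    exact this.eventually (lt_mem_nhds (by simp))
  filter_upwards [mem_nhdsWithin_of_mem_nhds h1, mem_nhdsWithin_of_mem_nhds h2,
    self_mem_nhdsWithin] with τ h3 h4 h5
  rw [Set.mem_Ioi] at h5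
  simp only [mul_zero, ofReal_zero, hu0, sub_zero, Real.norm_of_nonneg h5.le] at h3
  have h6 : ‖u ((σ * τ : ℝ) : ℂ)‖ ≤ ‖((1 + σ * β * τ : ℝ) : ℂ)‖ + ε * τ := by
    have h7 := norm_add_le ((1 + σ * β * τ : ℝ) : ℂ)
      (u ((σ * τ : ℝ) : ℂ) - 1 - τ • ((β : ℂ) * σ))
    have h8 : ((1 + σ * β * τ : ℝ) : ℂ) + (u ((σ * τ : ℝ) : ℂ) - 1 - τ • ((β : ℂ) * σ)) =
        u ((σ * τ : ℝ) : ℂ) := by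
      rw [real_smul]
      push_cast
      ring
    rw [h8] at h7
    linarith
  rw [norm_real, Real.norm_of_nonneg h4.le] at h6
  have h7 := Real.add_one_le_exp (y * τ)
  have h8 : ε * τ < (y - σ * β) * τ := mul_lt_mul_of_pos_right (by rw [hε]; linarith) h5
  nlinarith

theorem eventually_mul_exp_lt {W t q : ℝ} (hk : Tendsto (fun n : ℕ => (k n : ℝ) / n) atTop (𝓝 x))
    (hW : W * Real.exp (t * x) < q) (hW0 : 0 < W) :
    ∀ᶠ n : ℕ in atTop, W ^ n * Real.exp (t * k n) ≤ q ^ n := by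
  have h1 : Tendsto (fun n : ℕ => W * Real.exp (t * ((k n : ℝ) / n))) atTop
      (𝓝 (W * Real.exp (t * x))) :=
    ((Real.continuous_exp.tendsto _).comp (hk.const_mul t)).const_mul W
  filter_upwards [h1.eventually (gt_mem_nhds hW), eventually_gt_atTop 0] with n h2 h3
  have h4 : W ^ n * Real.exp (t * k n) = (W * Real.exp (t * ((k n : ℝ) / n))) ^ n := by
    rw [mul_pow, ← Real.exp_nat_mul]
    congr 2
    field_simp
  rw [h4]
  exact pow_le_pow_left₀ (by positivity) h2.le n

theorem eventually_mul_exp_lt_one {W : ℝ} (hW : W < 1) (y : ℝ) :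
    ∀ᶠ τ in 𝓝[>] (0 : ℝ), W * Real.exp (τ * y) < 1 := by
  have : ContinuousAt (fun τ : ℝ => W * Real.exp (τ * y)) 0 := by fun_prop
  exact mem_nhdsWithin_of_mem_nhds (this.eventually (gt_mem_nhds (by simpa using hW)))

theorem norm_exp_neg_mul (m : ℕ) (s : ℂ) : ‖cexp (-(m * s))‖ = Real.exp (-s.re * m) := by
  rw [norm_exp]
  congr 1
  simp
  ring

/-- On the shifted contour the powers of the base are negligible against `e^{ks}`. -/
theorem QuasiPower.contour_bound (hX : QuasiPower X u a β r) {σ δ ρ₀ : ℝ} (hσ : |σ| = 1)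
    (hβ : σ * β < σ * x) (hδ : 0 < δ) (hδr : δ < r) (hδπ : δ ≤ Real.pi) (hρ0 : 0 < ρ₀)
    (hρ1 : ρ₀ < 1) (hk : Tendsto (fun n : ℕ => (k n : ℝ) / n) atTop (𝓝 x)) :
    ∀ᶠ τ in 𝓝[>] (0 : ℝ), ∃ q : ℝ, 0 < q ∧ q < 1 ∧ ∃ C : ℝ, 0 < C ∧ ∀ᶠ n : ℕ in atTop,
      ∀ i ≤ n, ∀ s ∈ threeSides δ (σ * τ),
        ‖u s‖ ^ i * ρ₀ ^ (n - i) * ‖cexp (-(k n * s))‖ ≤ C * q ^ n := by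
  obtain ⟨ρ₁, hρ₁0, hρ₁1, C, hC, hre⟩ := hX.base_le_re
  have hub : ∀ θ : ℝ, |θ| = δ → ‖u (θ * I)‖ < 1 := fun θ hθ =>
    hX.base_lt_one θ (fun h => by rw [h, abs_zero] at hθ; exact hδ.ne hθ) (hθ ▸ hδr) (hθ ▸ hδπ)
  -- A bound `w < 1` above `|u(±iδ)|` and `ρ₀` serves the horizontal sides: for small `τ` they stay
  -- close to `±iδ`, and the growth `e^{τk}` of the exponential costs less than the gain `w^n`.
  obtain ⟨w, hw, hw1⟩ := exists_between
    (max_lt (max_lt (hub δ (abs_of_pos hδ)) (hub (-δ) (by rw [abs_neg, abs_of_pos hδ]))) hρ1)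
  simp only [max_lt_iff] at hw
  obtain ⟨⟨hwa, hwb⟩, hwρ⟩ := hw
  have hw0 : 0 < w := hρ0.trans hwρ
  have hcont : ∀ θ : ℝ, |θ| = δ → ‖u (θ * I)‖ < w →
      ∀ᶠ s in 𝓝 ((θ : ℂ) * I), ‖u s‖ < w := fun θ hθ h => by
    have hmem : Metric.ball (0 : ℂ) r ∈ 𝓝 ((θ : ℂ) * I) :=
      Metric.isOpen_ball.mem_nhds (by simpa [hθ] using hδr)
    exact (hX.differentiableOn_base.continuousOn.continuousAt hmem).norm.eventually (gt_mem_nhds h)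
  obtain ⟨η₁, hη₁, h1⟩ := Metric.eventually_nhds_iff_ball.mp (hcont δ (abs_of_pos hδ) hwa)
  obtain ⟨η₂, hη₂, h2⟩ := Metric.eventually_nhds_iff_ball.mp
    (hcont (-δ) (by rw [abs_neg, abs_of_pos hδ]) hwb)
  have hσ2 : σ * σ = 1 := by rw [← abs_mul_abs_self, hσ, one_mul]
  filter_upwards [eventually_norm_lt_exp hX.base_zero hX.hasDerivAt_base hβ,
    eventually_mul_exp_lt_one (max_lt hρ1 hρ₁1) (-(σ * x)), eventually_mul_exp_lt_one hw1 x,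
    mem_nhdsWithin_of_mem_nhds (gt_mem_nhds hη₁), mem_nhdsWithin_of_mem_nhds (gt_mem_nhds hη₂),
    mem_nhdsWithin_of_mem_nhds (gt_mem_nhds (show 0 < r - δ by linarith)),
    self_mem_nhdsWithin] with τ e1 e2 e3 e4 e5 e6 e7
  rw [Set.mem_Ioi] at e7
  set W := max ‖u ((σ * τ : ℝ) : ℂ)‖ (max ρ₀ ρ₁) with hW
  have hW0 : 0 < W := lt_max_of_lt_right (lt_max_of_lt_left hρ0)
  have hWx : W * Real.exp (-(σ * τ) * x) < 1 := by
    rcases le_total ‖u ((σ * τ : ℝ) : ℂ)‖ (max ρ₀ ρ₁) with h | h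
    · rw [hW, max_eq_right h]
      convert e2 using 3
      ring
    · rw [hW, max_eq_left h]
      calc _ < Real.exp (σ * x * τ) * Real.exp (-(σ * τ) * x) :=
            mul_lt_mul_of_pos_right e1 (Real.exp_pos _)
        _ = 1 := by
            rw [← Real.exp_add, ← Real.exp_zero]
            congr 1
            ring
  obtain ⟨q, hq, hq1⟩ := exists_between (max_lt hWx e3)
  rw [max_lt_iff] at hq
  have hq0 : 0 < q := lt_trans (by positivity) hq.1
  -- The constant covers both cases: 1 on the horizontal sides and `2 * C` on the vertical side.
  refine ⟨q, hq0, hq1, 2 * C + 1, by positivity, ?_⟩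
  filter_upwards [eventually_mul_exp_lt hk hq.1 hW0, eventually_mul_exp_lt hk hq.2 hw0]
    with n hn1 hn2 i hi s hs
  have hsτ : |s.re| ≤ τ := by
    rcases hs with ⟨-, h⟩ | ⟨h, -⟩
    · have h3 := Set.abs_sub_left_of_mem_uIcc h
      rwa [sub_zero, sub_zero, abs_mul, hσ, one_mul, abs_of_pos e7] at h3
    · rw [h, abs_mul, hσ, one_mul, abs_of_pos e7]
  have hsim : |s.im| ≤ δ := by
    rcases hs with ⟨h, -⟩ | ⟨-, h⟩
    · exact h.le
    · exact h
  have hsr : s ∈ Metric.ball (0 : ℂ) r := by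
    rw [mem_ball_zero_iff]
    have := norm_le_abs_re_add_abs_im s
    linarith
  have hsplit : ∀ c : ℝ, 0 ≤ c → ρ₀ ≤ c → c ^ i * ρ₀ ^ (n - i) ≤ c ^ n := fun c hc hρc => by
    calc c ^ i * ρ₀ ^ (n - i) ≤ c ^ i * c ^ (n - i) := by gcongr
      _ = c ^ n := by rw [← pow_add, Nat.add_sub_cancel' hi]
  rw [norm_exp_neg_mul]
  rcases hs with ⟨him, -⟩ | ⟨hsre, -⟩
  · have hus : ‖u s‖ ≤ w := by
      have hd : ∀ θ : ℝ, s.im = θ → dist s (θ * I) ≤ τ := fun θ hθ => by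
        rw [dist_eq, show s - θ * I = (s.re : ℂ) by
          conv_lhs => rw [← re_add_im s, hθ]
          ring, norm_real]
        exact hsτ
      rcases (abs_eq hδ.le).mp him with h | h
      · exact (h1 s ((hd δ h).trans_lt e4)).le
      · exact (h2 s ((hd (-δ) h).trans_lt e5)).le
    have hek : Real.exp (-s.re * k n) ≤ Real.exp (τ * k n) :=
      Real.exp_le_exp.mpr (mul_le_mul_of_nonneg_right ((neg_le_abs _).trans hsτ)
        (Nat.cast_nonneg _))
    calc ‖u s‖ ^ i * ρ₀ ^ (n - i) * Real.exp (-s.re * k n)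
        ≤ w ^ i * ρ₀ ^ (n - i) * Real.exp (τ * k n) := by gcongr
      _ ≤ w ^ n * Real.exp (τ * k n) :=
          mul_le_mul_of_nonneg_right (hsplit w hw0.le hwρ.le) (Real.exp_pos _).le
      _ ≤ 1 * q ^ n := by rw [one_mul]; exact hn2
      _ ≤ (2 * C + 1) * q ^ n := by gcongr; linarith
  -- On the vertical side `Re s = στ`, so `base_le_re` reduces the bound to the real point `στ`,
  -- where `|u| < e^{σxτ}` is beaten by `e^{-ks}`.
  · have hus : ‖u s‖ ^ i ≤ 2 * C * W ^ i := by
      refine (hre s hsr i).trans ?_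
      rw [hsre]
      have g1 : ‖u ((σ * τ : ℝ) : ℂ)‖ ^ i ≤ W ^ i :=
        pow_le_pow_left₀ (norm_nonneg _) (le_max_left _ _) i
      have g2 : ρ₁ ^ i ≤ W ^ i :=
        pow_le_pow_left₀ hρ₁0.le ((le_max_right _ _).trans (le_max_right _ _)) i
      nlinarith
    rw [hsre]
    calc ‖u s‖ ^ i * ρ₀ ^ (n - i) * Real.exp (-(σ * τ) * k n)
        ≤ 2 * C * W ^ i * ρ₀ ^ (n - i) * Real.exp (-(σ * τ) * k n) := by gcongr
      _ = 2 * C * ((W ^ i * ρ₀ ^ (n - i)) * Real.exp (-(σ * τ) * k n)) := by ring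
      _ ≤ 2 * C * (W ^ n * Real.exp (-(σ * τ) * k n)) := by
          gcongr
          exact hsplit W hW0.le ((le_max_left _ _).trans (le_max_right _ _))
      _ ≤ 2 * C * q ^ n := by gcongr
      _ ≤ (2 * C + 1) * q ^ n := by gcongr; linarith

end Bounds

/-! ### The convolution between the two drifts -/

section Convolution

open Complex MeasureTheory

variable {X Y : ℕ → ℂ → ℂ} {u a u' b : ℂ → ℂ} {β β' r r' x σ δ R : ℝ} {k : ℕ → ℕ}

theorem rect_subset_ball {τ : ℝ} (hδ : 0 ≤ δ) (h : |τ| + δ < R) :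
    Set.uIcc 0 τ ×ℂ Set.uIcc (-δ) δ ⊆ Metric.ball (0 : ℂ) R := by
  intro s hs
  obtain ⟨h1, h2⟩ := hs
  rw [Set.mem_preimage, Set.uIcc_of_le (by linarith)] at h2
  have h3 := Set.abs_sub_left_of_mem_uIcc (Set.mem_preimage.mp h1)
  rw [sub_zero, sub_zero] at h3
  rw [mem_ball_zero_iff]
  have := norm_le_abs_re_add_abs_im s
  have := abs_le.mpr h2
  linarith

theorem threeSides_subset_rect {τ : ℝ} (hδ : 0 ≤ δ) :
    threeSides δ τ ⊆ Set.uIcc 0 τ ×ℂ Set.uIcc (-δ) δ := by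
  intro s hs
  have h0 : Set.uIcc (-δ) δ = Set.Icc (-δ) δ := Set.uIcc_of_le (by linarith)
  rcases hs with ⟨h1, h2⟩ | ⟨h1, h2⟩
  · exact ⟨h2, by rw [Set.mem_preimage, h0]; exact abs_le.mp h1.le⟩
  · exact ⟨by simp [h1], by rw [Set.mem_preimage, h0]; exact abs_le.mp h2⟩

/-- A pure power convolved with a geometrically small sequence has no pole, so moving the contour in
the favourable direction leaves no residue. The factor `ρ₀ ^ (n - i)` in `contour_bound` is there
for this convolution. -/
theorem QuasiPower.geomSmall_integral_sum (hX : QuasiPower X u a β r) (hσ : |σ| = 1)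
    (hβ : σ * β < σ * x) (hδ : 0 < δ) (hδR : δ < R) (hRr : R ≤ r) (hRπ : R ≤ Real.pi)
    (hk : Tendsto (fun n : ℕ => (k n : ℝ) / n) atTop (𝓝 x)) {Q : ℕ → ℂ → ℂ} {ρ₀ c : ℝ}
    (hρ0 : 0 < ρ₀) (hρ1 : ρ₀ < 1) (hQd : ∀ j, DifferentiableOn ℂ (Q j) (Metric.ball 0 R))
    (hQ : ∀ s ∈ Metric.ball (0 : ℂ) R, ∀ j, ‖Q j s‖ ≤ c * ρ₀ ^ j) :
    GeomSmall fun n => ∫ y in (-δ)..δ, (∑ i ∈ Finset.range n, u (y * I) ^ i *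
      Q (n - 1 - i) (y * I)) * cexp (-(k n * (y * I))) := by
  obtain ⟨τ, ⟨q, hq0, hq1, C, hC, hbd⟩, hτR, hτ⟩ :=
    ((hX.contour_bound hσ hβ hδ (hδR.trans_le hRr) ((hδR.trans_le hRπ).le) hρ0 hρ1 hk).and
      ((eventually_nhdsWithin_of_eventually_nhds (gt_mem_nhds (sub_pos.mpr hδR))).and
        self_mem_nhdsWithin)).exists
  have hrect : Set.uIcc 0 (σ * τ) ×ℂ Set.uIcc (-δ) δ ⊆ Metric.ball (0 : ℂ) R :=
    rect_subset_ball hδ.le (by rw [abs_mul, hσ, one_mul, abs_of_pos hτ]; linarith)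
  have hc : 0 ≤ c := by
    have := (norm_nonneg _).trans (hQ 0 (Metric.mem_ball_self (hδ.trans hδR)) 0)
    simpa using this
  refine GeomSmall.of_le (C := c / ρ₀ * C * (2 * δ + 2 * |σ * τ|)) hq0 hq1 ?_
  filter_upwards [hbd] with n hn
  have hd : DifferentiableOn ℂ (fun s => (∑ i ∈ Finset.range n, u s ^ i * Q (n - 1 - i) s) *
      cexp (-(k n * s))) (Metric.ball 0 R) := by
    refine DifferentiableOn.mul (DifferentiableOn.fun_sum fun i _ =>
      DifferentiableOn.mul ?_ (hQd _))
      (by fun_prop)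
    exact (hX.differentiableOn_base.mono (Metric.ball_subset_ball hRr)).pow i
  have h1 := integral_eq_sideIntegral (hd.mono hrect)
  rw [h1]
  refine (norm_sideIntegral_le hδ.le (K := n * (c / ρ₀ * (C * q ^ n))) fun s hs => ?_).trans
    (le_of_eq (by ring))
  rw [Finset.sum_mul]
  refine (norm_sum_le _ _).trans ?_
  have h2 : ∀ i ∈ Finset.range n, ‖u s ^ i * Q (n - 1 - i) s * cexp (-(k n * s))‖ ≤
      c / ρ₀ * (C * q ^ n) := by
    intro i hi
    have hi' := Finset.mem_range.mp hi
    have h3 : ρ₀ ^ (n - i) = ρ₀ ^ (n - 1 - i) * ρ₀ := by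
      rw [← pow_succ]
      congr 1
      omega
    rw [norm_mul, norm_mul, norm_pow]
    calc ‖u s‖ ^ i * ‖Q (n - 1 - i) s‖ * ‖cexp (-(k n * s))‖
        ≤ ‖u s‖ ^ i * (c * ρ₀ ^ (n - 1 - i)) * ‖cexp (-(k n * s))‖ := by
          gcongr
          exact hQ s (hrect (threeSides_subset_rect hδ.le hs)) _
      _ = c / ρ₀ * (‖u s‖ ^ i * ρ₀ ^ (n - i) * ‖cexp (-(k n * s))‖) := by
          rw [h3]
          field_simp
      _ ≤ c / ρ₀ * (C * q ^ n) :=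
          mul_le_mul_of_nonneg_left (hn i hi'.le s hs) (div_nonneg hc hρ0.le)
  refine (Finset.sum_le_sum h2).trans (le_of_eq ?_)
  rw [Finset.sum_const, Finset.card_range, nsmul_eq_mul]

/-- After the shift, `F(s)/s` is exponentially small on the three sides, and the subtracted `F(0)/s`
contributes the half residue `σπ F(0)`, with `F(0) = ψ(0)` whatever `n` and `k n` are. -/
theorem QuasiPower.geomSmall_integral_dslope (hX : QuasiPower X u a β r) (hσ : σ = 1 ∨ σ = -1)
    (hβ : σ * β < σ * x) (hδ : 0 < δ) (hδR : δ < R) (hRr : R ≤ r) (hRπ : R ≤ Real.pi)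
    (hk : Tendsto (fun n : ℕ => (k n : ℝ) / n) atTop (𝓝 x)) {ψ : ℂ → ℂ} {K : ℝ}
    (hψd : DifferentiableOn ℂ ψ (Metric.ball 0 R))
    (hψ : ∀ s ∈ Metric.ball (0 : ℂ) R, ‖ψ s‖ ≤ K) :
    GeomSmall fun n => (∫ y in (-δ)..δ, dslope (fun s => u s ^ n * ψ s * cexp (-(k n * s))) 0
      (y * I)) + σ * Real.pi * ψ 0 := by
  have hσ' : |σ| = 1 := by rcases hσ with rfl | rfl <;> simp
  -- The value `1 / 2` for `ρ₀` is a dummy: only `i = n` is used, where the factor `ρ₀ ^ (n - i)` is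
  -- 1.
  obtain ⟨τ, ⟨q, hq0, hq1, C, hC, hbd⟩, hτR, hτ⟩ :=
    ((hX.contour_bound hσ' hβ hδ (hδR.trans_le hRr) ((hδR.trans_le hRπ).le)
      (show (0 : ℝ) < 1 / 2 by norm_num) (by norm_num) hk).and
      ((eventually_nhdsWithin_of_eventually_nhds (gt_mem_nhds (sub_pos.mpr hδR))).and
        self_mem_nhdsWithin)).exists
  have hστ : |σ * τ| = τ := by rw [abs_mul, hσ', one_mul, abs_of_pos hτ]
  have hστ0 : σ * τ ≠ 0 := abs_pos.mp (by rwa [hστ])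
  have hrect : Set.uIcc 0 (σ * τ) ×ℂ Set.uIcc (-δ) δ ⊆ Metric.ball (0 : ℂ) R :=
    rect_subset_ball hδ.le (by rw [hστ]; linarith)
  have hinv : sideIntegral (fun s => s⁻¹) δ (σ * τ) = σ * Real.pi := by
    rcases hσ with rfl | rfl
    · rw [sideIntegral_inv_of_pos hδ (by linarith)]
      simp
    · rw [sideIntegral_inv_of_neg hδ (by linarith)]
      simp
  have hK : 0 ≤ K := (norm_nonneg _).trans (hψ 0 (Metric.mem_ball_self (hδ.trans hδR)))
  have hm : 0 < min δ τ := lt_min hδ hτ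
  refine GeomSmall.of_le (C := K / min δ τ * C * (2 * δ + 2 * |σ * τ|)) hq0 hq1 ?_
  filter_upwards [hbd, eventually_ge_atTop 1] with n hn hn1
  have hd : DifferentiableOn ℂ (fun s => u s ^ n * ψ s * cexp (-(k n * s))) (Metric.ball 0 R) :=
    (((hX.differentiableOn_base.mono (Metric.ball_subset_ball hRr)).pow n).mul hψd).mul
      (by fun_prop)
  rw [integral_dslope Metric.isOpen_ball hd hδ hστ0 hrect, hinv]
  have h1 : u 0 ^ n * ψ 0 * cexp (-(k n * 0)) * (σ * Real.pi) = σ * Real.pi * ψ 0 := by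
    rw [hX.base_zero, one_pow, mul_zero, neg_zero, exp_zero]
    ring
  rw [h1, sub_add_cancel]
  refine (norm_sideIntegral_le hδ.le (K := K / min δ τ * (C * q ^ n)) fun s hs => ?_).trans ?_
  · have hs1 : min δ τ ≤ ‖s‖ := by
      rcases hs with ⟨h2, -⟩ | ⟨h2, -⟩
      · exact (min_le_left _ _).trans (h2 ▸ abs_im_le_norm s)
      · refine (min_le_right _ _).trans ?_
        rw [← hστ, ← h2]
        exact abs_re_le_norm s
    have h2 := hn n le_rfl s hs
    rw [Nat.sub_self, pow_zero, mul_one] at h2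
    rw [norm_mul, norm_mul, norm_mul, norm_pow, norm_inv]
    calc ‖u s‖ ^ n * ‖ψ s‖ * ‖cexp (-(k n * s))‖ * ‖s‖⁻¹
        = ‖ψ s‖ * ‖s‖⁻¹ * (‖u s‖ ^ n * ‖cexp (-(k n * s))‖) := by ring
      _ ≤ K * (min δ τ)⁻¹ * (C * q ^ n) := by
          gcongr
          exact hψ s (hrect (threeSides_subset_rect hδ.le hs))
      _ = _ := by rw [div_eq_mul_inv]
  · have h2 : (1 : ℝ) ≤ n := by exact_mod_cast hn1
    have h3 : 0 ≤ K / min δ τ * C * (2 * δ + 2 * |σ * τ|) * q ^ n := by positivity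
    nlinarith

/-- The central local estimate: the convolution of two quasi-power sequences with different
drifts, at a point strictly between the two drifts. -/
theorem geomSmall_convolution (hX : QuasiPower X u a β r) (hY : QuasiPower Y u' b β' r')
    (h1 : β < x) (h2 : x < β') (hk : Tendsto (fun n : ℕ => (k n : ℝ) / n) atTop (𝓝 x)) :
    GeomSmall fun n => (∫ θ in (-Real.pi)..Real.pi, (∑ i ∈ Finset.range n, X i (θ * I) *
      Y (n - 1 - i) (θ * I)) * cexp (-(k n * (θ * I)))) - 2 * Real.pi * (a 0 * b 0 / (β' - β)) := by
  -- `u - u' = s D(s)` with `D(0) = β - β' ≠ 0`, so `1 / (u - u')` has exactly a simple pole at `0`;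
  -- `R` is chosen small enough to keep `D` away from zero.
  set D : ℂ → ℂ := dslope (fun s => u s - u' s) 0 with hD
  have hmin : 0 < min r r' := lt_min hX.r_pos hY.r_pos
  have hDd : DifferentiableOn ℂ D (Metric.ball 0 (min r r')) :=
    (differentiableOn_dslope (Metric.ball_mem_nhds _ hmin)).mpr
      ((hX.differentiableOn_base.mono (Metric.ball_subset_ball (min_le_left _ _))).sub
        (hY.differentiableOn_base.mono (Metric.ball_subset_ball (min_le_right _ _))))
  have hD0 : D 0 = β - β' := by
    rw [hD, dslope_same]
    exact (hX.hasDerivAt_base.sub hY.hasDerivAt_base).deriv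
  have hββ : (β : ℂ) - β' ≠ 0 := by
    rw [← ofReal_sub, ofReal_ne_zero]
    linarith
  have hDc : ContinuousAt D 0 := (hDd.continuousOn).continuousAt (Metric.ball_mem_nhds _ hmin)
  obtain ⟨m, hm0, hm⟩ := exists_between (norm_pos_iff.mpr hββ)
  have hDm : ∀ᶠ s in 𝓝 (0 : ℂ), m < ‖D s‖ :=
    hDc.norm.eventually (lt_mem_nhds (by simpa only [hD0] using hm))
  obtain ⟨R₀, hR₀, hDR⟩ := Metric.eventually_nhds_iff_ball.mp hDm
  set R := min (min R₀ Real.pi) (min r r') with hR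
  have hR0 : 0 < R := lt_min (lt_min hR₀ Real.pi_pos) hmin
  have hRr : R ≤ r := (min_le_right _ _).trans (min_le_left _ _)
  have hRr' : R ≤ r' := (min_le_right _ _).trans (min_le_right _ _)
  have hRπ : R ≤ Real.pi := (min_le_left _ _).trans (min_le_right _ _)
  have hRR₀ : R ≤ R₀ := (min_le_left _ _).trans (min_le_left _ _)
  set δ := R / 2 with hδdef
  have hδ : 0 < δ := half_pos hR0
  have hδR : δ < R := half_lt_self hR0
  have hud := hX.differentiableOn_base.mono (Metric.ball_subset_ball hRr)
  have had := hX.differentiableOn_coeff.mono (Metric.ball_subset_ball hRr)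
  have hud' := hY.differentiableOn_base.mono (Metric.ball_subset_ball hRr')
  have hbd := hY.differentiableOn_coeff.mono (Metric.ball_subset_ball hRr')
  obtain ⟨Ka, hKa, ha⟩ := hX.coeff_bounded
  obtain ⟨Kb, hKb, hb⟩ := hY.coeff_bounded
  obtain ⟨ρ, hρ0, hρ1, C, hC, hXa⟩ := hX.approx
  obtain ⟨ρ', hρ0', hρ1', C', hC', hYa⟩ := hY.approx
  obtain ⟨ρ₁, hρ₁0, hρ₁1, C₁, hC₁, hXarc⟩ := hX.arc δ hδ
  obtain ⟨ρ₂, hρ₂0, hρ₂1, C₂, hC₂, hYarc⟩ := hY.arc δ hδ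
  have hball : ∀ s ∈ Metric.ball (0 : ℂ) R, s ∈ Metric.ball (0 : ℂ) r ∧ s ∈ Metric.ball (0 : ℂ) r' ∧
      m < ‖D s‖ := fun s hs => ⟨Metric.ball_subset_ball hRr hs, Metric.ball_subset_ball hRr' hs,
        hDR s (Metric.ball_subset_ball hRR₀ hs)⟩
  set ψ : ℂ → ℂ := fun s => a s * b s / D s with hψ
  have hψd : DifferentiableOn ℂ ψ (Metric.ball 0 R) :=
    (had.mul hbd).div (hDd.mono (Metric.ball_subset_ball (min_le_right _ _)))
      fun s hs => norm_pos_iff.mp (hm0.trans (hball s hs).2.2)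
  have hψb : ∀ s ∈ Metric.ball (0 : ℂ) R, ‖ψ s‖ ≤ Ka * Kb / m := fun s hs => by
    obtain ⟨g1, g2, g3⟩ := hball s hs
    rw [hψ, norm_div, norm_mul]
    have := ha s g1
    have := hb s g2
    gcongr
  have hψ0 : ψ 0 = a 0 * b 0 / (β - β') := by rw [← hD0]
  set P : ℕ → ℂ → ℂ := fun i s => X i s - u s ^ i * a s with hP
  set Q : ℕ → ℂ → ℂ := fun j s => Y j s - u' s ^ j * b s with hQ
  have hPd : ∀ i, DifferentiableOn ℂ (P i) (Metric.ball 0 R) := fun i =>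
    (hX.differentiable i).differentiableOn.sub ((hud.pow i).mul had)
  have hQd : ∀ i, DifferentiableOn ℂ (Q i) (Metric.ball 0 R) := fun i =>
    (hY.differentiable i).differentiableOn.sub ((hud'.pow i).mul hbd)
  have hseg : ∀ y ∈ Set.uIcc (-δ) δ, (y * I : ℂ) ∈ Metric.ball (0 : ℂ) R := fun y hy => by
    rw [Set.uIcc_of_le (by linarith)] at hy
    have := abs_le.mpr hy
    simpa using lt_of_le_of_lt this hδR
  have hint : ∀ f : ℂ → ℂ, DifferentiableOn ℂ f (Metric.ball 0 R) →
      IntervalIntegrable (fun y : ℝ => f (y * I)) volume (-δ) δ := fun f hf =>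
    (hf.continuousOn.comp (by fun_prop) hseg).intervalIntegrable
  have hnorm : ∀ (n : ℕ) (y : ℝ), ‖cexp (-(k n * (y * I)))‖ = 1 := fun n y => by
    rw [norm_exp_neg_mul]
    simp
  -- the three error terms and the main term on the inner segment
  have E1 := hX.geomSmall_integral_sum (σ := 1) (by simp) (by simpa using h1) hδ hδR hRr hRπ hk
    (Q := fun j s => a s * Q j s) (c := Ka * C') hρ0' hρ1' (fun j => had.mul (hQd j))
    (fun s hs j => by
      rw [norm_mul, mul_assoc]
      exact mul_le_mul (ha s (hball s hs).1) (hYa s (hball s hs).2.1 j) (norm_nonneg _) hKa.le)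
  have E2 := hY.geomSmall_integral_sum (σ := -1) (by simp) (by simpa using h2) hδ hδR hRr' hRπ hk
    (Q := fun j s => b s * P j s) (c := Kb * C) hρ0 hρ1 (fun j => hbd.mul (hPd j))
    (fun s hs j => by
      rw [norm_mul, mul_assoc]
      exact mul_le_mul (hb s (hball s hs).2.1) (hXa s (hball s hs).1 j) (norm_nonneg _) hKb.le)
  have E3 : GeomSmall fun n => ∫ y in (-δ)..δ, (∑ i ∈ Finset.range n, P i (y * I) *
      Q (n - 1 - i) (y * I)) * cexp (-(k n * (y * I))) := by
    refine GeomSmall.of_le (lt_max_of_lt_left hρ0) (max_lt hρ1 hρ1')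
      (C := C * C' / max ρ ρ' * |δ - -δ|) (Eventually.of_forall fun n => ?_)
    refine (intervalIntegral.norm_integral_le_of_norm_le_const
      (C := C * C' / max ρ ρ' * (n * max ρ ρ' ^ n)) fun y hy => ?_).trans (le_of_eq (by ring))
    have hy' := hball _ (hseg y (Set.uIoc_subset_uIcc hy))
    rw [norm_mul, hnorm, mul_one]
    exact norm_convolution_le hC.le hρ0.le hρ0'.le (lt_max_of_lt_left hρ0) (le_max_left _ _)
      (le_max_right _ _) (hXa _ hy'.1) (hYa _ hy'.2.1) n
  have F1 := hX.geomSmall_integral_dslope (σ := 1) (Or.inl rfl) (by simpa using h1) hδ hδR hRr hRπ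
    hk hψd hψb
  have F2 := hY.geomSmall_integral_dslope (σ := -1) (Or.inr rfl) (by simpa using h2) hδ hδR hRr'
    hRπ hk hψd hψb
  have hout : ∀ c d : ℝ, (∀ y ∈ Set.uIoc c d, δ ≤ |y| ∧ |y| ≤ Real.pi) →
      GeomSmall fun n => ∫ y in c..d, (∑ i ∈ Finset.range n, X i (y * I) *
        Y (n - 1 - i) (y * I)) * cexp (-(k n * (y * I))) := by
    intro c d hcd
    refine GeomSmall.of_le (lt_max_of_lt_left hρ₁0) (max_lt hρ₁1 hρ₂1)
      (C := C₁ * C₂ / max ρ₁ ρ₂ * |d - c|) (Eventually.of_forall fun n => ?_)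
    refine (intervalIntegral.norm_integral_le_of_norm_le_const
      (C := C₁ * C₂ / max ρ₁ ρ₂ * (n * max ρ₁ ρ₂ ^ n)) fun y hy => ?_).trans (le_of_eq (by ring))
    obtain ⟨g1, g2⟩ := hcd y hy
    rw [norm_mul, hnorm, mul_one]
    exact norm_convolution_le hC₁.le hρ₁0.le hρ₂0.le (lt_max_of_lt_left hρ₁0) (le_max_left _ _)
      (le_max_right _ _) (hXarc y g1 g2) (hYarc y g1 g2) n
  have hδπ : δ ≤ Real.pi := hδR.le.trans hRπ
  have O1 := hout (-Real.pi) (-δ) fun y hy => by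
    rw [Set.uIoc_of_le (by linarith)] at hy
    rw [abs_of_nonpos (by linarith [hy.2])]
    exact ⟨by linarith [hy.2], by linarith [hy.1]⟩
  have O2 := hout δ Real.pi fun y hy => by
    rw [Set.uIoc_of_le hδπ] at hy
    rw [abs_of_pos (by linarith [hy.1])]
    exact ⟨hy.1.le, hy.2⟩
  refine ((((O1.add O2).add E1).add E2).add (E3.add (F1.add F2.neg))).congr fun n => ?_
  set e : ℂ → ℂ := fun s => cexp (-(k n * s)) with he
  have hed : DifferentiableOn ℂ e (Metric.ball 0 R) := by
    rw [he]
    fun_prop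
  have hfull : Continuous fun y : ℝ => (∑ i ∈ Finset.range n, X i (y * I) *
      Y (n - 1 - i) (y * I)) * cexp (-(k n * (y * I))) := by
    refine Continuous.mul (continuous_finsetSum _ fun i _ => ?_) (by fun_prop)
    exact ((hX.differentiable i).continuous.comp (by fun_prop)).mul
      ((hY.differentiable _).continuous.comp (by fun_prop))
  set G1 : ℂ → ℂ := fun s => u s ^ n * ψ s * e s with hG1
  set G2 : ℂ → ℂ := fun s => u' s ^ n * ψ s * e s with hG2
  have hRn : Metric.ball (0 : ℂ) R ∈ 𝓝 (0 : ℂ) := Metric.ball_mem_nhds _ hR0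
  have hG1d : DifferentiableOn ℂ (dslope G1 0) (Metric.ball 0 R) :=
    (differentiableOn_dslope hRn).mpr (((hud.pow n).mul hψd).mul hed)
  have hG2d : DifferentiableOn ℂ (dslope G2 0) (Metric.ball 0 R) :=
    (differentiableOn_dslope hRn).mpr (((hud'.pow n).mul hψd).mul hed)
  -- With `X = u^i a + P` and `Y = u'^j b + Q`, the four products are the geometric sum of pure
  -- powers, two mixed sums, and error times error. The geometric sum is a difference of two
  -- functions with simple poles; `G1 0 = G2 0`, so both poles can be subtracted without changing
  -- it.
  have hpt : ∀ s ∈ Metric.ball (0 : ℂ) R, s ≠ 0 →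
      (∑ i ∈ Finset.range n, X i s * Y (n - 1 - i) s) * e s =
      (∑ i ∈ Finset.range n, u s ^ i * (a s * Q (n - 1 - i) s)) * e s +
      (∑ i ∈ Finset.range n, u' s ^ i * (b s * P (n - 1 - i) s)) * e s +
      (∑ i ∈ Finset.range n, P i s * Q (n - 1 - i) s) * e s +
      (dslope G1 0 s - dslope G2 0 s) := by
    intro s hs hs0
    have hDs : D s ≠ 0 := norm_pos_iff.mp (hm0.trans (hball s hs).2.2)
    have huu : u s - u' s = s * D s := by
      rw [hD, dslope_of_ne _ hs0, slope_def_field, sub_zero, hX.base_zero, hY.base_zero]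
      field_simp
      ring
    have hmain : dslope G1 0 s - dslope G2 0 s =
        (∑ i ∈ Finset.range n, u s ^ i * u' s ^ (n - 1 - i)) * (a s * b s) * e s := by
      have hgeom := (Commute.all (u s) (u' s)).geom_sum₂_mul n
      rw [dslope_of_ne _ hs0, dslope_of_ne _ hs0, slope_def_field, slope_def_field, ← sub_div]
      have hG0 : G1 0 = G2 0 := by simp only [hG1, hG2, hX.base_zero, hY.base_zero]
      rw [hG0, sub_sub_sub_cancel_right, sub_zero]
      have : G1 s - G2 s = (u s ^ n - u' s ^ n) * ψ s * e s := by
        simp only [hG1, hG2]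
        ring
      rw [this, ← hgeom, huu, hψ]
      field_simp
    have hrefl : ∑ i ∈ Finset.range n, u' s ^ i * (b s * P (n - 1 - i) s) =
        ∑ i ∈ Finset.range n, u' s ^ (n - 1 - i) * (b s * P i s) := by
      rw [← Finset.sum_range_reflect]
      refine Finset.sum_congr rfl fun i hi => ?_
      have := Finset.mem_range.mp hi
      rw [show n - 1 - (n - 1 - i) = i by omega]
    rw [hmain, hrefl, ← add_mul, ← add_mul, ← add_mul, ← Finset.sum_add_distrib,
      ← Finset.sum_add_distrib, Finset.sum_mul _ _ (a s * b s), ← Finset.sum_add_distrib]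
    congr 1
    refine Finset.sum_congr rfl fun i _ => ?_
    simp only [hP, hQ]
    ring
  have hS1 : DifferentiableOn ℂ (fun s => (∑ i ∈ Finset.range n, u s ^ i *
      (a s * Q (n - 1 - i) s)) * e s) (Metric.ball 0 R) :=
    (DifferentiableOn.fun_sum fun i _ => (hud.pow i).mul (had.mul (hQd _))).mul hed
  have hS2 : DifferentiableOn ℂ (fun s => (∑ i ∈ Finset.range n, u' s ^ i *
      (b s * P (n - 1 - i) s)) * e s) (Metric.ball 0 R) :=
    (DifferentiableOn.fun_sum fun i _ => (hud'.pow i).mul (hbd.mul (hPd _))).mul hed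
  have hS3 : DifferentiableOn ℂ (fun s => (∑ i ∈ Finset.range n, P i s *
      Q (n - 1 - i) s) * e s) (Metric.ball 0 R) :=
    (DifferentiableOn.fun_sum fun i _ => (hPd i).mul (hQd _)).mul hed
  have hin : ∫ y in (-δ)..δ, (∑ i ∈ Finset.range n, X i (y * I) *
      Y (n - 1 - i) (y * I)) * e (y * I) =
      (∫ y in (-δ)..δ, (∑ i ∈ Finset.range n, u (y * I) ^ i *
        (a (y * I) * Q (n - 1 - i) (y * I))) * e (y * I)) +
      (∫ y in (-δ)..δ, (∑ i ∈ Finset.range n, u' (y * I) ^ i *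
        (b (y * I) * P (n - 1 - i) (y * I))) * e (y * I)) +
      (∫ y in (-δ)..δ, (∑ i ∈ Finset.range n, P i (y * I) *
        Q (n - 1 - i) (y * I)) * e (y * I)) +
      ((∫ y in (-δ)..δ, dslope G1 0 (y * I)) - ∫ y in (-δ)..δ, dslope G2 0 (y * I)) := by
    rw [← intervalIntegral.integral_sub (hint _ hG1d) (hint _ hG2d),
      ← intervalIntegral.integral_add (hint _ hS1) (hint _ hS2),
      ← intervalIntegral.integral_add ((hint _ hS1).add (hint _ hS2)) (hint _ hS3),
      ← intervalIntegral.integral_add (((hint _ hS1).add (hint _ hS2)).add (hint _ hS3))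
        ((hint _ hG1d).sub (hint _ hG2d))]
    -- The pointwise identity was derived for `s ≠ 0`, and the single point `0` is a null set.
    refine intervalIntegral.integral_congr_ae ?_
    filter_upwards [compl_mem_ae_iff.mpr (measure_singleton (0 : ℝ))] with y hy0 hy
    exact hpt _ (hseg y (Set.uIoc_subset_uIcc hy))
      (mul_ne_zero (ofReal_ne_zero.mpr hy0) I_ne_zero)
  have hadj := intervalIntegral.integral_add_adjacent_intervals
    (hfull.intervalIntegrable (μ := volume) (-Real.pi) (-δ)) (hfull.intervalIntegrable (-δ) Real.pi)
  have hadj' := intervalIntegral.integral_add_adjacent_intervals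
    (hfull.intervalIntegrable (μ := volume) (-δ) δ) (hfull.intervalIntegrable δ Real.pi)
  -- The opposite shifts give `-πψ(0)` for `G1` and `+πψ(0)` for `G2`, and their difference
  -- `-2πψ(0)` is the claimed positive multiple of `a 0 * b 0`.
  have hψ0' : ψ 0 = -(a 0 * b 0 / (β' - β)) := by
    rw [hψ0, ← div_neg, neg_sub]
  rw [hψ0', ← hadj, ← hadj', hin]
  push_cast
  ring

end Convolution

/-! ### The remaining positions of `x`, and the passage to quotients -/

section Outside

open Complex MeasureTheory

variable {X Y : ℕ → ℂ → ℂ} {u a u' b : ℂ → ℂ} {β β' r r' x σ : ℝ} {k : ℕ → ℕ}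

theorem QuasiPower.axis_bound (hX : QuasiPower X u a β r) (hσ : |σ| = 1) (hβ : σ * β < σ * x) :
    ∀ᶠ τ in 𝓝[>] (0 : ℝ), ∃ W : ℝ, 0 < W ∧ W * Real.exp (-(σ * τ) * x) < 1 ∧ ∃ C : ℝ, 0 < C ∧
      ∀ s : ℂ, s.re = σ * τ → ∀ i, ‖X i s‖ ≤ C * W ^ i := by
  obtain ⟨ρ, hρ0, hρ1, C, hC, hXa⟩ := hX.approx
  obtain ⟨K, hK, ha⟩ := hX.coeff_bounded
  filter_upwards [eventually_norm_lt_exp hX.base_zero hX.hasDerivAt_base hβ,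
    eventually_mul_exp_lt_one hρ1 (-(σ * x)), mem_nhdsWithin_of_mem_nhds (gt_mem_nhds hX.r_pos),
    self_mem_nhdsWithin] with τ e1 e2 e3 e4
  rw [Set.mem_Ioi] at e4
  refine ⟨max ‖u ((σ * τ : ℝ) : ℂ)‖ ρ, lt_max_of_lt_right hρ0, ?_, K + C, by positivity,
    fun s hs i => ?_⟩
  · rcases le_total ‖u ((σ * τ : ℝ) : ℂ)‖ ρ with h | h
    · rw [max_eq_right h]
      convert e2 using 3
      ring
    · rw [max_eq_left h]
      calc _ < Real.exp (σ * x * τ) * Real.exp (-(σ * τ) * x) :=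
            mul_lt_mul_of_pos_right e1 (Real.exp_pos _)
        _ = 1 := by
            rw [← Real.exp_add, ← Real.exp_zero]
            congr 1
            ring
  · have hmem : ((σ * τ : ℝ) : ℂ) ∈ Metric.ball (0 : ℂ) r := by
      rw [mem_ball_zero_iff, norm_real, Real.norm_eq_abs, abs_mul, hσ, one_mul, abs_of_pos e4]
      exact e3
    have h1 := hX.norm_le_re i s
    rw [hs] at h1
    have h2 := hXa _ hmem i
    have h3 := norm_sub_norm_le (X i ((σ * τ : ℝ) : ℂ)) (u ((σ * τ : ℝ) : ℂ) ^ i *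
      a ((σ * τ : ℝ) : ℂ))
    have h4 : ‖u ((σ * τ : ℝ) : ℂ) ^ i * a ((σ * τ : ℝ) : ℂ)‖ ≤
        max ‖u ((σ * τ : ℝ) : ℂ)‖ ρ ^ i * K := by
      rw [norm_mul, norm_pow]
      exact mul_le_mul (pow_le_pow_left₀ (norm_nonneg _) (le_max_left _ _) i) (ha _ hmem)
        (norm_nonneg _) (by positivity)
    have h5 : C * ρ ^ i ≤ C * max ‖u ((σ * τ : ℝ) : ℂ)‖ ρ ^ i :=
      mul_le_mul_of_nonneg_left (pow_le_pow_left₀ hρ0.le (le_max_right _ _) i) hC.le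
    linarith

/-- Over a full period the two horizontal sides cancel, so the whole segment moves with no boundary
contribution. -/
theorem integral_shift {f : ℂ → ℂ} (hf : Differentiable ℂ f)
    (hper : ∀ s, f (s + 2 * Real.pi * I) = f s) (t : ℝ) :
    ∫ y in (-Real.pi)..Real.pi, f (y * I) = ∫ y in (-Real.pi)..Real.pi, f (t + y * I) := by
  rw [integral_eq_sideIntegral (τ := t) hf.differentiableOn, sideIntegral]
  have h : ∀ y : ℝ, f (y + (Real.pi : ℝ) * I) = f (y + (-Real.pi : ℝ) * I) := fun y => by
    rw [← hper (y + (-Real.pi : ℝ) * I)]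
    congr 1
    push_cast
    ring
  simp only [h]
  ring

theorem exp_neg_mul_periodic (m : ℕ) (s : ℂ) :
    cexp (-(m * (s + 2 * Real.pi * I))) = cexp (-(m * s)) := by
  rw [show -((m : ℂ) * (s + 2 * Real.pi * I)) = -(m * s) - m * (2 * Real.pi * I) by ring]
  exact exp_periodic.sub_nat_mul_eq m

theorem geomSmall_of_axis_bound {f : ℕ → ℂ → ℂ} (hf : ∀ n, Differentiable ℂ (f n))
    (hper : ∀ n s, f n (s + 2 * Real.pi * I) = f n s) {t W C : ℝ} (hW : 0 < W)
    (hWx : W * Real.exp (-t * x) < 1)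
    (hk : Tendsto (fun n : ℕ => (k n : ℝ) / n) atTop (𝓝 x)) (hC : 0 ≤ C)
    (hb : ∀ n, 1 ≤ n → ∀ s : ℂ, s.re = t → ‖f n s‖ ≤ C * (n * W ^ n)) :
    GeomSmall fun n => ∫ θ in (-Real.pi)..Real.pi, f n (θ * I) * cexp (-(k n * (θ * I))) := by
  obtain ⟨q, hq, hq1⟩ := exists_between hWx
  have hq0 : 0 < q := lt_trans (by positivity) hq
  refine GeomSmall.of_le (C := C * |Real.pi - -Real.pi|) hq0 hq1 ?_
  filter_upwards [eventually_mul_exp_lt hk hq hW, eventually_ge_atTop 1] with n hn hn1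
  have h := integral_shift (f := fun s => f n s * cexp (-(k n * s)))
    ((hf n).mul (by fun_prop)) (fun s => by rw [hper, exp_neg_mul_periodic]) t
  rw [h]
  refine (intervalIntegral.norm_integral_le_of_norm_le_const (C := C * (n * q ^ n))
    fun y _ => ?_).trans (le_of_eq (by ring))
  rw [norm_mul, norm_exp_neg_mul]
  have hre : ((t : ℂ) + y * I).re = t := by simp
  rw [hre]
  calc ‖f n (t + y * I)‖ * Real.exp (-t * k n) ≤ C * (n * W ^ n) * Real.exp (-t * k n) :=
        mul_le_mul_of_nonneg_right (hb n hn1 _ hre) (Real.exp_pos _).le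
    _ = C * (n * (W ^ n * Real.exp (-t * k n))) := by ring
    _ ≤ C * (n * q ^ n) := by gcongr

theorem QuasiPower.geomSmall_integral (hX : QuasiPower X u a β r) (hx : x ≠ β)
    (hk : Tendsto (fun n : ℕ => (k n : ℝ) / n) atTop (𝓝 x)) :
    GeomSmall fun n => ∫ θ in (-Real.pi)..Real.pi, X n (θ * I) * cexp (-(k n * (θ * I))) := by
  obtain ⟨σ, hσ, hβ⟩ : ∃ σ : ℝ, |σ| = 1 ∧ σ * β < σ * x := by
    rcases lt_or_gt_of_ne hx with h | h
    · exact ⟨-1, by simp, by linarith⟩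
    · exact ⟨1, by simp, by linarith⟩
  obtain ⟨τ, W, hW, hWx, C, hC, hb⟩ := (hX.axis_bound hσ hβ).exists
  refine geomSmall_of_axis_bound hX.differentiable hX.periodic hW hWx hk hC.le fun n hn s hs =>
    (hb s hs n).trans ?_
  have h1 : (1 : ℝ) ≤ n := by exact_mod_cast hn
  have h2 : 0 ≤ C * W ^ n := by positivity
  nlinarith

/-- Both factors are small on the same vertical line, so the full convolution is moved there;
neither the splitting near `0` nor a residue is involved. -/
theorem geomSmall_convolution_outside (hX : QuasiPower X u a β r) (hY : QuasiPower Y u' b β' r')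
    (hσ : |σ| = 1) (h1 : σ * β < σ * x) (h2 : σ * β' < σ * x)
    (hk : Tendsto (fun n : ℕ => (k n : ℝ) / n) atTop (𝓝 x)) :
    GeomSmall fun n => ∫ θ in (-Real.pi)..Real.pi, (∑ i ∈ Finset.range n, X i (θ * I) *
      Y (n - 1 - i) (θ * I)) * cexp (-(k n * (θ * I))) := by
  obtain ⟨τ, ⟨W, hW, hWx, C, hC, hb⟩, W', hW', hWx', C', hC', hb'⟩ :=
    ((hX.axis_bound hσ h1).and (hY.axis_bound hσ h2)).exists
  refine geomSmall_of_axis_bound (W := max W W') (t := σ * τ) (C := C * C' / max W W')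
    (f := fun n s => ∑ i ∈ Finset.range n, X i s * Y (n - 1 - i) s) (fun n => ?_) (fun n s => ?_)
    (lt_max_of_lt_left hW) ?_ hk (by positivity) fun n _ s hs => ?_
  · exact Differentiable.fun_sum fun i _ => (hX.differentiable i).mul (hY.differentiable _)
  · simp only [hX.periodic, hY.periodic]
  · rcases le_total W W' with h | h
    · rwa [max_eq_right h]
    · rwa [max_eq_left h]
  · exact norm_convolution_le hC.le hW.le hW'.le (lt_max_of_lt_left hW) (le_max_left _ _)
      (le_max_right _ _) (hb s hs) (hb' s hs) n

theorem geomSmall_convolution_density (hX : QuasiPower X u a β r) (hY : QuasiPower Y u' b β' r')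
    (hx : x ≠ β) (hx' : x ≠ β')
    (hk : Tendsto (fun n : ℕ => (k n : ℝ) / n) atTop (𝓝 x)) :
    GeomSmall fun n => (∫ θ in (-Real.pi)..Real.pi, (∑ i ∈ Finset.range n, X i (θ * I) *
      Y (n - 1 - i) (θ * I)) * cexp (-(k n * (θ * I)))) -
      2 * Real.pi * (a 0 * b 0 * (uniformDensity (min β β') (max β β') x : ℝ)) := by
  have hout : x ∉ Set.Icc (min β β') (max β β') → ∀ σ : ℝ, |σ| = 1 → σ * β < σ * x →
      σ * β' < σ * x → GeomSmall fun n => (∫ θ in (-Real.pi)..Real.pi,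
      (∑ i ∈ Finset.range n, X i (θ * I) * Y (n - 1 - i) (θ * I)) * cexp (-(k n * (θ * I)))) -
      2 * Real.pi * (a 0 * b 0 * (uniformDensity (min β β') (max β β') x : ℝ)) :=
    fun h σ hσ h1 h2 => (geomSmall_convolution_outside hX hY hσ h1 h2 hk).congr fun n => by
      rw [uniformDensity, Set.indicator_of_notMem h]
      simp
  rcases lt_or_gt_of_ne hx with h1 | h1 <;> rcases lt_or_gt_of_ne hx' with h2 | h2
  · refine hout (fun h => ?_) (-1) (by simp) (by linarith) (by linarith)
    exact absurd h.1 (not_le.mpr (lt_min h1 h2))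
  · have hmem : x ∈ Set.Icc (min β β') (max β β') :=
      ⟨(min_le_right _ _).trans h2.le, h1.le.trans (le_max_left _ _)⟩
    -- Here the second drift is the smaller one, so the two sequences exchange roles; the
    -- convolution is symmetric under `i ↦ n - 1 - i`.
    refine (geomSmall_convolution hY hX h2 h1 hk).congr fun n => ?_
    rw [uniformDensity, Set.indicator_of_mem hmem, min_eq_right (h2.trans h1).le,
      max_eq_left (h2.trans h1).le]
    have hrefl : ∀ s : ℂ, ∑ i ∈ Finset.range n, Y i s * X (n - 1 - i) s =
        ∑ i ∈ Finset.range n, X i s * Y (n - 1 - i) s := fun s => by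
      rw [← Finset.sum_range_reflect]
      refine Finset.sum_congr rfl fun i hi => ?_
      have := Finset.mem_range.mp hi
      rw [show n - 1 - (n - 1 - i) = i by omega, mul_comm]
    simp only [hrefl]
    push_cast
    ring
  · have hmem : x ∈ Set.Icc (min β β') (max β β') :=
      ⟨(min_le_left _ _).trans h1.le, h2.le.trans (le_max_right _ _)⟩
    refine (geomSmall_convolution hX hY h1 h2 hk).congr fun n => ?_
    rw [uniformDensity, Set.indicator_of_mem hmem, min_eq_left (h1.trans h2).le,
      max_eq_right (h1.trans h2).le]
    push_cast
    ring
  · refine hout (fun h => ?_) 1 (by simp) (by linarith) (by linarith)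
    exact absurd h.2 (not_le.mpr (max_lt h1 h2))

theorem sum_norm_geometric_le {p : ℕ → ℂ} {C ρ : ℝ} (hC : 0 ≤ C) (hρ0 : 0 ≤ ρ) (hρ1 : ρ < 1)
    (hp : ∀ i, ‖p i‖ ≤ C * ρ ^ i) (n : ℕ) : ∑ i ∈ Finset.range n, ‖p i‖ ≤ C * (1 - ρ)⁻¹ := by
  refine (Finset.sum_le_sum fun i _ => hp i).trans ?_
  rw [← Finset.mul_sum]
  refine mul_le_mul_of_nonneg_left ?_ hC
  rw [← tsum_geometric_of_lt_one hρ0 hρ1]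
  exact (summable_geometric_of_lt_one hρ0 hρ1).sum_le_tsum _ fun i _ => pow_nonneg hρ0 i

theorem QuasiPower.norm_apply_zero_le (hX : QuasiPower X u a β r) :
    ∃ K : ℝ, 0 < K ∧ ∀ i, ‖X i 0‖ ≤ K := by
  obtain ⟨ρ, hρ0, hρ1, C, hC, hXa⟩ := hX.approx
  refine ⟨C + ‖a 0‖, by positivity, fun i => ?_⟩
  have h1 := hXa 0 (Metric.mem_ball_self hX.r_pos) i
  rw [hX.base_zero, one_pow, one_mul] at h1
  have h2 := norm_sub_norm_le (X i 0) (a 0)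
  have h3 : C * ρ ^ i ≤ C * 1 := mul_le_mul_of_nonneg_left (pow_le_one₀ hρ0.le hρ1.le) hC.le
  linarith

/-- At `s = 0` both bases equal 1, so each product differs from `a 0 * b 0` by errors that are
summable uniformly in `n`. -/
theorem convolution_apply_zero (hX : QuasiPower X u a β r) (hY : QuasiPower Y u' b β' r') :
    (fun n : ℕ => ∑ i ∈ Finset.range n, X i 0 * Y (n - 1 - i) 0 - n * (a 0 * b 0))
      =O[atTop] fun _ => (1 : ℝ) := by
  obtain ⟨ρ, hρ0, hρ1, C, hC, hXa⟩ := hX.approx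
  obtain ⟨ρ', hρ0', hρ1', C', hC', hYa⟩ := hY.approx
  obtain ⟨K, hK, hYK⟩ := hY.norm_apply_zero_le
  have hp : ∀ i, ‖X i 0 - a 0‖ ≤ C * ρ ^ i := fun i => by
    have := hXa 0 (Metric.mem_ball_self hX.r_pos) i
    rwa [hX.base_zero, one_pow, one_mul] at this
  have hq : ∀ i, ‖Y i 0 - b 0‖ ≤ C' * ρ' ^ i := fun i => by
    have := hYa 0 (Metric.mem_ball_self hY.r_pos) i
    rwa [hY.base_zero, one_pow, one_mul] at this
  refine IsBigO.of_bound (C * (1 - ρ)⁻¹ * K + ‖a 0‖ * (C' * (1 - ρ')⁻¹))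
    (Eventually.of_forall fun n => ?_)
  rw [norm_one, mul_one]
  have h1 : ∑ i ∈ Finset.range n, X i 0 * Y (n - 1 - i) 0 - n * (a 0 * b 0) =
      ∑ i ∈ Finset.range n, (X i 0 - a 0) * Y (n - 1 - i) 0 +
        a 0 * ∑ i ∈ Finset.range n, (Y i 0 - b 0) := by
    rw [← Finset.sum_range_reflect (fun i => Y i 0 - b 0), Finset.mul_sum,
      ← Finset.sum_add_distrib]
    have h2 : (n : ℂ) * (a 0 * b 0) = ∑ i ∈ Finset.range n, a 0 * b 0 := by simp
    rw [h2, ← Finset.sum_sub_distrib]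
    exact Finset.sum_congr rfl fun i _ => by ring
  rw [h1]
  refine (norm_add_le _ _).trans (add_le_add ?_ ?_)
  · refine (norm_sum_le _ _).trans ?_
    calc ∑ i ∈ Finset.range n, ‖(X i 0 - a 0) * Y (n - 1 - i) 0‖
        ≤ ∑ i ∈ Finset.range n, ‖X i 0 - a 0‖ * K := Finset.sum_le_sum fun i _ => by
          rw [norm_mul]
          exact mul_le_mul_of_nonneg_left (hYK _) (norm_nonneg _)
      _ ≤ _ := by
          rw [← Finset.sum_mul]
          exact mul_le_mul_of_nonneg_right (sum_norm_geometric_le hC.le hρ0.le hρ1 hp n) hK.le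
  · rw [norm_mul]
    exact mul_le_mul_of_nonneg_left ((norm_sum_le _ _).trans
      (sum_norm_geometric_le hC'.le hρ0'.le hρ1' hq n)) (norm_nonneg _)

/-- Dividing a geometrically convergent numerator by a denominator of linear growth. -/
theorem isBigO_quotient {num den : ℕ → ℝ} {κ f : ℝ} (hκ : 0 < κ)
    (h1 : GeomSmall fun n => (num n : ℂ) - (κ * f : ℝ))
    (h2 : (fun n : ℕ => den n - n * κ) =O[atTop] fun _ => (1 : ℝ)) :
    (fun n : ℕ => |(n : ℝ) * (num n / den n) - f|) =O[atTop]
      fun n : ℕ => (n : ℝ) ^ (-(1 / 2) : ℝ) := by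
  obtain ⟨q, hq0, hq1, hq⟩ := h1
  have hn : (fun n : ℕ => (n : ℝ) * (num n - κ * f)) =O[atTop] fun _ => (1 : ℝ) := by
    have g1 : (fun n : ℕ => num n - κ * f) =O[atTop] fun n => q ^ n :=
      (isBigO_of_le (g := fun n => (num n : ℂ) - (κ * f : ℝ)) _ fun n => by
        rw [← ofReal_sub, norm_real]).trans hq
    have g2 := (isBigO_refl (fun n : ℕ => (n : ℝ)) atTop).mul g1
    refine g2.trans (Tendsto.isBigO_one ℝ (c := 0) ?_)
    have := tendsto_pow_const_mul_const_pow_of_lt_one 1 hq0.le hq1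
    simpa using this
  have hden : ∀ᶠ n : ℕ in atTop, κ / 2 * n ≤ den n := by
    obtain ⟨C, hC⟩ := h2.bound
    filter_upwards [hC, tendsto_natCast_atTop_atTop.eventually_ge_atTop (2 * C / κ)] with n g1 g2
    rw [norm_one, mul_one, Real.norm_eq_abs] at g1
    have g3 := (abs_le.mp g1).1
    rw [div_le_iff₀ hκ] at g2
    linarith
  have key : (fun n : ℕ => (n : ℝ) * (num n - κ * f) - f * (den n - n * κ)) =O[atTop]
      fun _ => (1 : ℝ) := hn.sub (h2.const_mul_left f)
  obtain ⟨C, hC0, hC⟩ := key.exists_pos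
  refine IsBigO.of_bound (C / (κ / 2)) ?_
  filter_upwards [hC.bound, hden, eventually_ge_atTop 1] with n g1 g2 g3
  have hn1 : (1 : ℝ) ≤ n := by exact_mod_cast g3
  have hd : 0 < den n := lt_of_lt_of_le (by positivity) g2
  -- The terms `n κ f` cancel in this numerator, leaving it bounded; dividing by a denominator of
  -- linear growth gives `O(1/n)`.
  have g4 : (n : ℝ) * (num n / den n) - f =
      ((n : ℝ) * (num n - κ * f) - f * (den n - n * κ)) / den n := by
    field_simp
    ring
  rw [norm_one, mul_one, Real.norm_eq_abs] at g1
  rw [Real.norm_eq_abs, abs_abs, g4, abs_div, abs_of_pos hd,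
    Real.norm_of_nonneg (Real.rpow_nonneg (by positivity) _)]
  calc _ ≤ C / (κ / 2 * n) := div_le_div₀ hC0.le g1 (by positivity) g2
    _ = C / (κ / 2) * (n : ℝ) ^ (-1 : ℝ) := by
        rw [Real.rpow_neg_one]
        field_simp
    _ ≤ C / (κ / 2) * (n : ℝ) ^ (-(1 / 2) : ℝ) :=
        mul_le_mul_of_nonneg_left (Real.rpow_le_rpow_of_exponent_le hn1 (by norm_num))
          (by positivity)

end Outside

/-! ### From words to generating functions, and coefficient extraction -/

section Words

open Complex MeasureTheory

variable {ι : Type*} [Fintype ι] [DecidableEq ι]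

theorem sum_letter {E : Type*} [AddCommMonoid E] (f : Letter → E) :
    ∑ σ, f σ = f Letter.a + f Letter.b := by
  have : (Finset.univ : Finset Letter) = {Letter.a, Letter.b} := rfl
  rw [this, Finset.sum_pair (by decide)]

theorem sum_words_eq_pencil_pow (R : LinearRep ι) (s : ℂ) (n : ℕ) :
    ∑ w : Fin n → Letter, cexp (s * ((List.ofFn w).count Letter.a : ℕ)) •
      (R.μ (List.ofFn w)).map Complex.ofReal = pencil R.A R.B s ^ n := by
  induction n with
  | zero =>
    ext i j
    simp [LinearRep.μ, Matrix.one_apply]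
  | succ n ih =>
    rw [← (Fin.consEquiv fun _ : Fin (n + 1) => Letter).sum_comp, Fintype.sum_prod_type, sum_letter,
      pow_succ', ← ih, Finset.mul_sum, ← Finset.sum_add_distrib]
    refine Finset.sum_congr rfl fun w _ => ?_
    have hμ : ∀ σ : Letter, (R.μ (List.ofFn (Fin.cons σ w : Fin (n + 1) → Letter))).map
        Complex.ofReal = (letterMatrix R.A R.B σ).map Complex.ofReal *
          (R.μ (List.ofFn w)).map Complex.ofReal := fun σ => by
      rw [List.ofFn_cons, LinearRep.μ, List.map_cons, List.prod_cons]
      exact Matrix.map_mul (f := Complex.ofRealHom)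
    have hc : ∀ σ : Letter, (Fin.consEquiv fun _ : Fin (n + 1) => Letter) (σ, w) = Fin.cons σ w :=
      fun _ => rfl
    simp only [hc, hμ]
    rw [List.ofFn_cons, List.ofFn_cons, List.count_cons_self, List.count_cons_of_ne (by decide)]
    simp only [letterMatrix, pencil, add_mul, smul_mul_assoc, mul_smul_comm]
    rw [smul_add, smul_smul, ← Complex.exp_add]
    push_cast
    ring_nf

/-- The generating function of the weights `(r, w)` of the words of length `n` by number of
occurrences of `a`, at `e^s`. -/
theorem sum_series_mul_exp (R : LinearRep ι) (s : ℂ) (n : ℕ) :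
    ∑ w : Fin n → Letter, (R.series (List.ofFn w) : ℂ) *
      cexp (s * ((List.ofFn w).count Letter.a : ℕ)) =
    (fun i => (R.ξ i : ℂ)) ⬝ᵥ (pencil R.A R.B s ^ n) *ᵥ fun i => (R.η i : ℂ) := by
  rw [← sum_words_eq_pencil_pow, sum_mulVec, dotProduct_sum]
  refine Finset.sum_congr rfl fun w _ => ?_
  rw [smul_mulVec, dotProduct_smul, smul_eq_mul, mul_comm, LinearRep.series]
  congr 1
  simp [dotProduct, mulVec]

theorem integral_exp_mul_I (m k : ℕ) :
    ∫ θ in (-Real.pi)..Real.pi, cexp (θ * (I * m)) * cexp (-(k * (θ * I))) =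
      if m = k then 2 * (Real.pi : ℂ) else 0 := by
  have h : ∀ θ : ℝ, cexp (θ * (I * m)) * cexp (-(k * (θ * I))) = cexp (((m : ℂ) - k) * I * θ) :=
    fun θ => by
      rw [← Complex.exp_add]
      ring_nf
  simp only [h]
  split_ifs with hmk
  · subst hmk
    simp
    ring
  · have h0 : ((m : ℂ) - k) * I ≠ 0 :=
      mul_ne_zero (sub_ne_zero.mpr (by exact_mod_cast hmk)) I_ne_zero
    rw [integral_exp_mul_complex h0]
    have h1 : cexp (((m : ℂ) - k) * I * (Real.pi : ℝ)) =
        cexp (((m : ℂ) - k) * I * ((-Real.pi : ℝ) : ℂ)) := by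
      rw [Complex.exp_eq_exp_iff_exists_int]
      refine ⟨(m : ℤ) - k, ?_⟩
      push_cast
      ring
    rw [h1, sub_self, zero_div]

/-- Orthogonality of the characters `e^{imθ}` on `[-π, π]` keeps the words with exactly `k` letters
`a`. -/
theorem integral_series (R : LinearRep ι) (n k : ℕ) :
    ∫ θ in (-Real.pi)..Real.pi, ((fun i => (R.ξ i : ℂ)) ⬝ᵥ (pencil R.A R.B (θ * I) ^ n) *ᵥ
      fun i => (R.η i : ℂ)) * cexp (-(k * (θ * I))) =
    2 * Real.pi * ((∑ w : Fin n → Letter with (List.ofFn w).count Letter.a = k,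
      R.series (List.ofFn w) : ℝ) : ℂ) := by
  simp only [← sum_series_mul_exp, Finset.sum_mul, mul_assoc]
  rw [intervalIntegral.integral_finsetSum]
  · simp only [intervalIntegral.integral_const_mul]
    simp only [integral_exp_mul_I]
    rw [Complex.ofReal_sum, Finset.mul_sum, Finset.mul_sum, Finset.sum_filter]
    refine Finset.sum_congr rfl fun w _ => ?_
    split_ifs <;> ring
  · intro w _
    exact Continuous.intervalIntegrable (by fun_prop) _ _

theorem probY_eq (R : LinearRep ι) (n k : ℕ) :
    R.probY n k = (∑ w : Fin n → Letter with (List.ofFn w).count Letter.a = k,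
      R.series (List.ofFn w)) / ∑ w : Fin n → Letter, R.series (List.ofFn w) := by
  simp only [LinearRep.probY, LinearRep.wordProb, Finset.sum_div]

end Words

/-! ### Block triangular representations and normalisation -/

section Blocks

variable {ι₁ ι₂ : Type*} [Fintype ι₁] [DecidableEq ι₁] [Fintype ι₂] [DecidableEq ι₂]

/-- In the off-diagonal block, `i` steps in the first component precede the single crossing and the
remaining `n - 1 - i` steps follow it; for `n = 0` the sum is empty. -/
theorem fromBlocks_pow (M₁ : Matrix ι₁ ι₁ ℂ) (N : Matrix ι₁ ι₂ ℂ) (M₂ : Matrix ι₂ ι₂ ℂ) (n : ℕ) :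
    Matrix.fromBlocks M₁ N 0 M₂ ^ n = Matrix.fromBlocks (M₁ ^ n)
      (∑ i ∈ Finset.range n, M₁ ^ i * N * M₂ ^ (n - 1 - i)) 0 (M₂ ^ n) := by
  induction n with
  | zero => simp [Matrix.fromBlocks_one]
  | succ n ih =>
    rw [pow_succ, ih, Matrix.fromBlocks_multiply]
    simp only [Matrix.zero_mul, Matrix.mul_zero, add_zero, zero_add, ← pow_succ]
    congr 1
    rw [Finset.sum_range_succ, Nat.add_sub_cancel, Nat.sub_self, pow_zero, Matrix.mul_one,
      add_comm, Matrix.sum_mul]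
    congr 1
    refine Finset.sum_congr rfl fun i hi => ?_
    have := Finset.mem_range.mp hi
    rw [Matrix.mul_assoc, ← pow_succ]
    congr 2
    omega

omit [Fintype ι₁] [DecidableEq ι₁] [Fintype ι₂] [DecidableEq ι₂] in
theorem pencil_fromBlocks (A₁ B₁ : Matrix ι₁ ι₁ ℝ) (A₀ B₀ : Matrix ι₁ ι₂ ℝ) (A₂ B₂ : Matrix ι₂ ι₂ ℝ)
    (s : ℂ) : pencil (Matrix.fromBlocks A₁ A₀ 0 A₂) (Matrix.fromBlocks B₁ B₀ 0 B₂) s =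
      Matrix.fromBlocks (pencil A₁ B₁ s) (pencil A₀ B₀ s) 0 (pencil A₂ B₂ s) := by
  ext (i | i) (j | j) <;> simp [pencil_apply]

/-- Scaling both matrices of a linear representation. -/
noncomputable def LinearRep.scale {ι : Type*} (R : LinearRep ι) (c : ℝ) (hc : 0 ≤ c) :
    LinearRep ι where
  ξ := R.ξ
  A := c • R.A
  B := c • R.B
  η := R.η
  ξ_nonneg := R.ξ_nonneg
  A_nonneg i j := mul_nonneg hc (R.A_nonneg i j)
  B_nonneg i j := mul_nonneg hc (R.B_nonneg i j)
  η_nonneg := R.η_nonneg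

theorem series_scale {ι : Type*} [Fintype ι] [DecidableEq ι] (R : LinearRep ι) (c : ℝ)
    (hc : 0 ≤ c) (w : List Letter) : (R.scale c hc).series w = c ^ w.length * R.series w := by
  have hμ : (R.scale c hc).μ w = c ^ w.length • R.μ w := by
    induction w with
    | nil => simp [LinearRep.μ]
    | cons σ w ih =>
      have h1 : letterMatrix (R.scale c hc).A (R.scale c hc).B σ = c • letterMatrix R.A R.B σ := by
        cases σ <;> rfl
      simp only [LinearRep.μ, List.map_cons, List.prod_cons, List.length_cons] at ih ⊢
      rw [ih, h1, smul_mul_smul_comm, pow_succ']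
  rw [LinearRep.series, hμ, smul_mulVec, dotProduct_smul, smul_eq_mul]
  rfl

/-- Every word of length `n` gains the same factor `c ^ n`, which cancels in the quotient. -/
theorem probY_scale {ι : Type*} [Fintype ι] [DecidableEq ι] (R : LinearRep ι) {c : ℝ}
    (hc : 0 < c) (n k : ℕ) : (R.scale c hc.le).probY n k = R.probY n k := by
  simp only [probY_eq, series_scale, List.length_ofFn, ← Finset.mul_sum]
  exact mul_div_mul_left _ _ (pow_pos hc n).ne'

theorem pencilSeq_vecMulVec {ι : Type*} [Fintype ι] [DecidableEq ι] (A B : Matrix ι ι ℝ)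
    (x y : ι → ℝ) (m : ℕ) (s : ℂ) : pencilSeq 0 (vecMulVec x y) A B m s =
      (fun i => (x i : ℂ)) ⬝ᵥ (pencil A B s ^ m) *ᵥ fun i => (y i : ℂ) := by
  simp only [pencilSeq, pencil_apply, dotProduct, mulVec, Finset.mul_sum, vecMulVec_apply]
  refine Finset.sum_congr rfl fun i _ => Finset.sum_congr rfl fun j _ => ?_
  simp
  ring

/-- The generating function of a bicomponent representation splits into the generating functions
of the two components and a convolution. -/
theorem dotProduct_pencil_pow_mulVec_fromBlocks (A₁ B₁ : Matrix ι₁ ι₁ ℝ) (A₀ B₀ : Matrix ι₁ ι₂ ℝ)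
    (A₂ B₂ : Matrix ι₂ ι₂ ℝ) (ξ₁ η₁ : ι₁ → ℝ) (ξ₂ η₂ : ι₂ → ℝ) (s : ℂ) (n : ℕ) :
    (fun i => ((Sum.elim ξ₁ ξ₂ i : ℝ) : ℂ)) ⬝ᵥ (pencil (Matrix.fromBlocks A₁ A₀ 0 A₂)
        (Matrix.fromBlocks B₁ B₀ 0 B₂) s ^ n) *ᵥ (fun i => ((Sum.elim η₁ η₂ i : ℝ) : ℂ)) =
      pencilSeq 0 (vecMulVec ξ₁ η₁) A₁ B₁ n s + pencilSeq 0 (vecMulVec ξ₂ η₂) A₂ B₂ n s +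
      ∑ e, ∑ i ∈ Finset.range n,
        pencilSeq 0 (vecMulVec ξ₁ (Pi.single e 1)) A₁ B₁ i s *
        pencilSeq (vecMulVec (A₀ e) η₂) (vecMulVec (B₀ e) η₂) A₂ B₂ (n - 1 - i) s := by
  have h1 : (fun i => ((Sum.elim ξ₁ ξ₂ i : ℝ) : ℂ)) =
      Sum.elim (fun i => (ξ₁ i : ℂ)) (fun i => (ξ₂ i : ℂ)) := by
    ext (i | i) <;> rfl
  have h2 : (fun i => ((Sum.elim η₁ η₂ i : ℝ) : ℂ)) =
      Sum.elim (fun i => (η₁ i : ℂ)) (fun i => (η₂ i : ℂ)) := by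
    ext (i | i) <;> rfl
  have hX : ∀ (e : ι₁) (m : ℕ), pencilSeq 0 (vecMulVec ξ₁ (Pi.single e 1)) A₁ B₁ m s =
      ((fun i => (ξ₁ i : ℂ)) ᵥ* pencil A₁ B₁ s ^ m) e := by
    intro e m
    simp only [pencilSeq, pencil_apply, vecMul, dotProduct, vecMulVec_apply]
    refine Finset.sum_congr rfl fun i _ => ?_
    rw [Finset.sum_eq_single e]
    · simp
    · intro j _ hj
      simp [hj]
    · simp
  have hY : ∀ (e : ι₁) (m : ℕ),
      pencilSeq (vecMulVec (A₀ e) η₂) (vecMulVec (B₀ e) η₂) A₂ B₂ m s =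
      (pencil A₀ B₀ s *ᵥ ((pencil A₂ B₂ s ^ m) *ᵥ fun i => (η₂ i : ℂ))) e := by
    intro e m
    simp only [pencilSeq, pencil_apply, mulVec, dotProduct, vecMulVec_apply, Finset.mul_sum]
    refine Finset.sum_congr rfl fun i _ => Finset.sum_congr rfl fun j _ => ?_
    push_cast
    ring
  -- The matrix product at the crossing is opened up over the state `e` from which the path leaves
  -- the first component. Each summand becomes a product of two scalar sequences, and the crossing
  -- row of `A₀ e^s + B₀` goes into the coefficients of the second.
  rw [h1, h2, pencil_fromBlocks, fromBlocks_pow, fromBlocks_mulVec]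
  simp only [Sum.elim_comp_inl, Sum.elim_comp_inr, zero_mulVec, zero_add]
  rw [sumElim_dotProduct_sumElim, dotProduct_add, pencilSeq_vecMulVec A₁,
    pencilSeq_vecMulVec A₂, Finset.sum_comm, sum_mulVec, dotProduct_sum, add_right_comm]
  congr 1
  refine Finset.sum_congr rfl fun i _ => ?_
  simp only [hX, hY]
  rw [← mulVec_mulVec, ← mulVec_mulVec, dotProduct_mulVec]
  rfl

end Blocks

theorem exists_normalized_perron {ι : Type*} [Fintype ι] [DecidableEq ι] [Nonempty ι]
    {A B : Matrix ι ι ℝ} (hM : (A + B).IsPrimitive) :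
    0 < perronRoot (A + B) ∧
      ((perronRoot (A + B))⁻¹ • A + (perronRoot (A + B))⁻¹ • B).IsPrimitive ∧
      ∃ v l : ι → ℝ, (∀ i, 0 < v i) ∧ (∀ i, 0 < l i) ∧
        ((perronRoot (A + B))⁻¹ • A + (perronRoot (A + B))⁻¹ • B) *ᵥ v = v ∧
        l ᵥ* ((perronRoot (A + B))⁻¹ • A + (perronRoot (A + B))⁻¹ • B) = l ∧ l ⬝ᵥ v = 1 ∧
        beta A B = l ⬝ᵥ ((perronRoot (A + B))⁻¹ • A) *ᵥ v := by
  obtain ⟨t, ht, v, l, hv, hl, hMv, hlM, hlv⟩ := exists_perron_pair hM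
  have hv0 : v ≠ 0 := fun h => by
    obtain ⟨i⟩ := ‹Nonempty ι›
    exact (hv i).ne' (congrFun h i)
  have hroot := perronRoot_eq hM.nonneg ht hv0 hl hMv hlM
  rw [hroot]
  have h1 : (t⁻¹ • A + t⁻¹ • B).IsPrimitive := by
    rw [← smul_add]
    exact isPrimitive_smul hM (inv_pos.mpr ht)
  have h2 : (t⁻¹ • A + t⁻¹ • B) *ᵥ v = v := by
    rw [← smul_add, smul_mulVec, hMv, inv_smul_smul₀ ht.ne']
  have h3 : l ᵥ* (t⁻¹ • A + t⁻¹ • B) = l := by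
    rw [← smul_add, vecMul_smul, hlM, inv_smul_smul₀ ht.ne']
  exact ⟨ht, h1, v, l, hv, hl, h2, h3, hlv, beta_eq ht hroot h1 hv hl h2 h3 hlv⟩

theorem scale_fromBlocks {ι₁ ι₂ : Type*} (c : ℝ) (A₁ : Matrix ι₁ ι₁ ℝ) (A₀ : Matrix ι₁ ι₂ ℝ)
    (A₂ : Matrix ι₂ ι₂ ℝ) : c • Matrix.fromBlocks A₁ A₀ 0 A₂ =
      Matrix.fromBlocks (c • A₁) (c • A₀) 0 (c • A₂) := by
  rw [Matrix.fromBlocks_smul, smul_zero]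

theorem smul_apply_nonneg {ι κ : Type*} {c : ℝ} (hc : 0 ≤ c) {F : Matrix ι κ ℝ}
    (h : ∀ i j, 0 ≤ F i j) (i : ι) (j : κ) : 0 ≤ (c • F) i j :=
  mul_nonneg hc (h i j)

theorem vecMulVec_apply_nonneg {ι κ : Type*} {y : ι → ℝ} {z : κ → ℝ} (hy : ∀ i, 0 ≤ y i)
    (hz : ∀ j, 0 ≤ z j) (i : ι) (j : κ) : 0 ≤ vecMulVec y z i j :=
  mul_nonneg (hy i) (hz j)

theorem sum_mul_pos_of_ne_zero {ι : Type*} [Fintype ι] {x y : ι → ℝ} (hx : ∀ i, 0 ≤ x i)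
    (hx0 : x ≠ 0) (hy : ∀ i, 0 < y i) : 0 < ∑ i, x i * y i := by
  obtain ⟨j, hj⟩ := Function.ne_iff.mp hx0
  exact Finset.sum_pos' (fun i _ => mul_nonneg (hx i) (hy i).le)
    ⟨j, Finset.mem_univ _, mul_pos (lt_of_le_of_ne (hx j) (Ne.symm hj)) (hy j)⟩

end RationalModel

/-! ### Assembly of the local limit law -/

open RationalModel in
theorem mainTheorem3 {ι₁ ι₂ : Type*} [Fintype ι₁] [DecidableEq ι₁] [Fintype ι₂] [DecidableEq ι₂]
    (R : RationalModel.BicomponentModel ι₁ ι₂) (hR : R.IsEquipotent)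
    (hβ : R.fst.beta ≠ R.snd.beta)
    (h₁ : RationalModel.IsAperiodicPair R.fst.A R.fst.B)
    (h₂ : RationalModel.IsAperiodicPair R.snd.A R.snd.B)
    (k : ℕ → ℕ) (x : ℝ) (hx₁ : x ≠ R.fst.beta) (hx₂ : x ≠ R.snd.beta)
    (hk : Tendsto (fun n : ℕ => (k n : ℝ) / (n : ℝ)) atTop (𝓝 x)) :
    (fun n : ℕ => |(n : ℝ) * R.toLinearRep.probY n (k n)
        - RationalModel.uniformDensity (min R.fst.beta R.snd.beta) (max R.fst.beta R.snd.beta) x|)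
      =O[atTop] (fun n : ℕ => (n : ℝ) ^ (-(1 / 2) : ℝ)) := by
  obtain ⟨i₀, hi₀⟩ := Function.ne_iff.mp R.M₀_ne_zero
  obtain ⟨j₀, hij₀⟩ := Function.ne_iff.mp hi₀
  have : Nonempty ι₁ := ⟨i₀⟩
  have : Nonempty ι₂ := ⟨j₀⟩
  obtain ⟨ht, hM₁, v₁, l₁, hv₁, hl₁, hMv₁, hlM₁, hlv₁, hβ₁⟩ :=
    exists_normalized_perron (A := R.fst.A) (B := R.fst.B) hR.fst_primitive
  obtain ⟨-, hM₂, v₂, l₂, hv₂, hl₂, hMv₂, hlM₂, hlv₂, hβ₂⟩ :=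
    exists_normalized_perron (A := R.snd.A) (B := R.snd.B) hR.snd_primitive
  -- Equipotence lets one factor `c` normalise both components at once, as scaling the block
  -- representation requires.
  have hroot : perronRoot (R.snd.A + R.snd.B) = perronRoot (R.fst.A + R.fst.B) :=
    hR.perronRoot_eq.symm
  rw [hroot] at hM₂ hMv₂ hlM₂ hβ₂
  set t := perronRoot (R.fst.A + R.fst.B) with ht_def
  set c := t⁻¹ with hc_def
  have hc : 0 < c := inv_pos.mpr ht
  obtain ⟨u₁, r₁, hQ₁⟩ := exists_quasiPower (smul_apply_nonneg hc.le R.fst.A_nonneg)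
    (smul_apply_nonneg hc.le R.fst.B_nonneg) hM₁
    (isAperiodicPair_smul hc h₁) hv₁ hl₁ hMv₁ hlM₁ hlv₁
  obtain ⟨u₂, r₂, hQ₂⟩ := exists_quasiPower (smul_apply_nonneg hc.le R.snd.A_nonneg)
    (smul_apply_nonneg hc.le R.snd.B_nonneg) hM₂
    (isAperiodicPair_smul hc h₂) hv₂ hl₂ hMv₂ hlM₂ hlv₂
  rw [← hβ₁] at hQ₁
  rw [← hβ₂] at hQ₂
  have hsingle : ∀ e i : ι₁, (0 : ℝ) ≤ (Pi.single e 1 : ι₁ → ℝ) i := fun e i => by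
    rw [Pi.single_apply]
    split_ifs <;> norm_num
  obtain ⟨z₁, -, hZ₁⟩ := hQ₁ 0 (vecMulVec R.fst.ξ R.fst.η) (fun _ _ => le_rfl)
    (vecMulVec_apply_nonneg R.fst.ξ_nonneg R.fst.η_nonneg)
  obtain ⟨z₂, -, hZ₂⟩ := hQ₂ 0 (vecMulVec R.snd.ξ R.snd.η) (fun _ _ => le_rfl)
    (vecMulVec_apply_nonneg R.snd.ξ_nonneg R.snd.η_nonneg)
  choose a ha hX using fun e => hQ₁ 0 (vecMulVec R.fst.ξ (Pi.single e 1)) (fun _ _ => le_rfl)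
    (vecMulVec_apply_nonneg R.fst.ξ_nonneg (hsingle e))
  choose b hb hY using fun e => hQ₂ (vecMulVec ((c • R.A₀) e) R.snd.η)
    (vecMulVec ((c • R.B₀) e) R.snd.η)
    (vecMulVec_apply_nonneg (smul_apply_nonneg hc.le R.A₀_nonneg e) R.snd.η_nonneg)
    (vecMulVec_apply_nonneg (smul_apply_nonneg hc.le R.B₀_nonneg e) R.snd.η_nonneg)
  -- `κ` is the sum over `e` of the leading coefficients `a e 0 * b e 0`, that is `c (ξ₁ ⬝ v₁)(l₁ ⬝
  -- M₀ v₂)(l₂ ⬝ η₂)` with `M₀ = A₀ + B₀`. It is both the growth rate of the denominator and the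
  -- factor in the limit of the numerator.
  set κ : ℝ := ∑ e, (∑ i, R.fst.ξ i * v₁ i) * l₁ e *
    ((∑ f, (c • R.A₀ + c • R.B₀) e f * v₂ f) * ∑ g, R.snd.η g * l₂ g) with hκ
  have hκ0 : 0 < κ := by
    have g1 := sum_mul_pos_of_ne_zero R.fst.ξ_nonneg R.fst_ξ_ne_zero hv₁
    have g2 := sum_mul_pos_of_ne_zero R.snd.η_nonneg R.snd_η_ne_zero hl₂
    have g3 : ∀ i j, 0 ≤ (c • R.A₀ + c • R.B₀) i j := fun i j =>
      add_nonneg (smul_apply_nonneg hc.le R.A₀_nonneg i j) (smul_apply_nonneg hc.le R.B₀_nonneg i j)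
    refine Finset.sum_pos' (fun e _ => mul_nonneg (mul_nonneg g1.le (hl₁ e).le)
      (mul_nonneg (Finset.sum_nonneg fun f _ => mul_nonneg (g3 e f) (hv₂ f).le) g2.le))
      ⟨i₀, Finset.mem_univ _, mul_pos (mul_pos g1 (hl₁ i₀)) (mul_pos ?_ g2)⟩
    refine sum_mul_pos_of_ne_zero (g3 i₀) (fun h => hij₀ ?_) hv₂
    have g4 : c * (R.A₀ + R.B₀) i₀ j₀ = 0 := by
      have := congrFun h j₀
      rwa [← smul_add] at this
    exact (mul_eq_zero.mp g4).resolve_left hc.ne'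
  have hab : ∑ e, a e 0 * b e 0 = (κ : ℂ) := by
    rw [hκ, Complex.ofReal_sum]
    refine Finset.sum_congr rfl fun e _ => ?_
    have g1 : ∑ i, ∑ j, ((0 : Matrix ι₁ ι₁ ℝ) i j + vecMulVec R.fst.ξ (Pi.single e 1) i j) *
        (v₁ i * l₁ j) = (∑ i, R.fst.ξ i * v₁ i) * l₁ e := by
      rw [Finset.sum_mul]
      refine Finset.sum_congr rfl fun i _ => ?_
      rw [Finset.sum_eq_single e]
      · simp [vecMulVec_apply]
        ring
      · intro j _ hj
        simp [vecMulVec_apply, hj]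
      · simp
    have g2 : ∑ i, ∑ j, (vecMulVec ((c • R.A₀) e) R.snd.η i j +
        vecMulVec ((c • R.B₀) e) R.snd.η i j) * (v₂ i * l₂ j) =
        (∑ f, (c • R.A₀ + c • R.B₀) e f * v₂ f) * ∑ g, R.snd.η g * l₂ g := by
      rw [Finset.sum_mul_sum]
      refine Finset.sum_congr rfl fun i _ => Finset.sum_congr rfl fun j _ => ?_
      simp only [vecMulVec_apply, Matrix.add_apply]
      ring
    rw [ha, hb, g1, g2]
    push_cast
    ring
  set f := uniformDensity (min R.fst.beta R.snd.beta) (max R.fst.beta R.snd.beta) x with hf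
  set S := R.toLinearRep.scale c hc.le with hS
  have hgen : ∀ (n : ℕ) (s : ℂ), (fun i => (S.ξ i : ℂ)) ⬝ᵥ (pencil S.A S.B s ^ n) *ᵥ
      (fun i => (S.η i : ℂ)) =
      pencilSeq 0 (vecMulVec R.fst.ξ R.fst.η) (c • R.fst.A) (c • R.fst.B) n s +
      pencilSeq 0 (vecMulVec R.snd.ξ R.snd.η) (c • R.snd.A) (c • R.snd.B) n s +
      ∑ e, ∑ i ∈ Finset.range n,
        pencilSeq 0 (vecMulVec R.fst.ξ (Pi.single e 1)) (c • R.fst.A) (c • R.fst.B) i s *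
        pencilSeq (vecMulVec ((c • R.A₀) e) R.snd.η) (vecMulVec ((c • R.B₀) e) R.snd.η)
          (c • R.snd.A) (c • R.snd.B) (n - 1 - i) s := by
    intro n s
    rw [← dotProduct_pencil_pow_mulVec_fromBlocks, ← scale_fromBlocks, ← scale_fromBlocks]
    rfl
  set num : ℕ → ℝ := fun n => ∑ w : Fin n → Letter with (List.ofFn w).count Letter.a = k n,
    S.series (List.ofFn w) with hnum
  set den : ℕ → ℝ := fun n => ∑ w : Fin n → Letter, S.series (List.ofFn w) with hden
  have hprob : ∀ n, R.toLinearRep.probY n (k n) = num n / den n := fun n => by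
    rw [← probY_scale R.toLinearRep hc, probY_eq]
  simp only [hprob]
  refine isBigO_quotient hκ0 ?_ ?_
  -- Numerator: the generating function is integrated term by term. The two single-component terms
  -- are negligible, and the convolutions for the various `e` add up to `2π κ f`.
  · have g := ((hZ₁.geomSmall_integral hx₁ hk).add (hZ₂.geomSmall_integral hx₂ hk)).add
      (GeomSmall.sum Finset.univ fun e _ =>
        geomSmall_convolution_density (hX e) (hY e) hx₁ hx₂ hk)
    refine (g.const_mul (2 * Real.pi : ℂ)⁻¹).congr fun n => ?_
    have h2π : (2 * Real.pi : ℂ) ≠ 0 := by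
      exact_mod_cast Real.two_pi_pos.ne'
    have hcont : ∀ {Z : ℕ → ℂ → ℂ} {u a : ℂ → ℂ} {β r : ℝ}, QuasiPower Z u a β r →
        ∀ m, Continuous fun θ : ℝ => Z m (θ * Complex.I) := fun h m =>
      (h.differentiable m).continuous.comp (by fun_prop)
    have hexp : Continuous fun θ : ℝ => Complex.exp (-(k n * (θ * Complex.I))) := by fun_prop
    have hconv : ∀ e, Continuous fun θ : ℝ => (∑ i ∈ Finset.range n,
        pencilSeq 0 (vecMulVec R.fst.ξ (Pi.single e 1)) (c • R.fst.A) (c • R.fst.B) i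
          (θ * Complex.I) *
        pencilSeq (vecMulVec ((c • R.A₀) e) R.snd.η) (vecMulVec ((c • R.B₀) e) R.snd.η)
          (c • R.snd.A) (c • R.snd.B) (n - 1 - i) (θ * Complex.I)) *
        Complex.exp (-(k n * (θ * Complex.I))) := fun e =>
      (continuous_finsetSum _ fun i _ => (hcont (hX e) i).mul (hcont (hY e) _)).mul hexp
    have c1 : Continuous fun θ : ℝ => pencilSeq 0 (vecMulVec R.fst.ξ R.fst.η) (c • R.fst.A)
        (c • R.fst.B) n (θ * Complex.I) * Complex.exp (-(k n * (θ * Complex.I))) :=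
      (hcont hZ₁ n).mul hexp
    have c2 : Continuous fun θ : ℝ => pencilSeq 0 (vecMulVec R.snd.ξ R.snd.η) (c • R.snd.A)
        (c • R.snd.B) n (θ * Complex.I) * Complex.exp (-(k n * (θ * Complex.I))) :=
      (hcont hZ₂ n).mul hexp
    have hint := integral_series S n (k n)
    simp only [hgen, add_mul] at hint
    simp only [Finset.sum_mul Finset.univ] at hint
    rw [intervalIntegral.integral_add (Continuous.intervalIntegrable (c1.fun_add c2) _ _)
        ((continuous_finsetSum _ fun e _ => hconv e).intervalIntegrable _ _),
      intervalIntegral.integral_add (c1.intervalIntegrable _ _) (c2.intervalIntegrable _ _),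
      intervalIntegral.integral_finsetSum fun e _ => (hconv e).intervalIntegrable _ _] at hint
    rw [Finset.sum_sub_distrib, ← Finset.mul_sum, ← Finset.sum_mul, hab, ← add_sub_assoc, hint,
      ← mul_sub, inv_mul_cancel_left₀ h2π, Complex.ofReal_mul]
    rfl
  -- Denominator: the total weight is the generating function at `s = 0`, where the single-component
  -- terms are bounded and the convolutions grow like `n κ`.
  · obtain ⟨K₁, -, hK₁⟩ := hZ₁.norm_apply_zero_le
    obtain ⟨K₂, -, hK₂⟩ := hZ₂.norm_apply_zero_le
    have g := ((IsBigO.of_bound (g := fun _ : ℕ => (1 : ℝ)) (l := atTop) K₁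
      (Eventually.of_forall fun n => by simpa using hK₁ n)).add
      (IsBigO.of_bound (g := fun _ : ℕ => (1 : ℝ)) K₂
      (Eventually.of_forall fun n => by simpa using hK₂ n))).add
      (IsBigO.sum (s := Finset.univ) fun e _ => convolution_apply_zero (hX e) (hY e))
    refine (isBigO_of_le _ fun n => le_of_eq ?_).trans g
    rw [← Complex.norm_real]
    congr 1
    have h1 : (den n : ℂ) = ∑ w : Fin n → Letter, (S.series (List.ofFn w) : ℂ) *
        Complex.exp (0 * ((List.ofFn w).count Letter.a : ℕ)) := by
      simp [hden]
    rw [Complex.ofReal_sub, h1, sum_series_mul_exp, hgen, Complex.ofReal_mul, ← hab,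
      Finset.sum_apply, Finset.sum_sub_distrib, ← Finset.mul_sum, Complex.ofReal_natCast,
      add_sub_assoc]
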